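/- **Setting.** Fix a set of base types $b$ and a set of operation symbols $\mathtt{op}$. *Effect theories.* Ground types are $\hat A ::= b \mid \hat A_1\times\dots\times\hat A_n \mid \hat A_1+\dots+\hat A_n$ ($n\ge 0$). Ground terms are $\hat V ::= x \mid \langle \hat V_1,\dots,\hat V_n\rangle \mid \pi_i\,\hat V \mid \iota_i\,\hat V$. A signature $\Sigma$ is a finite partial function that assigns to an operation symbol a pair of ground types, written $(\mathtt{op}:\hat A_{\mathtt{op}}\rightarrowtriangle\hat B_{\mathtt{op}})\in\Sigma$. Effect theory terms are $\hat M ::= \mathtt{return}\,\hat V \mid \mathtt{let}\,x=\mathtt{op}(\hat V)\,\mathtt{in}\,\hat M \mid \mathtt{case}\,\hat V\,\mathtt{of}\,\{\iota_i\,x_i\mapsto\hat M_i\}_{i=1}^n$, with the evident typing $\hat\Delta\vdash\hat M:\hat A!\Sigma$ for ground contexts $\hat\Delta$. An effect theory is a pair $\mathcal T=(\Sigma,\mathcal E)$, where $\mathcal E$ is a set of equational axioms $\hat\Delta\vdash\hat M\sim\hat N:\hat A!\Sigma$. *The calculus $\lambda_{\mathrm{eff}}^{\mathcal E}$.* Value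 types are $A ::= b\mid A\to C\mid A_1\times\dots\times A_n\mid A_1+\dots+A_n$, computation types are $C ::= A!\Sigma/\mathcal E$, and handler types are $\Sigma\Rightarrow C$. Terms are type-annotated and taken up to renaming of bound variables: $$V ::= x\mid\lambda x.M\mid\langle V_1,\dots,V_n\rangle\mid\pi_i\,V\mid\iota_i\,V,$$ $$M ::= V\,W\mid\mathtt{return}\,V\mid\mathtt{let}\,x=M\,\mathtt{in}\,N\mid\mathtt{op}(V)\mid\mathtt{case}\,V\,\mathtt{of}\,\{\iota_i\,x_i\mapsto M_i\}_i\mid\mathtt{handle}\,M\,\mathtt{with}\,H\,\mathtt{to}\,x.N,$$ and a handler $\Gamma\vdash H:\Sigma\Rightarrow C$ consists of one clause $\Gamma,x:\hat A_{\mathtt{op}},k:\hat B_{\mathtt{op}}\to C\vdash M_{\mathtt{op}}:C$ for each $\mathtt{op}\in\Sigma$. Typing and derivable equality $\Gamma\vdash M=N:C$ (likewise for values and handlers) are defined by simultaneous induction. The typing rules are the usual ones of fine-grain call-by-value with $\mathtt{op}(V):\hat B_{\mathtt{op}}!\Sigma/\mathcal E$ for $V:\hat A_{\mathtt{op}}$;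 and $\mathtt{handle}\,M\,\mathtt{with}\,H\,\mathtt{to}\,x.N:C$ is well typed if $\Gamma\vdash M:A!\Sigma/\mathcal E$, $\Gamma,x:A\vdash N:C$, and $\Gamma\vdash H:\Sigma\Rightarrow C$ *respects* $\mathcal E$, i.e. $\Gamma,\hat\Delta,k:\hat A\to C\vdash\hat M[H,k]=\hat N[H,k]:C$ is derivable for every axiom $\hat\Delta\vdash\hat M\sim\hat N:\hat A!\Sigma$ in $\mathcal E$, where $(\mathtt{return}\,\hat V)[H,k]=k\,\hat V$, $(\mathtt{let}\,x=\mathtt{op}(\hat V)\,\mathtt{in}\,\hat N)[H,k]=M_{\mathtt{op}}[\hat V/x,\lambda x.\hat N[H,k]/k']$ for the clause $\mathtt{op}(x,k')\mapsto M_{\mathtt{op}}$ of $H$, and $[H,k]$ commutes with $\mathtt{case}$. Derivable equality is the least congruence on well-typed terms (clausewise on handlers) that contains the $\beta$- and $\eta$-laws for functions, products and sums, namely for sums $\mathtt{case}\,\iota_i V\,\mathtt{of}\,\{\iota_j x_j\mapsto M_j\}_j=M_i[V/x_i]$ and $\mathtt{case}\,V\,\mathtt{of}\,\{\iota_i y\mapsto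 M[\iota_i y/x]\}_i=M[V/x]$; the three monad laws for $\mathtt{return}$ and $\mathtt{let}$; the laws $$\mathtt{handle}\,(\mathtt{return}\,V)\,\mathtt{with}\,H\,\mathtt{to}\,x.N=N[V/x],$$ $$\mathtt{handle}\,(\mathtt{let}\,x=L\,\mathtt{in}\,M)\,\mathtt{with}\,H\,\mathtt{to}\,y.N=\mathtt{handle}\,L\,\mathtt{with}\,H\,\mathtt{to}\,x.(\mathtt{handle}\,M\,\mathtt{with}\,H\,\mathtt{to}\,y.N),$$ $$\mathtt{handle}\,\mathtt{op}(V)\,\mathtt{with}\,H\,\mathtt{to}\,x.N=M_{\mathtt{op}}[V/x,\lambda x.N/k];$$ and, for each axiom $\hat\Delta\vdash\hat M\sim\hat N:\hat A!\Sigma$ in $\mathcal E$ and each substitution $\sigma:\Gamma\to\hat\Delta$ of well-typed values, the equation $\Gamma\vdash\hat M[\sigma]=\hat N[\sigma]:\hat A!\Sigma/\mathcal E$. *Models.* A $\lambda_{\mathrm{eff}}^{\mathcal E}$-model consists of the following. (1) A category $\mathbb C$ with (chosen) finite products, an object $[\![b]\!]$ for each base type, and a strong monad $T_{\mathcal T}$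 on $\mathbb C$ for each effect theory $\mathcal T$. (2) Kleisli exponentials $Y\Rightarrow_{\mathcal T}Z$, i.e. bijections $\Lambda:\mathbb C(X\times Y,T_{\mathcal T}Z)\cong\mathbb C(X,Y\Rightarrow_{\mathcal T}Z)$ natural in $X$, with $\mathrm{ev}=\Lambda^{-1}(\mathrm{id})$. (3) Joint distributive Kleisli coproducts: for each finite family $(X_i)_i$ an object $\sum_iX_i$ with morphisms $\iota_i:X_i\to\sum_iX_i$ such that for all $\mathcal T,Z,Y$ and $f_i:Z\times X_i\to T_{\mathcal T}Y$ there is a unique $[f_i]_i:Z\times\sum_iX_i\to T_{\mathcal T}Y$ with $[f_i]_i\circ(\mathrm{id}\times\iota_i)=f_i$ for all $i$. These data interpret value types, with $[\![A\to B!\mathcal T]\!]=[\![A]\!]\Rightarrow_{\mathcal T}[\![B]\!]$, as well as contexts and ground terms. Put $$\mathrm{Alg}^{\mathcal T'}_\Sigma(X)=\prod_{\mathtt{op}\in\Sigma}\bigl([\![\hat A_{\mathtt{op}}]\!]\times([\![\hat B_{\mathtt{op}}]\!]\Rightarrow_{\mathcal T'}X)\bigr)\Rightarrow_{\mathcal T'}X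 .$$ For $\hat\Delta\vdash\hat M:\hat A!\Sigma$ define $(\!|\hat M|\!):\mathrm{Alg}^{\mathcal T'}_\Sigma(X)\to([\![\hat\Delta]\!]\times([\![\hat A]\!]\Rightarrow_{\mathcal T'}X))\Rightarrow_{\mathcal T'}X$ by recursion; in elements $(h,(d,k))$ its transpose $\Lambda^{-1}(\!|\hat M|\!)$ is $\mathrm{ev}(k,[\![\hat V]\!](d))$ for $\mathtt{return}\,\hat V$; $\mathrm{ev}\bigl(\pi_{\mathtt{op}}h,([\![\hat V]\!](d),\Lambda(y\mapsto\Lambda^{-1}(\!|\hat N|\!)(h,((d,y),k))))\bigr)$ for $\mathtt{let}\,x=\mathtt{op}(\hat V)\,\mathtt{in}\,\hat N$; and the Kleisli copairing of the $y\mapsto\Lambda^{-1}(\!|\hat M_i|\!)(h,((d,y),k))$ applied to $[\![\hat V]\!](d)$ for $\mathtt{case}$. A morphism $h:Z\to\mathrm{Alg}^{\mathcal T'}_\Sigma(X)$ *satisfies* $\mathcal E$ if $(\!|\hat M|\!)\circ h=(\!|\hat N|\!)\circ h$ for all axioms $\hat M\sim\hat N$ in $\mathcal E$; such $h$ form a subpresheaf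 $H_{\mathcal T}$ of $\mathbb C(-,\mathrm{Alg}^{\mathcal T'}_\Sigma(X))$. (4) For each $\mathcal T=(\Sigma,\mathcal E)$ and $\mathtt{op}\in\Sigma$ a morphism $[\![\mathtt{op}]\!]_{\mathcal T}:[\![\hat A_{\mathtt{op}}]\!]\to T_{\mathcal T}[\![\hat B_{\mathtt{op}}]\!]$ such that $[\![\hat M]\!]=[\![\hat N]\!]$ for all axioms in $\mathcal E$, where $[\![\mathtt{return}\,\hat V]\!]=\eta\circ[\![\hat V]\!]$, $[\![\mathtt{let}\,x=\mathtt{op}(\hat V)\,\mathtt{in}\,\hat M]\!]=\mu\circ T[\![\hat M]\!]\circ\mathrm{st}\circ\langle\mathrm{id},[\![\mathtt{op}]\!]\circ[\![\hat V]\!]\rangle$, and $[\![\mathtt{case}\,\hat V\,\mathtt{of}\,\{\iota_i x_i\mapsto\hat M_i\}]\!]=[[\![\hat M_i]\!]]_i\circ\langle\mathrm{id},[\![\hat V]\!]\rangle$. (5) For all $\mathcal T,\mathcal T'$ and $X\in\mathbb C$ a natural transformation $\mathbf{handle}:H_{\mathcal T}\times\mathbb C(-,T_{\mathcal T}T_{\mathcal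 T'}X)\to\mathbb C(-,T_{\mathcal T'}X)$ such that for $h\in H_{\mathcal T}(Z)$ and all $f$ of suitable type $$\mathbf{handle}(h,\eta\circ f)=f,$$ $$\mathbf{handle}(h,\mu\circ f)=\mathbf{handle}(h,T_{\mathcal T}(\mathbf{handle}(h\circ\pi_1,\pi_2))\circ\mathrm{st}\circ\langle\mathrm{id},f\rangle),$$ $$\mathbf{handle}(h,T_{\mathcal T}\mathrm{ev}\circ\mathrm{st}\circ\mathrm{swap}\circ([\![\mathtt{op}]\!]_{\mathcal T}\times\mathrm{id})\circ f)=\mathrm{ev}\circ\langle\pi_{\mathtt{op}}\circ h,f\rangle .$$ *Interpretation.* In a model, typed terms are interpreted by partially defined morphisms $[\![V]\!]:[\![\Gamma]\!]\to[\![A]\!]$, $[\![M]\!]:[\![\Gamma]\!]\to T_{\mathcal T}[\![A]\!]$ and $[\![H]\!]=\langle\Lambda([\![M_{\mathtt{op}}]\!]\circ\alpha^{-1})\rangle_{\mathtt{op}\in\Sigma}:[\![\Gamma]\!]\to\mathrm{Alg}^{\mathcal T'}_\Sigma([\![B]\!])$ for $H:\Sigma\Rightarrow B!\mathcal T'$,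 where $\alpha$ is the associativity isomorphism of products. The clauses are the standard ones of fine-grain call-by-value, $[\![\mathtt{op}(V)]\!]=[\![\mathtt{op}]\!]_{\mathcal T}\circ[\![V]\!]$, and $$[\![\mathtt{handle}\,M\,\mathtt{with}\,H\,\mathtt{to}\,x.N]\!]=\mathbf{handle}([\![H]\!],T_{\mathcal T}[\![N]\!]\circ\mathrm{st}\circ\langle\mathrm{id},[\![M]\!]\rangle)$$ if $[\![H]\!]\in H_{\mathcal T}([\![\Gamma]\!])$, and undefined otherwise. **Theorem (completeness).** Let $\Gamma\vdash M:A!\Sigma/\mathcal E$ and $\Gamma\vdash N:A!\Sigma/\mathcal E$ be well-typed computation terms of $\lambda_{\mathrm{eff}}^{\mathcal E}$. If $[\![M]\!]=[\![N]\!]$ in every $\lambda_{\mathrm{eff}}^{\mathcal E}$-model, then $\Gamma\vdash M=N:A!\Sigma/\mathcal E$ is derivable. The same holds for well-typed value terms $\Gamma\vdash V,W:A$ and for well-typed handlers $\Gamma\vdash H,H':\Sigma\Rightarrow C$. -/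

import Mathlib

open CategoryTheory MonoidalCategory CartesianMonoidalCategory

universe u v w

-- so that `X ⟶ Y` always elaborates to the hom-sets of the category structure itself
attribute [-instance] CategoryTheory.catToReflQuiver

namespace EffCalc

/-! ## Ground types, signatures, effect theory terms, effect theories -/

/-- Ground types: base types, finite products and finite sums. -/
inductive GTy (Base : Type u) : Type u
  | base (b : Base) : GTy Base
  | prod {n : ℕ} (A : Fin n → GTy Base) : GTy Base
  | sum {n : ℕ} (A : Fin n → GTy Base) : GTy Base

/-- Operation signatures: a finite set of operation symbols, each with an argument type and a
result type, both ground. -/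
structure Sig (Base Op : Type u) : Type u where
  ops : Finset Op
  arg : {o : Op // o ∈ ops} → GTy Base
  res : {o : Op // o ∈ ops} → GTy Base

/-- The operation symbols of a signature. -/
abbrev Sig.Idx {Base Op : Type u} (S : Sig Base Op) : Type u := {o : Op // o ∈ S.ops}

/-- Typed de Bruijn variables. A context is a list whose head is the most recent variable. -/
inductive Var {α : Type u} : List α → α → Type u
  | zero {Γ : List α} {a : α} : Var (a :: Γ) a
  | succ {Γ : List α} {a b : α} (x : Var Γ a) : Var (b :: Γ) a

/-- Ground terms `Δ ⊢ V : A`. -/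
inductive GTm {Base : Type u} : List (GTy Base) → GTy Base → Type u
  | var {Δ : List (GTy Base)} {A : GTy Base} (x : Var Δ A) : GTm Δ A
  | tuple {Δ : List (GTy Base)} {n : ℕ} {A : Fin n → GTy Base}
      (V : ∀ i, GTm Δ (A i)) : GTm Δ (.prod A)
  | proj {Δ : List (GTy Base)} {n : ℕ} {A : Fin n → GTy Base}
      (i : Fin n) (V : GTm Δ (.prod A)) : GTm Δ (A i)
  | inj {Δ : List (GTy Base)} {n : ℕ} {A : Fin n → GTy Base}
      (i : Fin n) (V : GTm Δ (A i)) : GTm Δ (.sum A)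

/-- Effect theory terms `Δ ⊢ M : A ! S`; `letop o V M` is `let x = o(V) in M`. -/
inductive ETm {Base Op : Type u} (S : Sig Base Op) : List (GTy Base) → GTy Base → Type u
  | ret {Δ : List (GTy Base)} {A : GTy Base} (V : GTm Δ A) : ETm S Δ A
  | letop {Δ : List (GTy Base)} {A : GTy Base} (o : S.Idx) (V : GTm Δ (S.arg o))
      (M : ETm S (S.res o :: Δ) A) : ETm S Δ A
  | case {Δ : List (GTy Base)} {A : GTy Base} {n : ℕ} {B : Fin n → GTy Base}
      (V : GTm Δ (.sum B)) (M : ∀ i, ETm S (B i :: Δ) A) : ETm S Δ A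

/-- Equational axioms `Δ ⊢ lhs ∼ rhs : A ! S`. -/
structure EqAx {Base Op : Type u} (S : Sig Base Op) : Type u where
  ctx : List (GTy Base)
  ty : GTy Base
  lhs : ETm S ctx ty
  rhs : ETm S ctx ty

/-- Effect theories `(Σ, ℰ)`. -/
structure Theory (Base Op : Type u) : Type u where
  sig : Sig Base Op
  ax : Set (EqAx sig)

/-! ## Types and terms of the calculus -/

/-- Value types; `fn A B 𝒯` is the function type `A → B ! 𝒯`. -/
inductive Ty (Base Op : Type u) : Type u
  | base (b : Base) : Ty Base Op
  | fn (A B : Ty Base Op) (𝒯 : Theory Base Op) : Ty Base Op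
  | prod {n : ℕ} (A : Fin n → Ty Base Op) : Ty Base Op
  | sum {n : ℕ} (A : Fin n → Ty Base Op) : Ty Base Op

/-- Ground types as value types. -/
def GTy.toTy {Base : Type u} (Op : Type u) : GTy Base → Ty Base Op
  | .base b => .base b
  | .prod A => .prod fun i => (A i).toTy Op
  | .sum A => .sum fun i => (A i).toTy Op

/-- The argument type of an operation, as a value type. -/
abbrev Sig.argTy {Base Op : Type u} (S : Sig Base Op) (o : S.Idx) : Ty Base Op :=
  (S.arg o).toTy Op

/-- The result type of an operation, as a value type. -/
abbrev Sig.resTy {Base Op : Type u} (S : Sig Base Op) (o : S.Idx) : Ty Base Op :=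
  (S.res o).toTy Op

/-- What a term is classified by: a value type `A`, or a computation type `A ! 𝒯`. -/
inductive Kind (Base Op : Type u) : Type u
  | val (A : Ty Base Op) : Kind Base Op
  | cmp (A : Ty Base Op) (𝒯 : Theory Base Op) : Kind Base Op

abbrev Ctx (Base Op : Type u) : Type u := List (Ty Base Op)

/-- Type-annotated terms in context, up to renaming of bound variables. They obey all typing rules
except the side condition that a handler used in `handle` has to respect the axioms of the handled
theory; that condition is imposed by `Tm.Wf`, which is defined together with the equational
theory. In `handle M H N`, the clause `H o` lives in the context `Γ, x : A_o, k : B_o → C`. -/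
inductive Tm {Base Op : Type u} : Ctx Base Op → Kind Base Op → Type u
  | var {Γ : Ctx Base Op} {A : Ty Base Op} (x : Var Γ A) : Tm Γ (.val A)
  | lam {Γ : Ctx Base Op} {A B : Ty Base Op} {𝒯 : Theory Base Op}
      (M : Tm (A :: Γ) (.cmp B 𝒯)) : Tm Γ (.val (.fn A B 𝒯))
  | tuple {Γ : Ctx Base Op} {n : ℕ} {A : Fin n → Ty Base Op}
      (V : ∀ i, Tm Γ (.val (A i))) : Tm Γ (.val (.prod A))
  | proj {Γ : Ctx Base Op} {n : ℕ} {A : Fin n → Ty Base Op}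
      (i : Fin n) (V : Tm Γ (.val (.prod A))) : Tm Γ (.val (A i))
  | inj {Γ : Ctx Base Op} {n : ℕ} {A : Fin n → Ty Base Op}
      (i : Fin n) (V : Tm Γ (.val (A i))) : Tm Γ (.val (.sum A))
  | app {Γ : Ctx Base Op} {A B : Ty Base Op} {𝒯 : Theory Base Op}
      (V : Tm Γ (.val (.fn A B 𝒯))) (W : Tm Γ (.val A)) : Tm Γ (.cmp B 𝒯)
  | ret {Γ : Ctx Base Op} {A : Ty Base Op} {𝒯 : Theory Base Op}
      (V : Tm Γ (.val A)) : Tm Γ (.cmp A 𝒯)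
  | letin {Γ : Ctx Base Op} {A B : Ty Base Op} {𝒯 : Theory Base Op}
      (M : Tm Γ (.cmp A 𝒯)) (N : Tm (A :: Γ) (.cmp B 𝒯)) : Tm Γ (.cmp B 𝒯)
  | op {Γ : Ctx Base Op} {𝒯 : Theory Base Op} (o : 𝒯.sig.Idx)
      (V : Tm Γ (.val (𝒯.sig.argTy o))) : Tm Γ (.cmp (𝒯.sig.resTy o) 𝒯)
  | case {Γ : Ctx Base Op} {n : ℕ} {A : Fin n → Ty Base Op} {B : Ty Base Op}
      {𝒯 : Theory Base Op} (V : Tm Γ (.val (.sum A)))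
      (M : ∀ i, Tm (A i :: Γ) (.cmp B 𝒯)) : Tm Γ (.cmp B 𝒯)
  | handle {Γ : Ctx Base Op} {A B : Ty Base Op} {𝒯 𝒯' : Theory Base Op}
      (M : Tm Γ (.cmp A 𝒯))
      (H : ∀ o : 𝒯.sig.Idx,
        Tm (.fn (𝒯.sig.resTy o) B 𝒯' :: 𝒯.sig.argTy o :: Γ) (.cmp B 𝒯'))
      (N : Tm (A :: Γ) (.cmp B 𝒯')) : Tm Γ (.cmp B 𝒯')

/-- Value terms. -/
abbrev Val {Base Op : Type u} (Γ : Ctx Base Op) (A : Ty Base Op) : Type u := Tm Γ (.val A)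

/-- Computation terms of type `A ! 𝒯`. -/
abbrev Cmp {Base Op : Type u} (Γ : Ctx Base Op) (A : Ty Base Op) (𝒯 : Theory Base Op) : Type u :=
  Tm Γ (.cmp A 𝒯)

/-- Handlers of type `S ⇒ B ! 𝒯'`: one operation clause for each operation of `S`. -/
abbrev Hdl {Base Op : Type u} (Γ : Ctx Base Op) (S : Sig Base Op) (B : Ty Base Op)
    (𝒯' : Theory Base Op) : Type u :=
  ∀ o : S.Idx, Cmp (.fn (S.resTy o) B 𝒯' :: S.argTy o :: Γ) B 𝒯'

section Substitution

variable {Base Op : Type u}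

/-- Renamings of variables. -/
abbrev Ren (Γ Δ : Ctx Base Op) : Type u := ∀ ⦃A : Ty Base Op⦄, Var Γ A → Var Δ A

/-- The extension of a renaming under a binder. -/
def Ren.up {Γ Δ : Ctx Base Op} (ρ : Ren Γ Δ) {B : Ty Base Op} : Ren (B :: Γ) (B :: Δ)
  | _, .zero => .zero
  | _, .succ x => .succ (ρ x)

/-- The action of a renaming on terms. -/
def Tm.rename : ∀ {Γ : Ctx Base Op} {s : Kind Base Op}, Tm Γ s →
    ∀ {Δ : Ctx Base Op}, Ren Γ Δ → Tm Δ s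
  | _, _, .var x, _, ρ => .var (ρ x)
  | _, _, .lam M, _, ρ => .lam (M.rename ρ.up)
  | _, _, .tuple V, _, ρ => .tuple fun i => (V i).rename ρ
  | _, _, .proj i V, _, ρ => .proj i (V.rename ρ)
  | _, _, .inj i V, _, ρ => .inj i (V.rename ρ)
  | _, _, .app V W, _, ρ => .app (V.rename ρ) (W.rename ρ)
  | _, _, .ret V, _, ρ => .ret (V.rename ρ)
  | _, _, .letin M N, _, ρ => .letin (M.rename ρ) (N.rename ρ.up)
  | _, _, .op o V, _, ρ => .op o (V.rename ρ)
  | _, _, .case V M, _, ρ => .case (V.rename ρ) fun i => (M i).rename ρ.up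
  | _, _, .handle M H N, _, ρ =>
      .handle (M.rename ρ) (fun o => (H o).rename ρ.up.up) (N.rename ρ.up)

/-- Weakening by one variable. -/
abbrev Tm.wk {Γ : Ctx Base Op} {s : Kind Base Op} (M : Tm Γ s) {B : Ty Base Op} :
    Tm (B :: Γ) s :=
  M.rename fun _ x => .succ x

/-- The action of a renaming on handlers. -/
def Hdl.rename {Γ Δ : Ctx Base Op} {S : Sig Base Op} {B : Ty Base Op} {𝒯' : Theory Base Op}
    (H : Hdl Γ S B 𝒯') (ρ : Ren Γ Δ) : Hdl Δ S B 𝒯' :=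
  fun o => (H o).rename ρ.up.up

/-- Substitutions: a value term over `Δ` for each variable of `Γ`. -/
abbrev Sub (Γ Δ : Ctx Base Op) : Type u := ∀ ⦃A : Ty Base Op⦄, Var Γ A → Val Δ A

/-- The extension of a substitution under a binder. -/
def Sub.up {Γ Δ : Ctx Base Op} (σ : Sub Γ Δ) {B : Ty Base Op} : Sub (B :: Γ) (B :: Δ)
  | _, .zero => .var .zero
  | _, .succ x => (σ x).wk

/-- The substitution `σ` extended by a value for the most recent variable. -/
def Sub.cons {Γ Δ : Ctx Base Op} (σ : Sub Γ Δ) {B : Ty Base Op} (V : Val Δ B) : Sub (B :: Γ) Δ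
  | _, .zero => V
  | _, .succ x => σ x

/-- The identity substitution. -/
def Sub.ids (Γ : Ctx Base Op) : Sub Γ Γ := fun _ x => .var x

/-- Capture-avoiding simultaneous substitution. -/
def Tm.subst : ∀ {Γ : Ctx Base Op} {s : Kind Base Op}, Tm Γ s →
    ∀ {Δ : Ctx Base Op}, Sub Γ Δ → Tm Δ s
  | _, _, .var x, _, σ => σ x
  | _, _, .lam M, _, σ => .lam (M.subst σ.up)
  | _, _, .tuple V, _, σ => .tuple fun i => (V i).subst σ
  | _, _, .proj i V, _, σ => .proj i (V.subst σ)
  | _, _, .inj i V, _, σ => .inj i (V.subst σ)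
  | _, _, .app V W, _, σ => .app (V.subst σ) (W.subst σ)
  | _, _, .ret V, _, σ => .ret (V.subst σ)
  | _, _, .letin M N, _, σ => .letin (M.subst σ) (N.subst σ.up)
  | _, _, .op o V, _, σ => .op o (V.subst σ)
  | _, _, .case V M, _, σ => .case (V.subst σ) fun i => (M i).subst σ.up
  | _, _, .handle M H N, _, σ =>
      .handle (M.subst σ) (fun o => (H o).subst σ.up.up) (N.subst σ.up)

/-- `M[V/x]` for the most recent variable `x`. -/
abbrev Tm.inst {Γ : Ctx Base Op} {s : Kind Base Op} {A : Ty Base Op} (M : Tm (A :: Γ) s)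
    (V : Val Γ A) : Tm Γ s :=
  M.subst ((Sub.ids Γ).cons V)

/-- `M[V/x, K/k]` for the two most recent variables `x` and then `k`. -/
abbrev Tm.inst₂ {Γ : Ctx Base Op} {s : Kind Base Op} {A B : Ty Base Op} (M : Tm (B :: A :: Γ) s)
    (V : Val Γ A) (K : Val Γ B) : Tm Γ s :=
  M.subst (((Sub.ids Γ).cons V).cons K)

/-! ## Effect theory terms in the calculus -/

/-- Substitutions `Γ → Δ` where `Δ` is a ground context. -/
abbrev GSub (Δ : List (GTy Base)) (Γ : Ctx Base Op) : Type u :=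
  ∀ ⦃A : GTy Base⦄, Var Δ A → Val Γ (A.toTy Op)

/-- The extension of a substitution under a binder of ground type. -/
def GSub.up {Δ : List (GTy Base)} {Γ : Ctx Base Op} (σ : GSub Δ Γ) {B : GTy Base} :
    GSub (B :: Δ) (B.toTy Op :: Γ)
  | _, .zero => .var .zero
  | _, .succ x => (σ x).wk

/-- `V[σ]` for a ground term `V`. -/
def GTm.inst {Γ : Ctx Base Op} {Δ : List (GTy Base)} (σ : GSub Δ Γ) :
    ∀ {A : GTy Base}, GTm Δ A → Val Γ (A.toTy Op)
  | _, .var x => σ x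
  | _, .tuple V => .tuple fun i => (V i).inst σ
  | _, .proj (A := A) i V => .proj (A := fun i => (A i).toTy Op) i (V.inst σ)
  | _, .inj (A := A) i V => .inj (A := fun i => (A i).toTy Op) i (V.inst σ)

/-- `M[σ]` for an effect theory term `M`. -/
def ETm.inst {𝒯 : Theory Base Op} : ∀ {Δ : List (GTy Base)} {A : GTy Base}, ETm 𝒯.sig Δ A →
    ∀ {Γ : Ctx Base Op}, GSub Δ Γ → Cmp Γ (A.toTy Op) 𝒯
  | _, _, .ret V, _, σ => .ret (V.inst σ)
  | _, _, .letop o V M, _, σ => .letin (.op o (V.inst σ)) (M.inst σ.up)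
  | _, _, .case (B := B) V M, _, σ =>
      .case (A := fun i => (B i).toTy Op) (V.inst σ) fun i => (M i).inst σ.up

/-- The translation of an effect theory term by a handler `H` and a continuation `k`, in a
context `Γ` into which its ground context is mapped by `σ`. -/
def ETm.handleWith {S : Sig Base Op} {B : Ty Base Op} {𝒯' : Theory Base Op} :
    ∀ {Δ : List (GTy Base)} {A : GTy Base}, ETm S Δ A →
    ∀ {Γ : Ctx Base Op}, Hdl Γ S B 𝒯' → GSub Δ Γ → Val Γ (.fn (A.toTy Op) B 𝒯') → Cmp Γ B 𝒯'
  | _, _, .ret V, _, _, σ, k => .app k (V.inst σ)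
  | _, _, .letop o V M, _, H, σ, k =>
      (H o).inst₂ (V.inst σ)
        (.lam (M.handleWith (H.rename fun _ x => .succ x) σ.up k.wk))
  | _, _, .case (B := B) V M, _, H, σ, k =>
      .case (A := fun i => (B i).toTy Op) (V.inst σ)
        fun i => (M i).handleWith (H.rename fun _ x => .succ x) σ.up k.wk

/-- The variables of `Δ` inside `Γ, Δ`. -/
def Var.ofGround (Γ : Ctx Base Op) : ∀ {Δ : List (GTy Base)} {A : GTy Base}, Var Δ A →
    Var (Δ.map (GTy.toTy Op) ++ Γ) (A.toTy Op)
  | _, _, .zero => .zero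
  | _, _, .succ x => .succ (x.ofGround Γ)

/-- The variables of `Γ` inside `Γ, Δ`. -/
def Ren.append (Γ : Ctx Base Op) : ∀ Δ : Ctx Base Op, Ren Γ (Δ ++ Γ)
  | [], _, x => x
  | _ :: Δ, _, x => .succ (Ren.append Γ Δ x)

/-- The context `Γ, Δ, k : A → B ! 𝒯'`. -/
abbrev axCtx (Γ : Ctx Base Op) (Δ : List (GTy Base)) (A : GTy Base) (B : Ty Base Op)
    (𝒯' : Theory Base Op) : Ctx Base Op :=
  .fn (A.toTy Op) B 𝒯' :: (Δ.map (GTy.toTy Op) ++ Γ)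

/-- The term `M[H, k]` in context `Γ, Δ, k : A → B ! 𝒯'`. -/
def ETm.translate {S : Sig Base Op} {Γ : Ctx Base Op} {B : Ty Base Op} {𝒯' : Theory Base Op}
    {Δ : List (GTy Base)} {A : GTy Base} (M : ETm S Δ A) (H : Hdl Γ S B 𝒯') :
    Cmp (axCtx Γ Δ A B 𝒯') B 𝒯' :=
  M.handleWith (H.rename fun _ x => .succ (Ren.append Γ (Δ.map (GTy.toTy Op)) x))
    (fun _ x => .var (.succ (x.ofGround Γ))) (.var .zero)

end Substitution

/-! ## Typing and equational theory, by simultaneous induction -/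

mutual

/-- Well-typedness: every handler that occurs in a `handle` respects the axioms of the handled
theory. -/
inductive Tm.Wf {Base Op : Type u} : ∀ {Γ : Ctx Base Op} {s : Kind Base Op}, Tm Γ s → Prop
  | var {Γ : Ctx Base Op} {A : Ty Base Op} (x : Var Γ A) : Tm.Wf (.var x)
  | lam {Γ : Ctx Base Op} {A B : Ty Base Op} {𝒯 : Theory Base Op} {M : Cmp (A :: Γ) B 𝒯} :
      M.Wf → Tm.Wf (.lam M)
  | tuple {Γ : Ctx Base Op} {n : ℕ} {A : Fin n → Ty Base Op} {V : ∀ i, Val Γ (A i)} :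
      (∀ i, (V i).Wf) → Tm.Wf (.tuple V)
  | proj {Γ : Ctx Base Op} {n : ℕ} {A : Fin n → Ty Base Op} (i : Fin n) {V : Val Γ (.prod A)} :
      V.Wf → Tm.Wf (.proj i V)
  | inj {Γ : Ctx Base Op} {n : ℕ} {A : Fin n → Ty Base Op} (i : Fin n) {V : Val Γ (A i)} :
      V.Wf → Tm.Wf (.inj (A := A) i V)
  | app {Γ : Ctx Base Op} {A B : Ty Base Op} {𝒯 : Theory Base Op} {V : Val Γ (.fn A B 𝒯)}
      {W : Val Γ A} : V.Wf → W.Wf → Tm.Wf (.app V W)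
  | ret {Γ : Ctx Base Op} {A : Ty Base Op} {𝒯 : Theory Base Op} {V : Val Γ A} :
      V.Wf → Tm.Wf (.ret (𝒯 := 𝒯) V)
  | letin {Γ : Ctx Base Op} {A B : Ty Base Op} {𝒯 : Theory Base Op} {M : Cmp Γ A 𝒯}
      {N : Cmp (A :: Γ) B 𝒯} : M.Wf → N.Wf → Tm.Wf (.letin M N)
  | op {Γ : Ctx Base Op} {𝒯 : Theory Base Op} (o : 𝒯.sig.Idx) {V : Val Γ (𝒯.sig.argTy o)} :
      V.Wf → Tm.Wf (.op o V)
  | case {Γ : Ctx Base Op} {n : ℕ} {A : Fin n → Ty Base Op} {B : Ty Base Op}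
      {𝒯 : Theory Base Op} {V : Val Γ (.sum A)} {M : ∀ i, Cmp (A i :: Γ) B 𝒯} :
      V.Wf → (∀ i, (M i).Wf) → Tm.Wf (.case V M)
  | handle {Γ : Ctx Base Op} {A B : Ty Base Op} {𝒯 𝒯' : Theory Base Op} {M : Cmp Γ A 𝒯}
      {H : Hdl Γ 𝒯.sig B 𝒯'} {N : Cmp (A :: Γ) B 𝒯'} :
      M.Wf → (∀ o, (H o).Wf) →
      (∀ e ∈ 𝒯.ax, Tm.Equ (e.lhs.translate H) (e.rhs.translate H)) →
      N.Wf → Tm.Wf (.handle M H N)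

/-- Derivable equality `Γ ⊢ M = N` of terms of the same type. -/
inductive Tm.Equ {Base Op : Type u} :
    ∀ {Γ : Ctx Base Op} {s : Kind Base Op}, Tm Γ s → Tm Γ s → Prop
  -- equivalence relation
  | refl {Γ : Ctx Base Op} {s : Kind Base Op} {M : Tm Γ s} : M.Wf → Tm.Equ M M
  | symm {Γ : Ctx Base Op} {s : Kind Base Op} {M N : Tm Γ s} : Tm.Equ M N → Tm.Equ N M
  | trans {Γ : Ctx Base Op} {s : Kind Base Op} {L M N : Tm Γ s} :
      Tm.Equ L M → Tm.Equ M N → Tm.Equ L N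
  -- congruence
  | lam {Γ : Ctx Base Op} {A B : Ty Base Op} {𝒯 : Theory Base Op} {M M' : Cmp (A :: Γ) B 𝒯} :
      Tm.Equ M M' → Tm.Equ (.lam M) (.lam M')
  | tuple {Γ : Ctx Base Op} {n : ℕ} {A : Fin n → Ty Base Op} {V V' : ∀ i, Val Γ (A i)} :
      (∀ i, Tm.Equ (V i) (V' i)) → Tm.Equ (.tuple V) (.tuple V')
  | proj {Γ : Ctx Base Op} {n : ℕ} {A : Fin n → Ty Base Op} (i : Fin n)
      {V V' : Val Γ (.prod A)} : Tm.Equ V V' → Tm.Equ (.proj i V) (.proj i V')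
  | inj {Γ : Ctx Base Op} {n : ℕ} {A : Fin n → Ty Base Op} (i : Fin n) {V V' : Val Γ (A i)} :
      Tm.Equ V V' → Tm.Equ (.inj (A := A) i V) (.inj i V')
  | app {Γ : Ctx Base Op} {A B : Ty Base Op} {𝒯 : Theory Base Op} {V V' : Val Γ (.fn A B 𝒯)}
      {W W' : Val Γ A} : Tm.Equ V V' → Tm.Equ W W' → Tm.Equ (.app V W) (.app V' W')
  | ret {Γ : Ctx Base Op} {A : Ty Base Op} {𝒯 : Theory Base Op} {V V' : Val Γ A} :
      Tm.Equ V V' → Tm.Equ (.ret (𝒯 := 𝒯) V) (.ret V')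
  | letin {Γ : Ctx Base Op} {A B : Ty Base Op} {𝒯 : Theory Base Op} {M M' : Cmp Γ A 𝒯}
      {N N' : Cmp (A :: Γ) B 𝒯} :
      Tm.Equ M M' → Tm.Equ N N' → Tm.Equ (.letin M N) (.letin M' N')
  | op {Γ : Ctx Base Op} {𝒯 : Theory Base Op} (o : 𝒯.sig.Idx)
      {V V' : Val Γ (𝒯.sig.argTy o)} : Tm.Equ V V' → Tm.Equ (.op o V) (.op o V')
  | case {Γ : Ctx Base Op} {n : ℕ} {A : Fin n → Ty Base Op} {B : Ty Base Op}
      {𝒯 : Theory Base Op} {V V' : Val Γ (.sum A)} {M M' : ∀ i, Cmp (A i :: Γ) B 𝒯} :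
      Tm.Equ V V' → (∀ i, Tm.Equ (M i) (M' i)) → Tm.Equ (.case V M) (.case V' M')
  | handle {Γ : Ctx Base Op} {A B : Ty Base Op} {𝒯 𝒯' : Theory Base Op} {M M' : Cmp Γ A 𝒯}
      {H H' : Hdl Γ 𝒯.sig B 𝒯'} {N N' : Cmp (A :: Γ) B 𝒯'} :
      Tm.Equ M M' → (∀ o, Tm.Equ (H o) (H' o)) →
      (∀ e ∈ 𝒯.ax, Tm.Equ (e.lhs.translate H) (e.rhs.translate H)) →
      (∀ e ∈ 𝒯.ax, Tm.Equ (e.lhs.translate H') (e.rhs.translate H')) →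
      Tm.Equ N N' → Tm.Equ (.handle M H N) (.handle M' H' N')
  -- beta and eta laws
  | fn_beta {Γ : Ctx Base Op} {A B : Ty Base Op} {𝒯 : Theory Base Op} {M : Cmp (A :: Γ) B 𝒯}
      {V : Val Γ A} : M.Wf → V.Wf → Tm.Equ (.app (.lam M) V) (M.inst V)
  | fn_eta {Γ : Ctx Base Op} {A B : Ty Base Op} {𝒯 : Theory Base Op} {V : Val Γ (.fn A B 𝒯)} :
      V.Wf → Tm.Equ V (.lam (.app V.wk (.var .zero)))
  | prod_beta {Γ : Ctx Base Op} {n : ℕ} {A : Fin n → Ty Base Op} {V : ∀ i, Val Γ (A i)}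
      (i : Fin n) : (∀ j, (V j).Wf) → Tm.Equ (.proj i (.tuple V)) (V i)
  | prod_eta {Γ : Ctx Base Op} {n : ℕ} {A : Fin n → Ty Base Op} {V : Val Γ (.prod A)} :
      V.Wf → Tm.Equ V (.tuple fun i => .proj i V)
  | sum_beta {Γ : Ctx Base Op} {n : ℕ} {A : Fin n → Ty Base Op} {B : Ty Base Op}
      {𝒯 : Theory Base Op} {M : ∀ i, Cmp (A i :: Γ) B 𝒯} (i : Fin n) {V : Val Γ (A i)} :
      V.Wf → (∀ j, (M j).Wf) → Tm.Equ (.case (.inj i V) M) ((M i).inst V)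
  | sum_eta {Γ : Ctx Base Op} {n : ℕ} {A : Fin n → Ty Base Op} {B : Ty Base Op}
      {𝒯 : Theory Base Op} {M : Cmp (.sum A :: Γ) B 𝒯} {V : Val Γ (.sum A)} :
      V.Wf → M.Wf →
      Tm.Equ
        (.case V fun i => M.subst (Sub.cons (fun _ x => .var (.succ x)) (.inj i (.var .zero))))
        (M.inst V)
  -- monad laws
  | ret_let {Γ : Ctx Base Op} {A B : Ty Base Op} {𝒯 : Theory Base Op} {V : Val Γ A}
      {M : Cmp (A :: Γ) B 𝒯} : V.Wf → M.Wf → Tm.Equ (.letin (.ret V) M) (M.inst V)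
  | let_ret {Γ : Ctx Base Op} {A : Ty Base Op} {𝒯 : Theory Base Op} {M : Cmp Γ A 𝒯} :
      M.Wf → Tm.Equ (.letin M (.ret (.var .zero))) M
  | let_let {Γ : Ctx Base Op} {A₁ A₂ A₃ : Ty Base Op} {𝒯 : Theory Base Op} {M : Cmp Γ A₁ 𝒯}
      {N : Cmp (A₁ :: Γ) A₂ 𝒯} {L : Cmp (A₂ :: Γ) A₃ 𝒯} : M.Wf → N.Wf → L.Wf →
      Tm.Equ (.letin (.letin M N) L)
        (.letin M (.letin N (L.rename (Ren.up fun _ x => .succ x))))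
  -- effect handlers
  | handle_ret {Γ : Ctx Base Op} {A B : Ty Base Op} {𝒯 𝒯' : Theory Base Op} {V : Val Γ A}
      {H : Hdl Γ 𝒯.sig B 𝒯'} {N : Cmp (A :: Γ) B 𝒯'} :
      V.Wf → (∀ o, (H o).Wf) →
      (∀ e ∈ 𝒯.ax, Tm.Equ (e.lhs.translate H) (e.rhs.translate H)) →
      N.Wf → Tm.Equ (.handle (.ret (𝒯 := 𝒯) V) H N) (N.inst V)
  | handle_let {Γ : Ctx Base Op} {A₁ A₂ B : Ty Base Op} {𝒯 𝒯' : Theory Base Op}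
      {L : Cmp Γ A₁ 𝒯} {M : Cmp (A₁ :: Γ) A₂ 𝒯} {H : Hdl Γ 𝒯.sig B 𝒯'}
      {N : Cmp (A₂ :: Γ) B 𝒯'} :
      L.Wf → M.Wf → (∀ o, (H o).Wf) →
      (∀ e ∈ 𝒯.ax, Tm.Equ (e.lhs.translate H) (e.rhs.translate H)) →
      N.Wf →
      Tm.Equ (.handle (.letin L M) H N)
        (.handle L H
          (.handle M (Hdl.rename H fun _ x => .succ x) (N.rename (Ren.up fun _ x => .succ x))))
  | handle_op {Γ : Ctx Base Op} {B : Ty Base Op} {𝒯 𝒯' : Theory Base Op} (o : 𝒯.sig.Idx)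
      {V : Val Γ (𝒯.sig.argTy o)} {H : Hdl Γ 𝒯.sig B 𝒯'}
      {N : Cmp (𝒯.sig.resTy o :: Γ) B 𝒯'} :
      V.Wf → (∀ o, (H o).Wf) →
      (∀ e ∈ 𝒯.ax, Tm.Equ (e.lhs.translate H) (e.rhs.translate H)) →
      N.Wf → Tm.Equ (.handle (.op o V) H N) ((H o).inst₂ V (.lam N))
  -- instantiation of the axioms of an effect theory
  | inst_ax {Γ : Ctx Base Op} {𝒯 : Theory Base Op} {e : EqAx 𝒯.sig} {σ : GSub e.ctx Γ} :
      e ∈ 𝒯.ax → (∀ (A : GTy Base) (x : Var e.ctx A), (σ x).Wf) →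
      Tm.Equ (e.lhs.inst σ) (e.rhs.inst σ)

end

/-- `Γ ⊢ H : S ⇒ B ! 𝒯'`. -/
def Hdl.Wf {Base Op : Type u} {Γ : Ctx Base Op} {S : Sig Base Op} {B : Ty Base Op}
    {𝒯' : Theory Base Op} (H : Hdl Γ S B 𝒯') : Prop :=
  ∀ o, (H o).Wf

/-- Derivable equality of handlers, which is clausewise. -/
def Hdl.Equ {Base Op : Type u} {Γ : Ctx Base Op} {S : Sig Base Op} {B : Ty Base Op}
    {𝒯' : Theory Base Op} (H H' : Hdl Γ S B 𝒯') : Prop :=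
  ∀ o, Tm.Equ (H o) (H' o)

/-! ## Models -/

/-- Strong monads on a cartesian category. -/
structure StrongMonad (C : Type u) [Category.{v} C] [CartesianMonoidalCategory C]
    extends CategoryTheory.Monad C where
  str (X Y : C) : X ⊗ obj Y ⟶ obj (X ⊗ Y)
  str_natural {X X' Y Y' : C} (f : X ⟶ X') (g : Y ⟶ Y') :
    (f ⊗ₘ map g) ≫ str X' Y' = str X Y ≫ map (f ⊗ₘ g)
  str_leftUnitor (Y : C) : str (𝟙_ C) Y ≫ map (λ_ Y).hom = (λ_ (obj Y)).hom
  str_associator (X Y Z : C) :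
    str (X ⊗ Y) Z ≫ map (α_ X Y Z).hom = (α_ X Y (obj Z)).hom ≫ X ◁ str Y Z ≫ str X (Y ⊗ Z)
  str_unit (X Y : C) : X ◁ η.app Y ≫ str X Y = η.app (X ⊗ Y)
  str_mul (X Y : C) :
    X ◁ μ.app Y ≫ str X Y = str X (obj Y) ≫ map (str X Y) ≫ μ.app (X ⊗ Y)

/-- The part of a model that interprets types: a cartesian category with chosen finite products,
an interpretation of the base types, a strong monad `T 𝒯` for each effect theory, chosen Kleisli
exponentials for each of these monads, and chosen joint distributive Kleisli coproducts. -/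
structure TypeModel (Base Op : Type u) (C : Type w) [Category.{v} C]
    [CartesianMonoidalCategory C] where
  -- finite products
  pr {n : ℕ} (X : Fin n → C) : C
  prProj {n : ℕ} (X : Fin n → C) (i : Fin n) : pr X ⟶ X i
  prLift {n : ℕ} {X : Fin n → C} {Z : C} (f : ∀ i, Z ⟶ X i) : Z ⟶ pr X
  prLift_proj {n : ℕ} {X : Fin n → C} {Z : C} (f : ∀ i, Z ⟶ X i) (i : Fin n) :
    prLift f ≫ prProj X i = f i
  pr_ext {n : ℕ} {X : Fin n → C} {Z : C} {f g : Z ⟶ pr X} :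
    (∀ i, f ≫ prProj X i = g ≫ prProj X i) → f = g
  -- base types
  base (b : Base) : C
  -- strong monads
  T (𝒯 : Theory Base Op) : StrongMonad C
  -- Kleisli exponentials
  kexp (𝒯 : Theory Base Op) (Y Z : C) : C
  curry {𝒯 : Theory Base Op} {X Y Z : C} : (X ⊗ Y ⟶ (T 𝒯).obj Z) ≃ (X ⟶ kexp 𝒯 Y Z)
  curry_natural {𝒯 : Theory Base Op} {X X' Y Z : C} (g : X' ⟶ X) (f : X ⊗ Y ⟶ (T 𝒯).obj Z) :
    curry (g ▷ Y ≫ f) = g ≫ curry f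
  -- joint distributive Kleisli coproducts
  sm {n : ℕ} (X : Fin n → C) : C
  smInj {n : ℕ} (X : Fin n → C) (i : Fin n) : X i ⟶ sm X
  smCase {𝒯 : Theory Base Op} {n : ℕ} {X : Fin n → C} {Z Y : C}
    (f : ∀ i, Z ⊗ X i ⟶ (T 𝒯).obj Y) : Z ⊗ sm X ⟶ (T 𝒯).obj Y
  smInj_case {𝒯 : Theory Base Op} {n : ℕ} {X : Fin n → C} {Z Y : C}
    (f : ∀ i, Z ⊗ X i ⟶ (T 𝒯).obj Y) (i : Fin n) : Z ◁ smInj X i ≫ smCase f = f i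
  sm_ext {𝒯 : Theory Base Op} {n : ℕ} {X : Fin n → C} {Z Y : C}
    {f g : Z ⊗ sm X ⟶ (T 𝒯).obj Y} :
    (∀ i, Z ◁ smInj X i ≫ f = Z ◁ smInj X i ≫ g) → f = g

namespace TypeModel

variable {Base Op : Type u} {C : Type w} [Category.{v} C] [CartesianMonoidalCategory C]
  (𝓜 : TypeModel Base Op C)

/-- Evaluation `(Y ⇒ Z) × Y → T Z`. -/
def ev (𝒯 : Theory Base Op) (Y Z : C) : 𝓜.kexp 𝒯 Y Z ⊗ Y ⟶ (𝓜.T 𝒯).obj Z :=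
  𝓜.curry.symm (𝟙 _)

/-- Interpretation of value types. -/
def ty : Ty Base Op → C
  | .base b => 𝓜.base b
  | .fn A B 𝒯 => 𝓜.kexp 𝒯 (ty A) (ty B)
  | .prod A => 𝓜.pr fun i => ty (A i)
  | .sum A => 𝓜.sm fun i => ty (A i)

/-- Interpretation of ground types. -/
abbrev gty (A : GTy Base) : C := 𝓜.ty (A.toTy Op)

/-- The object that terms of the given kind are interpreted in. -/
abbrev kind : Kind Base Op → C
  | .val A => 𝓜.ty A
  | .cmp A 𝒯 => (𝓜.T 𝒯).obj (𝓜.ty A)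

end TypeModel

section

variable {C : Type w} [Category.{v} C] [CartesianMonoidalCategory C]

/-- Interpretation of contexts, for a given interpretation of types. -/
def ctxObj {α : Type u} (F : α → C) : List α → C
  | [] => 𝟙_ C
  | a :: Γ => ctxObj F Γ ⊗ F a

/-- Interpretation of variables. -/
def varHom {α : Type u} (F : α → C) : ∀ {Γ : List α} {a : α}, Var Γ a → (ctxObj F Γ ⟶ F a)
  | _ :: Γ, a, .zero => snd (ctxObj F Γ) (F a)
  | b :: Γ, _, .succ x => fst (ctxObj F Γ) (F b) ≫ varHom F x

end

namespace TypeModel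

variable {Base Op : Type u} {C : Type w} [Category.{v} C] [CartesianMonoidalCategory C]
  (𝓜 : TypeModel Base Op C)

/-- Interpretation of contexts. -/
abbrev ctx (Γ : Ctx Base Op) : C := ctxObj 𝓜.ty Γ

/-- Interpretation of ground contexts. -/
abbrev gctx (Δ : List (GTy Base)) : C := ctxObj 𝓜.gty Δ

/-- Interpretation of ground terms. -/
def gtm {Δ : List (GTy Base)} : ∀ {A : GTy Base}, GTm Δ A → (𝓜.gctx Δ ⟶ 𝓜.gty A)
  | _, .var x => varHom 𝓜.gty x
  | _, .tuple (A := A) V => 𝓜.prLift (X := fun i => 𝓜.gty (A i)) fun i => gtm (V i)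
  | _, .proj (A := A) i V => gtm V ≫ 𝓜.prProj (fun i => 𝓜.gty (A i)) i
  | _, .inj (A := A) i V => gtm V ≫ 𝓜.smInj (fun i => 𝓜.gty (A i)) i

/-- `μ ∘ T g ∘ st ∘ ⟨id, f⟩`. -/
def bind {𝒯 : Theory Base Op} {Z X Y : C} (f : Z ⟶ (𝓜.T 𝒯).obj X)
    (g : Z ⊗ X ⟶ (𝓜.T 𝒯).obj Y) : Z ⟶ (𝓜.T 𝒯).obj Y :=
  lift (𝟙 Z) f ≫ (𝓜.T 𝒯).str Z X ≫ (𝓜.T 𝒯).map g ≫ (𝓜.T 𝒯).μ.app Y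

/-- Interpretation of effect theory terms by generic effects `I o : A_o → T B_o`. -/
def etm {𝒯 : Theory Base Op}
    (I : ∀ o : 𝒯.sig.Idx, 𝓜.gty (𝒯.sig.arg o) ⟶ (𝓜.T 𝒯).obj (𝓜.gty (𝒯.sig.res o))) :
    ∀ {Δ : List (GTy Base)} {A : GTy Base}, ETm 𝒯.sig Δ A →
      (𝓜.gctx Δ ⟶ (𝓜.T 𝒯).obj (𝓜.gty A))
  | _, _, .ret V => 𝓜.gtm V ≫ (𝓜.T 𝒯).η.app _
  | _, _, .letop o V M => 𝓜.bind (𝓜.gtm V ≫ I o) (etm I M)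
  | _, _, .case (B := B) V M =>
      lift (𝟙 _) (𝓜.gtm V) ≫ 𝓜.smCase (X := fun i => 𝓜.gty (B i)) fun i => etm I (M i)

/-- The object of `S`-algebra structures on `X` in the Kleisli category of `T 𝒯'`: the product
over all operations `o` of `S` of the Kleisli exponentials `A_o × (B_o ⇒ X) ⇒ X`. -/
noncomputable abbrev hb (S : Sig Base Op) (𝒯' : Theory Base Op) (X : C) : C :=
  𝓜.pr fun i : Fin S.ops.card =>
    𝓜.kexp 𝒯' (𝓜.gty (S.arg (S.ops.equivFin.symm i)) ⊗
      𝓜.kexp 𝒯' (𝓜.gty (S.res (S.ops.equivFin.symm i))) X) X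

/-- The projection from `hb` to the component of `o`. -/
noncomputable def hbProj (S : Sig Base Op) (𝒯' : Theory Base Op) (X : C) (o : S.Idx) :
    𝓜.hb S 𝒯' X ⟶ 𝓜.kexp 𝒯' (𝓜.gty (S.arg o) ⊗ 𝓜.kexp 𝒯' (𝓜.gty (S.res o)) X) X :=
  𝓜.prProj _ (S.ops.equivFin o) ≫ eqToHom (by rw [Equiv.symm_apply_apply])

/-- Tupling into `hb`. -/
noncomputable def hbLift (S : Sig Base Op) (𝒯' : Theory Base Op) (X : C) {Z : C}
    (f : ∀ o : S.Idx,
      Z ⟶ 𝓜.kexp 𝒯' (𝓜.gty (S.arg o) ⊗ 𝓜.kexp 𝒯' (𝓜.gty (S.res o)) X) X) :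
    Z ⟶ 𝓜.hb S 𝒯' X :=
  𝓜.prLift fun i => f (S.ops.equivFin.symm i)

/-- The canonical map `(H × (D × K)) × A → H × ((D × A) × K)`. -/
def shuffle (H D K A : C) : (H ⊗ (D ⊗ K)) ⊗ A ⟶ H ⊗ ((D ⊗ A) ⊗ K) :=
  lift (fst _ _ ≫ fst _ _)
    (lift (lift (fst _ _ ≫ snd _ _ ≫ fst _ _) (snd _ _)) (fst _ _ ≫ snd _ _ ≫ snd _ _))

/-- The uncurried interpretation of effect theory terms by algebra structures on `X`. -/
noncomputable def algUncurried {S : Sig Base Op} (𝒯' : Theory Base Op) (X : C) :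
    ∀ {Δ : List (GTy Base)} {A : GTy Base}, ETm S Δ A →
      (𝓜.hb S 𝒯' X ⊗ (𝓜.gctx Δ ⊗ 𝓜.kexp 𝒯' (𝓜.gty A) X) ⟶ (𝓜.T 𝒯').obj X)
  | _, _, .ret V => snd _ _ ≫ lift (snd _ _) (fst _ _ ≫ 𝓜.gtm V) ≫ 𝓜.ev 𝒯' _ X
  | _, _, .letop o V M =>
      lift (fst _ _ ≫ 𝓜.hbProj S 𝒯' X o)
        (lift (snd _ _ ≫ fst _ _ ≫ 𝓜.gtm V)
          (𝓜.curry (shuffle _ _ _ _ ≫ algUncurried 𝒯' X M))) ≫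
      𝓜.ev 𝒯' _ X
  | _, _, .case (B := B) V M =>
      lift (𝟙 _) (snd _ _ ≫ fst _ _ ≫ 𝓜.gtm V) ≫
        𝓜.smCase (X := fun i => 𝓜.gty (B i))
          fun i => shuffle _ _ _ _ ≫ algUncurried 𝒯' X (M i)

/-- The interpretation of effect theory terms by algebra structures on `X`. -/
noncomputable def alg {S : Sig Base Op} (𝒯' : Theory Base Op) (X : C) {Δ : List (GTy Base)}
    {A : GTy Base} (M : ETm S Δ A) :
    𝓜.hb S 𝒯' X ⟶ 𝓜.kexp 𝒯' (𝓜.gctx Δ ⊗ 𝓜.kexp 𝒯' (𝓜.gty A) X) X :=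
  𝓜.curry (𝓜.algUncurried 𝒯' X M)

/-- A generalized element of the object of algebra structures satisfies the axioms of `𝒯`. -/
def Sat (𝒯 𝒯' : Theory Base Op) (X : C) {Z : C} (h : Z ⟶ 𝓜.hb 𝒯.sig 𝒯' X) : Prop :=
  ∀ e ∈ 𝒯.ax, h ≫ 𝓜.alg 𝒯' X e.lhs = h ≫ 𝓜.alg 𝒯' X e.rhs

theorem Sat.comp {𝓜 : TypeModel Base Op C} {𝒯 𝒯' : Theory Base Op} {X Z Z' : C}
    {h : Z ⟶ 𝓜.hb 𝒯.sig 𝒯' X} (hh : 𝓜.Sat 𝒯 𝒯' X h) (g : Z' ⟶ Z) :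
    𝓜.Sat 𝒯 𝒯' X (g ≫ h) := fun e he => by
  rw [Category.assoc, Category.assoc, hh e he]

/-- The morphism `T ev ∘ st ∘ swap ∘ (a × id) : A × (B ⇒ X) → T T' X` for `a : A → T B`, where
`⇒` is the Kleisli exponential of `T'`. -/
def mixed {𝒯 : Theory Base Op} (𝒯' : Theory Base Op) (X : C) {A B : C}
    (a : A ⟶ (𝓜.T 𝒯).obj B) :
    A ⊗ 𝓜.kexp 𝒯' B X ⟶ (𝓜.T 𝒯).obj ((𝓜.T 𝒯').obj X) :=
  a ▷ _ ≫ lift (snd _ _) (fst _ _) ≫ (𝓜.T 𝒯).str _ _ ≫ (𝓜.T 𝒯).map (𝓜.ev 𝒯' B X)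

end TypeModel

/-- Models of the calculus. The field `handle` with `handle_natural` is a natural transformation
from `H × C(-, T T' X)` to `C(-, T' X)`, where `H` is the subpresheaf of `C(-, hb Σ 𝒯' X)` that
consists of the elements satisfying the axioms of the handled theory. -/
structure Model (Base Op : Type u) (C : Type w) [Category.{v} C] [CartesianMonoidalCategory C]
    extends TypeModel Base Op C where
  op (𝒯 : Theory Base Op) (o : 𝒯.sig.Idx) :
    toTypeModel.gty (𝒯.sig.arg o) ⟶ (T 𝒯).obj (toTypeModel.gty (𝒯.sig.res o))
  op_sat (𝒯 : Theory Base Op) :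
    ∀ e ∈ 𝒯.ax, toTypeModel.etm (op 𝒯) e.lhs = toTypeModel.etm (op 𝒯) e.rhs
  handle (𝒯 𝒯' : Theory Base Op) (X : C) {Z : C} (h : Z ⟶ toTypeModel.hb 𝒯.sig 𝒯' X)
    (hh : toTypeModel.Sat 𝒯 𝒯' X h) (f : Z ⟶ (T 𝒯).obj ((T 𝒯').obj X)) : Z ⟶ (T 𝒯').obj X
  handle_natural (𝒯 𝒯' : Theory Base Op) (X : C) {Z Z' : C}
    (h : Z ⟶ toTypeModel.hb 𝒯.sig 𝒯' X) (hh : toTypeModel.Sat 𝒯 𝒯' X h)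
    (f : Z ⟶ (T 𝒯).obj ((T 𝒯').obj X)) (g : Z' ⟶ Z) :
    g ≫ handle 𝒯 𝒯' X h hh f = handle 𝒯 𝒯' X (g ≫ h) (hh.comp g) (g ≫ f)
  handle_unit (𝒯 𝒯' : Theory Base Op) (X : C) {Z : C}
    (h : Z ⟶ toTypeModel.hb 𝒯.sig 𝒯' X) (hh : toTypeModel.Sat 𝒯 𝒯' X h)
    (f : Z ⟶ (T 𝒯').obj X) :
    handle 𝒯 𝒯' X h hh (f ≫ (T 𝒯).η.app _) = f
  handle_mul (𝒯 𝒯' : Theory Base Op) (X : C) {Z : C}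
    (h : Z ⟶ toTypeModel.hb 𝒯.sig 𝒯' X) (hh : toTypeModel.Sat 𝒯 𝒯' X h)
    (f : Z ⟶ (T 𝒯).obj ((T 𝒯).obj ((T 𝒯').obj X))) :
    handle 𝒯 𝒯' X h hh (f ≫ (T 𝒯).μ.app _) =
      handle 𝒯 𝒯' X h hh
        (lift (𝟙 Z) f ≫ (T 𝒯).str _ _ ≫
          (T 𝒯).map (handle 𝒯 𝒯' X (fst Z _ ≫ h) (hh.comp (fst Z _)) (snd _ _)))
  handle_op (𝒯 𝒯' : Theory Base Op) (X : C) {Z : C}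
    (h : Z ⟶ toTypeModel.hb 𝒯.sig 𝒯' X) (hh : toTypeModel.Sat 𝒯 𝒯' X h) (o : 𝒯.sig.Idx)
    (f : Z ⟶ toTypeModel.gty (𝒯.sig.arg o) ⊗
      kexp 𝒯' (toTypeModel.gty (𝒯.sig.res o)) X) :
    handle 𝒯 𝒯' X h hh (f ≫ toTypeModel.mixed 𝒯' X (op 𝒯 o)) =
      lift (h ≫ toTypeModel.hbProj 𝒯.sig 𝒯' X o) f ≫ toTypeModel.ev 𝒯' _ X

/-! ## Interpretation of terms -/

/-- A family of partial elements as a partial family. -/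
def partPi {ι : Type u} {β : ι → Type v} (f : ∀ i, Part (β i)) : Part (∀ i, β i) :=
  ⟨∀ i, (f i).Dom, fun h i => (f i).get (h i)⟩

namespace Model

variable {Base Op : Type u} {C : Type w} [Category.{v} C] [CartesianMonoidalCategory C]
  (𝓜 : Model Base Op C)

/-- The partial tupling `⟨Λ (f_o ∘ α⁻¹)⟩_o` of interpretations of operation clauses. -/
noncomputable def clauses {Z : C} {S : Sig Base Op} {B : Ty Base Op} {𝒯' : Theory Base Op}
    (f : ∀ o : S.Idx, Part
      ((Z ⊗ 𝓜.ty (S.argTy o)) ⊗ 𝓜.ty (.fn (S.resTy o) B 𝒯') ⟶ (𝓜.T 𝒯').obj (𝓜.ty B))) :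
    Part (Z ⟶ 𝓜.hb S 𝒯' (𝓜.ty B)) :=
  (partPi f).map fun m => 𝓜.hbLift S 𝒯' (𝓜.ty B) fun o => 𝓜.curry ((α_ _ _ _).inv ≫ m o)

/-- The partial interpretation of terms. It is undefined where a handler is used whose
interpretation does not satisfy the axioms of the handled theory. -/
noncomputable def interp : ∀ {Γ : Ctx Base Op} {s : Kind Base Op}, Tm Γ s →
    Part (𝓜.ctx Γ ⟶ 𝓜.kind s)
  | _, _, .var x => Part.some (varHom 𝓜.ty x)
  | _, _, .lam M => (interp M).map fun m => 𝓜.curry m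
  | _, _, .tuple (A := A) V =>
      (partPi fun i => interp (V i)).map fun v => 𝓜.prLift (X := fun i => 𝓜.ty (A i)) v
  | _, _, .proj (A := A) i V => (interp V).map fun v => v ≫ 𝓜.prProj (fun i => 𝓜.ty (A i)) i
  | _, _, .inj (A := A) i V => (interp V).map fun v => v ≫ 𝓜.smInj (fun i => 𝓜.ty (A i)) i
  | _, _, .app (A := A) (B := B) (𝒯 := 𝒯) V W =>
      (interp V).bind fun v => (interp W).map fun w =>
        lift v w ≫ 𝓜.ev 𝒯 (𝓜.ty A) (𝓜.ty B)
  | _, _, .ret (𝒯 := 𝒯) V => (interp V).map fun v => v ≫ (𝓜.T 𝒯).η.app _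
  | _, _, .letin M N => (interp M).bind fun m => (interp N).map fun n => 𝓜.bind m n
  | _, _, .op (𝒯 := 𝒯) o V => (interp V).map fun v => v ≫ 𝓜.op 𝒯 o
  | _, _, .case (A := A) V M =>
      (interp V).bind fun v => (partPi fun i => interp (M i)).map fun m =>
        lift (𝟙 _) v ≫ 𝓜.smCase (X := fun i => 𝓜.ty (A i)) m
  | Γ, _, .handle (B := B) (𝒯 := 𝒯) (𝒯' := 𝒯') M H N =>
      (interp M).bind fun m => (interp N).bind fun n =>
        (𝓜.clauses (Z := 𝓜.ctx Γ) fun o => interp (H o)).bind fun h =>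
          Part.assert (𝓜.Sat 𝒯 𝒯' (𝓜.ty B) h) fun hh =>
            Part.some (𝓜.handle 𝒯 𝒯' (𝓜.ty B) h hh
              (lift (𝟙 _) m ≫ (𝓜.T 𝒯).str _ _ ≫ (𝓜.T 𝒯).map n))

/-- The partial interpretation of handlers. -/
noncomputable def interpHdl {Γ : Ctx Base Op} {S : Sig Base Op} {B : Ty Base Op}
    {𝒯' : Theory Base Op} (H : Hdl Γ S B 𝒯') : Part (𝓜.ctx Γ ⟶ 𝓜.hb S 𝒯' (𝓜.ty B)) :=
  𝓜.clauses fun o => 𝓜.interp (H o)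

end Model

end EffCalc

namespace EffCalc

/-! ## The substitution calculus -/

section SubstitutionLemmas

variable {Base Op : Type u} {Γ Δ Ξ : Ctx Base Op} {s : Kind Base Op}

theorem Ren.up_comp (ρ : Ren Γ Δ) (ρ' : Ren Δ Ξ) (B : Ty Base Op) :
    (fun _ x => ρ'.up (ρ.up x) : Ren (B :: Γ) (B :: Ξ)) = Ren.up fun _ x => ρ' (ρ x) := by
  funext A x; cases x <;> rfl

theorem Tm.rename_rename (M : Tm Γ s) (ρ : Ren Γ Δ) (ρ' : Ren Δ Ξ) :
    (M.rename ρ).rename ρ' = M.rename fun _ x => ρ' (ρ x) := by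
  induction M generalizing Δ Ξ <;> simp only [Tm.rename, Ren.up_comp, *]

theorem Sub.up_var (ρ : Ren Γ Δ) (B : Ty Base Op) :
    (Sub.up fun _ x => .var (ρ x) : Sub (B :: Γ) (B :: Δ)) = fun _ x => .var (ρ.up x) := by
  funext A x; cases x <;> rfl

theorem Tm.rename_eq_subst (M : Tm Γ s) (ρ : Ren Γ Δ) :
    M.rename ρ = M.subst fun _ x => .var (ρ x) := by
  induction M generalizing Δ <;> simp only [Tm.rename, Tm.subst, Sub.up_var, *]

theorem Sub.up_ren (ρ : Ren Γ Δ) (σ : Sub Δ Ξ) (B : Ty Base Op) :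
    (fun _ x => σ.up (ρ.up x) : Sub (B :: Γ) (B :: Ξ)) = Sub.up fun _ x => σ (ρ x) := by
  funext A x; cases x <;> rfl

theorem Tm.rename_subst (M : Tm Γ s) (ρ : Ren Γ Δ) (σ : Sub Δ Ξ) :
    (M.rename ρ).subst σ = M.subst fun _ x => σ (ρ x) := by
  induction M generalizing Δ Ξ <;> simp only [Tm.rename, Tm.subst, Sub.up_ren, *]

theorem Sub.up_rename (σ : Sub Γ Δ) (ρ : Ren Δ Ξ) (B : Ty Base Op) :
    (fun _ x => (σ.up x).rename ρ.up : Sub (B :: Γ) (B :: Ξ)) =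
      Sub.up fun _ x => (σ x).rename ρ := by
  funext A x
  cases x with
  | zero => rfl
  | succ x => simp only [Sub.up, Tm.wk, Tm.rename_rename]; rfl

theorem Tm.subst_rename (M : Tm Γ s) (σ : Sub Γ Δ) (ρ : Ren Δ Ξ) :
    (M.subst σ).rename ρ = M.subst fun _ x => (σ x).rename ρ := by
  induction M generalizing Δ Ξ <;> simp only [Tm.rename, Tm.subst, Sub.up_rename, *]

theorem Sub.up_subst (σ : Sub Γ Δ) (τ : Sub Δ Ξ) (B : Ty Base Op) :
    (fun _ x => (σ.up x).subst τ.up : Sub (B :: Γ) (B :: Ξ)) =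
      Sub.up fun _ x => (σ x).subst τ := by
  funext A x
  cases x with
  | zero => rfl
  | succ x => simp only [Sub.up, Tm.wk, Tm.rename_subst, Tm.subst_rename]

theorem Tm.subst_subst (M : Tm Γ s) (σ : Sub Γ Δ) (τ : Sub Δ Ξ) :
    (M.subst σ).subst τ = M.subst fun _ x => (σ x).subst τ := by
  induction M generalizing Δ Ξ <;> simp only [Tm.subst, Sub.up_subst, *]

theorem Sub.up_ids (Γ : Ctx Base Op) (B : Ty Base Op) :
    ((Sub.ids Γ).up : Sub (B :: Γ) (B :: Γ)) = Sub.ids (B :: Γ) := by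
  funext A x; cases x <;> rfl

theorem Tm.subst_ids (M : Tm Γ s) : M.subst (Sub.ids Γ) = M := by
  induction M <;> simp only [Tm.subst, Sub.up_ids, *]
  rfl

/-- The action of a substitution on handlers. -/
def Hdl.subst {S : Sig Base Op} {B : Ty Base Op} {𝒯' : Theory Base Op}
    (H : Hdl Γ S B 𝒯') (σ : Sub Γ Δ) : Hdl Δ S B 𝒯' :=
  fun o => (H o).subst σ.up.up

theorem Hdl.rename_eq_subst {S : Sig Base Op} {B : Ty Base Op} {𝒯' : Theory Base Op}
    (H : Hdl Γ S B 𝒯') (ρ : Ren Γ Δ) : H.rename ρ = H.subst fun _ x => .var (ρ x) := by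
  funext o
  simp only [Hdl.rename, Hdl.subst, Tm.rename_eq_subst, Sub.up_var]

theorem Hdl.subst_subst {S : Sig Base Op} {B : Ty Base Op} {𝒯' : Theory Base Op}
    (H : Hdl Γ S B 𝒯') (σ : Sub Γ Δ) (τ : Sub Δ Ξ) :
    (H.subst σ).subst τ = H.subst fun _ x => (σ x).subst τ := by
  funext o
  simp only [Hdl.subst, Tm.subst_subst, Sub.up_subst]

theorem Tm.inst_subst {A : Ty Base Op} (M : Tm (A :: Γ) s) (V : Val Γ A) (σ : Sub Γ Δ) :
    (M.inst V).subst σ = (M.subst σ.up).inst (V.subst σ) := by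
  simp only [Tm.inst, Tm.subst_subst]
  congr 1; funext A x
  cases x with
  | zero => rfl
  | succ x =>
    simp only [Sub.cons, Sub.ids, Tm.subst, Sub.up, Tm.wk, Tm.rename_subst]
    exact (Tm.subst_ids _).symm

theorem Tm.inst₂_subst {A B : Ty Base Op} (M : Tm (B :: A :: Γ) s) (V : Val Γ A) (K : Val Γ B)
    (σ : Sub Γ Δ) :
    (M.inst₂ V K).subst σ = (M.subst σ.up.up).inst₂ (V.subst σ) (K.subst σ) := by
  simp only [Tm.inst₂, Tm.subst_subst]
  congr 1; funext A x
  match x with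
  | .zero => rfl
  | .succ .zero => rfl
  | .succ (.succ x) =>
    simp only [Sub.cons, Sub.ids, Tm.subst, Sub.up, Tm.wk, Tm.rename_subst]
    exact (Tm.subst_ids _).symm

theorem Tm.rename_up_succ_subst {A B : Ty Base Op} (L : Tm (A :: Γ) s) (σ : Sub Γ Δ) :
    (L.rename (Ren.up fun _ x => .succ x)).subst (σ.up (B := B)).up =
      (L.subst σ.up).rename (Ren.up fun _ x => .succ x) := by
  simp only [Tm.rename_subst, Tm.subst_rename]
  congr 1; funext A x
  cases x with
  | zero => rfl
  | succ x => simp only [Sub.up, Ren.up, Tm.wk, Tm.rename_rename]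

theorem Hdl.rename_succ_subst {S : Sig Base Op} {B A : Ty Base Op} {𝒯' : Theory Base Op}
    (H : Hdl Γ S B 𝒯') (σ : Sub Γ Δ) :
    (H.rename fun _ x => Var.succ (b := A) x).subst σ.up =
      (H.subst σ).rename fun _ x => .succ x := by
  simp only [Hdl.rename_eq_subst, Hdl.subst_subst]
  congr 1; funext C x
  simp only [Tm.subst, Sub.up, Tm.wk, Tm.rename_eq_subst]

theorem GSub.up_subst {G : List (GTy Base)} (σ : GSub G Γ) (τ : Sub Γ Δ) (B : GTy Base) :
    (fun _ x => (σ.up x).subst τ.up : GSub (B :: G) (B.toTy Op :: Δ)) =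
      GSub.up fun _ x => (σ x).subst τ := by
  funext A x
  cases x with
  | zero => rfl
  | succ x => simp only [GSub.up, Sub.up, Tm.wk, Tm.rename_subst, Tm.subst_rename]

theorem GTm.inst_subst {G : List (GTy Base)} {A : GTy Base} (V : GTm G A) (σ : GSub G Γ)
    (τ : Sub Γ Δ) : (V.inst σ).subst τ = V.inst fun _ x => (σ x).subst τ := by
  induction V with
  | var x => rfl
  | tuple V ih => exact congrArg Tm.tuple (funext ih)
  | proj i V ih => exact congrArg (Tm.proj (A := fun i => GTy.toTy Op _) i) ih
  | inj i V ih => exact congrArg (Tm.inj (A := fun i => GTy.toTy Op _) i) ih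

theorem ETm.inst_subst {𝒯 : Theory Base Op} {G : List (GTy Base)} {A : GTy Base}
    (M : ETm 𝒯.sig G A) (σ : GSub G Γ) (τ : Sub Γ Δ) :
    (M.inst σ).subst τ = M.inst fun _ x => (σ x).subst τ := by
  induction M generalizing Γ Δ with
  | ret V => simp only [ETm.inst, Tm.subst, GTm.inst_subst]
  | letop o V M ih => simp only [ETm.inst, Tm.subst, GTm.inst_subst, ih, GSub.up_subst]
  | case V M ih =>
    simp only [ETm.inst, Tm.subst, ih, GSub.up_subst]
    exact congrArg (Tm.case · _) (GTm.inst_subst V σ τ)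

theorem ETm.handleWith_subst {S : Sig Base Op} {B : Ty Base Op} {𝒯' : Theory Base Op}
    {G : List (GTy Base)} {A : GTy Base} (M : ETm S G A) (H : Hdl Γ S B 𝒯') (σ : GSub G Γ)
    (k : Val Γ (.fn (A.toTy Op) B 𝒯')) (τ : Sub Γ Δ) :
    (M.handleWith H σ k).subst τ =
      M.handleWith (H.subst τ) (fun _ x => (σ x).subst τ) (k.subst τ) := by
  have wk_subst : ∀ (Γ Δ : Ctx Base Op) (s : Kind Base Op) (C : Ty Base Op) (k : Tm Γ s)
      (τ : Sub Γ Δ), (k.wk (B := C)).subst τ.up = (k.subst τ).wk := by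
    intro Γ Δ s C k τ
    simp only [Tm.wk, Tm.rename_subst, Tm.subst_rename, Sub.up]
  induction M generalizing Γ Δ with
  | ret V => simp only [ETm.handleWith, Tm.subst, GTm.inst_subst]
  | letop o V M ih =>
    simp only [ETm.handleWith, Tm.inst₂_subst, Tm.subst, GTm.inst_subst, ih, GSub.up_subst,
      Hdl.rename_succ_subst, wk_subst]
    rfl
  | case V M ih =>
    simp only [ETm.handleWith, Tm.subst, ih, GSub.up_subst, Hdl.rename_succ_subst, wk_subst]
    exact congrArg (Tm.case · _) (GTm.inst_subst V σ τ)

/-- The extension of a substitution under several binders. -/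
def Sub.ups (σ : Sub Γ Δ) : ∀ Ξ : Ctx Base Op, Sub (Ξ ++ Γ) (Ξ ++ Δ)
  | [] => σ
  | _ :: Ξ => (σ.ups Ξ).up

theorem Sub.ups_ofGround (σ : Sub Γ Δ) {G : List (GTy Base)} {A : GTy Base} (x : Var G A) :
    σ.ups (G.map (GTy.toTy Op)) (x.ofGround Γ) = .var (x.ofGround Δ) := by
  induction x with
  | zero => rfl
  | succ x ih => exact congrArg (Tm.wk (B := GTy.toTy Op _)) ih

theorem Sub.ups_append (σ : Sub Γ Δ) (Ξ : Ctx Base Op) {A : Ty Base Op} (x : Var Γ A) :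
    σ.ups Ξ (Ren.append Γ Ξ x) = (σ x).rename (Ren.append Δ Ξ) := by
  induction Ξ with
  | nil =>
    simp only [Tm.rename_eq_subst]
    exact (Tm.subst_ids _).symm
  | cons B Ξ ih =>
    refine (congrArg (Tm.wk (B := B)) ih).trans ?_
    simp only [Tm.wk, Tm.rename_rename]
    rfl

theorem ETm.translate_subst {S : Sig Base Op} {B : Ty Base Op} {𝒯' : Theory Base Op}
    {G : List (GTy Base)} {A : GTy Base} (M : ETm S G A) (H : Hdl Γ S B 𝒯') (σ : Sub Γ Δ) :
    (M.translate H).subst (σ.ups (G.map (GTy.toTy Op))).up = M.translate (H.subst σ) := by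
  simp only [ETm.translate, ETm.handleWith_subst, Hdl.rename_eq_subst, Hdl.subst_subst]
  congr 1
  · congr 1; funext C x
    simp only [Tm.subst, Sub.up, Sub.ups_append, Tm.wk, Tm.rename_rename]
    rw [Tm.rename_eq_subst]
  · funext C x
    simp only [Tm.subst, Sub.up, Sub.ups_ofGround, Tm.wk, Tm.rename]

end SubstitutionLemmas

/-! ## Stability of typing and equality under substitution -/

section Stability

variable {Base Op : Type u}

/-- A class of substitutions by well-typed values that is closed under extension. -/
structure SubClass (Base Op : Type u) : Type u where
  mem : ∀ {Γ Δ : Ctx Base Op}, Sub Γ Δ → Prop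
  up : ∀ {Γ Δ : Ctx Base Op} {σ : Sub Γ Δ} (_ : mem σ) (B : Ty Base Op), mem (σ.up (B := B))
  wf : ∀ {Γ Δ : Ctx Base Op} {σ : Sub Γ Δ} (_ : mem σ) {A : Ty Base Op} (x : Var Γ A), (σ x).Wf

theorem SubClass.ups (P : SubClass Base Op) {Γ Δ : Ctx Base Op} {σ : Sub Γ Δ} (h : P.mem σ)
    (Ξ : Ctx Base Op) : P.mem (σ.ups Ξ) := by
  induction Ξ with
  | nil => exact h
  | cons B Ξ ih => exact P.up ih B

theorem Sub.up_sum_eta {Γ Δ : Ctx Base Op} {s : Kind Base Op} {n : ℕ} {A : Fin n → Ty Base Op}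
    (M : Tm (.sum A :: Γ) s) (i : Fin n) (σ : Sub Γ Δ) :
    (M.subst (Sub.cons (fun _ x => .var (.succ x)) (.inj i (.var .zero)))).subst σ.up =
      (M.subst σ.up).subst (Sub.cons (fun _ x => .var (.succ x)) (.inj i (.var .zero))) := by
  simp only [Tm.subst_subst]
  congr 1; funext B x
  cases x with
  | zero => rfl
  | succ x =>
    simp only [Sub.cons, Tm.subst, Sub.up, Tm.wk, Tm.rename_subst]
    exact Tm.rename_eq_subst _ _

mutual

theorem SubClass.wf_subst (P : SubClass Base Op) {Γ : Ctx Base Op} {s : Kind Base Op}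
    {M : Tm Γ s} (hM : M.Wf) {Δ : Ctx Base Op} {σ : Sub Γ Δ} (hσ : P.mem σ) :
    (M.subst σ).Wf := by
  match hM with
  | .var x => exact P.wf hσ x
  | .lam h => exact .lam (P.wf_subst h (P.up hσ _))
  | .tuple h => exact .tuple fun i => P.wf_subst (h i) hσ
  | .proj i h => exact .proj i (P.wf_subst h hσ)
  | .inj i h => exact .inj i (P.wf_subst h hσ)
  | .app h h' => exact .app (P.wf_subst h hσ) (P.wf_subst h' hσ)
  | .ret h => exact .ret (P.wf_subst h hσ)
  | .letin h h' => exact .letin (P.wf_subst h hσ) (P.wf_subst h' (P.up hσ _))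
  | .op o h => exact .op o (P.wf_subst h hσ)
  | .case h h' => exact .case (P.wf_subst h hσ) fun i => P.wf_subst (h' i) (P.up hσ _)
  | .handle h hH hr h' =>
    refine .handle (P.wf_subst h hσ) (fun o => P.wf_subst (hH o) (P.up (P.up hσ _) _)) ?_
      (P.wf_subst h' (P.up hσ _))
    intro e he
    have := P.equ_subst (hr e he) (P.up (P.ups hσ _) _)
    simp only [ETm.translate_subst] at this; exact this

theorem SubClass.equ_subst (P : SubClass Base Op) {Γ : Ctx Base Op} {s : Kind Base Op}
    {M N : Tm Γ s} (hM : M.Equ N) {Δ : Ctx Base Op} {σ : Sub Γ Δ} (hσ : P.mem σ) :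
    (M.subst σ).Equ (N.subst σ) := by
  match hM with
  | .refl h => exact .refl (P.wf_subst h hσ)
  | .symm h => exact .symm (P.equ_subst h hσ)
  | .trans h h' => exact .trans (P.equ_subst h hσ) (P.equ_subst h' hσ)
  | .lam h => exact .lam (P.equ_subst h (P.up hσ _))
  | .tuple h => exact .tuple fun i => P.equ_subst (h i) hσ
  | .proj i h => exact .proj i (P.equ_subst h hσ)
  | .inj i h => exact .inj i (P.equ_subst h hσ)
  | .app h h' => exact .app (P.equ_subst h hσ) (P.equ_subst h' hσ)
  | .ret h => exact .ret (P.equ_subst h hσ)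
  | .letin h h' => exact .letin (P.equ_subst h hσ) (P.equ_subst h' (P.up hσ _))
  | .op o h => exact .op o (P.equ_subst h hσ)
  | .case h h' => exact .case (P.equ_subst h hσ) fun i => P.equ_subst (h' i) (P.up hσ _)
  | .handle h hH hr hr' h' =>
    refine .handle (P.equ_subst h hσ) (fun o => P.equ_subst (hH o) (P.up (P.up hσ _) _)) ?_ ?_
      (P.equ_subst h' (P.up hσ _))
    · intro e he
      have := P.equ_subst (hr e he) (P.up (P.ups hσ _) _)
      simp only [ETm.translate_subst] at this; exact this
    · intro e he
      have := P.equ_subst (hr' e he) (P.up (P.ups hσ _) _)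
      simp only [ETm.translate_subst] at this; exact this
  | .fn_beta h h' =>
    rw [Tm.inst_subst]
    exact .fn_beta (P.wf_subst h (P.up hσ _)) (P.wf_subst h' hσ)
  | .fn_eta h =>
    have := Tm.Equ.fn_eta (P.wf_subst h hσ)
    simpa only [Tm.subst, Tm.wk, Tm.rename_subst, Tm.subst_rename, Sub.up] using this
  | .prod_beta (V := V) i h => exact .prod_beta i fun j => P.wf_subst (h j) hσ
  | .prod_eta h => exact .prod_eta (P.wf_subst h hσ)
  | .sum_beta i h h' =>
    rw [Tm.inst_subst]
    exact .sum_beta i (P.wf_subst h hσ) fun j => P.wf_subst (h' j) (P.up hσ _)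
  | .sum_eta h h' =>
    simp only [Tm.subst, Tm.inst_subst, Sub.up_sum_eta]
    exact .sum_eta (P.wf_subst h hσ) (P.wf_subst h' (P.up hσ _))
  | .ret_let h h' =>
    rw [Tm.inst_subst]
    exact .ret_let (P.wf_subst h hσ) (P.wf_subst h' (P.up hσ _))
  | .let_ret h => exact .let_ret (P.wf_subst h hσ)
  | .let_let h h' h'' =>
    simp only [Tm.subst, Tm.rename_up_succ_subst]
    exact .let_let (P.wf_subst h hσ) (P.wf_subst h' (P.up hσ _)) (P.wf_subst h'' (P.up hσ _))
  | .handle_ret h hH hr h' =>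
    rw [Tm.inst_subst]
    refine .handle_ret (P.wf_subst h hσ) (fun o => P.wf_subst (hH o) (P.up (P.up hσ _) _)) ?_
      (P.wf_subst h' (P.up hσ _))
    intro e he
    have := P.equ_subst (hr e he) (P.up (P.ups hσ _) _)
    simp only [ETm.translate_subst] at this; exact this
  | .handle_let (H := H) h h' hH hr h'' =>
    have key := Tm.Equ.handle_let (H := H.subst σ) (P.wf_subst h hσ) (P.wf_subst h' (P.up hσ _))
      (fun o => P.wf_subst (hH o) (P.up (P.up hσ _) _)) (fun e he => by
        have := P.equ_subst (hr e he) (P.up (P.ups hσ _) _)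
        simp only [ETm.translate_subst] at this; exact this) (P.wf_subst h'' (P.up hσ _))
    simp only [← Hdl.rename_succ_subst, ← Tm.rename_up_succ_subst] at key
    exact key
  | .handle_op o h hH hr h' =>
    rw [Tm.inst₂_subst]
    refine .handle_op o (P.wf_subst h hσ) (fun o => P.wf_subst (hH o) (P.up (P.up hσ _) _)) ?_
      (P.wf_subst h' (P.up hσ _))
    intro e he
    have := P.equ_subst (hr e he) (P.up (P.ups hσ _) _)
    simp only [ETm.translate_subst] at this; exact this
  | .inst_ax he h =>
    rw [ETm.inst_subst, ETm.inst_subst]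
    exact .inst_ax he fun A x => P.wf_subst (h A x) hσ

end

end Stability

section Wellformedness

variable {Base Op : Type u} {Γ Δ : Ctx Base Op} {s : Kind Base Op}

/-- Renamings, as a class of substitutions. -/
def SubClass.ren (Base Op : Type u) : SubClass Base Op where
  mem {Γ Δ} σ := ∃ ρ : Ren Γ Δ, σ = fun _ x => .var (ρ x)
  up := by
    rintro _ _ _ ⟨ρ, rfl⟩ B
    exact ⟨ρ.up, Sub.up_var ρ B⟩
  wf := by
    rintro _ _ _ ⟨ρ, rfl⟩ A x
    exact .var _

theorem Tm.Wf.rename {M : Tm Γ s} (h : M.Wf) (ρ : Ren Γ Δ) : (M.rename ρ).Wf := by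
  rw [Tm.rename_eq_subst]
  exact (SubClass.ren Base Op).wf_subst h ⟨ρ, rfl⟩

/-- A substitution by well-typed values. -/
def Sub.Wf (σ : Sub Γ Δ) : Prop := ∀ ⦃A : Ty Base Op⦄ (x : Var Γ A), (σ x).Wf

theorem Sub.Wf.up {σ : Sub Γ Δ} (h : σ.Wf) (B : Ty Base Op) : (σ.up (B := B)).Wf := by
  intro A x
  cases x with
  | zero => exact .var _
  | succ x => exact (h x).rename _

theorem Sub.Wf.cons {σ : Sub Γ Δ} (h : σ.Wf) {B : Ty Base Op} {V : Val Δ B} (hV : V.Wf) :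
    (σ.cons V).Wf := by
  intro A x
  cases x with
  | zero => exact hV
  | succ x => exact h x

theorem Sub.ids_wf : (Sub.ids Γ).Wf := fun _ x => .var x

theorem Sub.ren_wf (ρ : Ren Γ Δ) : Sub.Wf fun _ x => .var (ρ x) := fun _ x => .var (ρ x)

/-- Substitutions by well-typed values, as a class of substitutions. -/
def SubClass.wfs (Base Op : Type u) : SubClass Base Op where
  mem σ := σ.Wf
  up h B := h.up B
  wf h _ x := h x

theorem Tm.Wf.subst {M : Tm Γ s} (h : M.Wf) {σ : Sub Γ Δ} (hσ : σ.Wf) : (M.subst σ).Wf :=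
  (SubClass.wfs Base Op).wf_subst h hσ

theorem Tm.Equ.subst {M N : Tm Γ s} (h : M.Equ N) {σ : Sub Γ Δ} (hσ : σ.Wf) :
    (M.subst σ).Equ (N.subst σ) :=
  (SubClass.wfs Base Op).equ_subst h hσ

theorem Sub.Wf.comp {Ξ : Ctx Base Op} {σ : Sub Γ Δ} (hσ : σ.Wf) {τ : Sub Δ Ξ} (hτ : τ.Wf) :
    Sub.Wf fun _ x => (σ x).subst τ :=
  fun _ x => (hσ x).subst hτ

theorem Hdl.Wf.rename {S : Sig Base Op} {B : Ty Base Op} {𝒯' : Theory Base Op}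
    {H : Hdl Γ S B 𝒯'} (h : H.Wf) (ρ : Ren Γ Δ) : (H.rename ρ).Wf :=
  fun o => Tm.Wf.rename (h o) _

theorem Hdl.Wf.subst {S : Sig Base Op} {B : Ty Base Op} {𝒯' : Theory Base Op}
    {H : Hdl Γ S B 𝒯'} (h : H.Wf) {σ : Sub Γ Δ} (hσ : σ.Wf) : (H.subst σ).Wf :=
  fun o => Tm.Wf.subst (h o) ((hσ.up _).up _)

theorem Tm.Wf.inst {A : Ty Base Op} {M : Tm (A :: Γ) s} {V : Val Γ A} (h : M.Wf) (hV : V.Wf) :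
    (M.inst V).Wf :=
  h.subst (Sub.ids_wf.cons hV)

theorem Tm.Wf.inst₂ {A B : Ty Base Op} {M : Tm (B :: A :: Γ) s} {V : Val Γ A} {K : Val Γ B}
    (h : M.Wf) (hV : V.Wf) (hK : K.Wf) : (M.inst₂ V K).Wf :=
  h.subst ((Sub.ids_wf.cons hV).cons hK)

theorem GTm.inst_wf {G : List (GTy Base)} {A : GTy Base} (V : GTm G A) {σ : GSub G Γ}
    (hσ : ∀ (A : GTy Base) (x : Var G A), (σ x).Wf) : (V.inst σ).Wf := by
  induction V with
  | var x => exact hσ _ x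
  | tuple V ih => exact .tuple ih
  | proj i V ih => exact .proj (A := fun i => GTy.toTy Op _) i ih
  | inj i V ih => exact .inj (A := fun i => GTy.toTy Op _) i ih

theorem GSub.up_wf {G : List (GTy Base)} {σ : GSub G Γ}
    (hσ : ∀ (A : GTy Base) (x : Var G A), (σ x).Wf) (B : GTy Base) (A : GTy Base)
    (x : Var (B :: G) A) : (σ.up x).Wf := by
  cases x with
  | zero => exact .var _
  | succ x => exact (hσ _ x).rename _

theorem ETm.inst_wf {𝒯 : Theory Base Op} {G : List (GTy Base)} {A : GTy Base}
    (M : ETm 𝒯.sig G A) {σ : GSub G Γ} (hσ : ∀ (A : GTy Base) (x : Var G A), (σ x).Wf) :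
    (M.inst σ).Wf := by
  induction M generalizing Γ with
  | ret V => exact .ret (V.inst_wf hσ)
  | letop o V M ih => exact .letin (.op o (V.inst_wf hσ)) (ih (GSub.up_wf hσ _))
  | case V M ih => exact .case (V.inst_wf hσ) fun i => ih i (GSub.up_wf hσ _)

theorem ETm.handleWith_wf {S : Sig Base Op} {B : Ty Base Op} {𝒯' : Theory Base Op}
    {G : List (GTy Base)} {A : GTy Base} (M : ETm S G A) {H : Hdl Γ S B 𝒯'} {σ : GSub G Γ}
    {k : Val Γ (.fn (A.toTy Op) B 𝒯')} (hH : H.Wf)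
    (hσ : ∀ (A : GTy Base) (x : Var G A), (σ x).Wf) (hk : k.Wf) : (M.handleWith H σ k).Wf := by
  induction M generalizing Γ with
  | ret V => exact .app hk (V.inst_wf hσ)
  | letop o V M ih =>
    exact (hH o).inst₂ (V.inst_wf hσ)
      (.lam (ih (hH.rename _) (GSub.up_wf hσ _) (hk.rename _)))
  | case V M ih =>
    exact .case (V.inst_wf hσ)
      fun i => ih i (hH.rename _) (GSub.up_wf hσ _) (hk.rename _)

theorem ETm.translate_wf {S : Sig Base Op} {B : Ty Base Op} {𝒯' : Theory Base Op}
    {G : List (GTy Base)} {A : GTy Base} (M : ETm S G A) {H : Hdl Γ S B 𝒯'} (hH : H.Wf) :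
    (M.translate H).Wf :=
  M.handleWith_wf (hH.rename _) (fun _ _ => .var _) (.var _)

/-- The handler `H` respects the axioms of `𝒯`. -/
def Hdl.Respects {𝒯 : Theory Base Op} {B : Ty Base Op} {𝒯' : Theory Base Op}
    (H : Hdl Γ 𝒯.sig B 𝒯') : Prop :=
  ∀ e ∈ 𝒯.ax, Tm.Equ (e.lhs.translate H) (e.rhs.translate H)

theorem Hdl.Respects.subst {𝒯 : Theory Base Op} {B : Ty Base Op} {𝒯' : Theory Base Op}
    {H : Hdl Γ 𝒯.sig B 𝒯'} (h : H.Respects) {σ : Sub Γ Δ} (hσ : σ.Wf) :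
    (H.subst σ).Respects := fun e he => by
  have := (h e he).subst ((SubClass.wfs Base Op).up ((SubClass.wfs Base Op).ups hσ _) _)
  simp only [ETm.translate_subst] at this; exact this

theorem Tm.Equ.wf {Γ : Ctx Base Op} {s : Kind Base Op} {M N : Tm Γ s} (h : M.Equ N) : M.Wf ∧ N.Wf := by
  match h with
  | .refl h => exact ⟨h, h⟩
  | .symm h => exact h.wf.symm
  | .trans h h' => exact ⟨h.wf.1, h'.wf.2⟩
  | .lam h => exact ⟨.lam h.wf.1, .lam h.wf.2⟩
  | .tuple h => exact ⟨.tuple fun i => (h i).wf.1, .tuple fun i => (h i).wf.2⟩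
  | .proj i h => exact ⟨.proj i h.wf.1, .proj i h.wf.2⟩
  | .inj i h => exact ⟨.inj i h.wf.1, .inj i h.wf.2⟩
  | .app h h' => exact ⟨.app h.wf.1 h'.wf.1, .app h.wf.2 h'.wf.2⟩
  | .ret h => exact ⟨.ret h.wf.1, .ret h.wf.2⟩
  | .letin h h' => exact ⟨.letin h.wf.1 h'.wf.1, .letin h.wf.2 h'.wf.2⟩
  | .op o h => exact ⟨.op o h.wf.1, .op o h.wf.2⟩
  | .case h h' =>
    exact ⟨.case h.wf.1 fun i => (h' i).wf.1, .case h.wf.2 fun i => (h' i).wf.2⟩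
  | .handle h hH hr hr' h' =>
    exact ⟨.handle h.wf.1 (fun o => (hH o).wf.1) hr h'.wf.1,
      .handle h.wf.2 (fun o => (hH o).wf.2) hr' h'.wf.2⟩
  | .fn_beta h h' => exact ⟨.app (.lam h) h', h.inst h'⟩
  | .fn_eta h => exact ⟨h, .lam (.app (h.rename _) (.var _))⟩
  | .prod_beta (V := V) i h => exact ⟨.proj i (.tuple h), h i⟩
  | .prod_eta h => exact ⟨h, .tuple fun i => .proj i h⟩
  | .sum_beta i h h' => exact ⟨.case (.inj i h) h', (h' i).inst h⟩
  | .sum_eta h h' =>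
    exact ⟨.case h fun i => h'.subst ((Sub.ren_wf _).cons (.inj i (.var _))), h'.inst h⟩
  | .ret_let h h' => exact ⟨.letin (.ret h) h', h'.inst h⟩
  | .let_ret h => exact ⟨.letin h (.ret (.var _)), h⟩
  | .let_let h h' h'' =>
    exact ⟨.letin (.letin h h') h'', .letin h (.letin h' (h''.rename _))⟩
  | .handle_ret h hH hr h' => exact ⟨.handle (.ret h) hH hr h', h'.inst h⟩
  | .handle_let (H := H) h h' hH hr h'' =>
    refine ⟨.handle (.letin h h') hH hr h'',
      .handle h hH hr (.handle h' (fun o => (hH o).rename _) ?_ (h''.rename _))⟩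
    rw [Hdl.rename_eq_subst]
    exact Hdl.Respects.subst (H := H) hr (Sub.ren_wf _)
  | .handle_op o h hH hr h' => exact ⟨.handle (.op o h) hH hr h', (hH o).inst₂ h (.lam h')⟩
  | .inst_ax he h => exact ⟨ETm.inst_wf _ h, ETm.inst_wf _ h⟩

theorem Tm.Wf.subst_congr {Γ : Ctx Base Op} {s : Kind Base Op} {M : Tm Γ s} (hM : M.Wf)
    {Δ : Ctx Base Op} {σ τ : Sub Γ Δ}
    (h : ∀ ⦃A : Ty Base Op⦄ (x : Var Γ A), (σ x).Equ (τ x)) :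
    (M.subst σ).Equ (M.subst τ) := by
  have up : ∀ {Γ : Ctx Base Op} {Δ : Ctx Base Op} {σ τ : Sub Γ Δ}
      (_ : ∀ ⦃A : Ty Base Op⦄ (x : Var Γ A), (σ x).Equ (τ x)) (B : Ty Base Op)
      ⦃A : Ty Base Op⦄ (x : Var (B :: Γ) A), (σ.up x).Equ (τ.up x) := by
    intro Γ Δ σ τ h B A x
    cases x with
    | zero => exact .refl (.var _)
    | succ x =>
      simp only [Sub.up, Tm.wk, Tm.rename_eq_subst]
      exact (h x).subst (Sub.ren_wf _)
  match hM with
  | .var x => exact h x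
  | .lam hM => exact .lam (hM.subst_congr (up h _))
  | .tuple hV => exact .tuple fun i => (hV i).subst_congr h
  | .proj i hV => exact .proj i (hV.subst_congr h)
  | .inj i hV => exact .inj i (hV.subst_congr h)
  | .app hV hW => exact .app (hV.subst_congr h) (hW.subst_congr h)
  | .ret hV => exact .ret (hV.subst_congr h)
  | .letin hM hN => exact .letin (hM.subst_congr h) (hN.subst_congr (up h _))
  | .op o hV => exact .op o (hV.subst_congr h)
  | .case hV hM => exact .case (hV.subst_congr h) fun i => (hM i).subst_congr (up h _)
  | .handle (H := H) hM hH hr hN =>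
    exact .handle (hM.subst_congr h) (fun o => (hH o).subst_congr (up (up h _) _))
      (Hdl.Respects.subst (H := H) hr fun _ x => (h x).wf.1)
      (Hdl.Respects.subst (H := H) hr fun _ x => (h x).wf.2) (hN.subst_congr (up h _))

end Wellformedness

/-! ## Terms up to derivable equality -/

section Classes

variable {Base Op : Type u}

/-- Derivable equality as an equivalence relation on well-typed terms. -/
def tmSetoid (Γ : Ctx Base Op) (s : Kind Base Op) : Setoid {M : Tm Γ s // M.Wf} where
  r M N := M.1.Equ N.1
  iseqv := ⟨fun M => .refl M.2, .symm, .trans⟩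

/-- Well-typed terms up to derivable equality. -/
def Cl (Γ : Ctx Base Op) (s : Kind Base Op) : Type u := Quotient (tmSetoid Γ s)

/-- Substitutions by classes of values. -/
abbrev CSub (Γ Δ : Ctx Base Op) : Type u := ∀ ⦃A : Ty Base Op⦄, Var Γ A → Cl Δ (.val A)

/-- Handlers up to derivable equality. -/
abbrev CHdl (Γ : Ctx Base Op) (S : Sig Base Op) (B : Ty Base Op) (𝒯' : Theory Base Op) : Type u :=
  ∀ o : S.Idx, Cl (.fn (S.resTy o) B 𝒯' :: S.argTy o :: Γ) (.cmp B 𝒯')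

/-- Substitutions by classes of values for a ground context. -/
abbrev CGSub (G : List (GTy Base)) (Γ : Ctx Base Op) : Type u :=
  ∀ ⦃A : GTy Base⦄, Var G A → Cl Γ (.val (A.toTy Op))

namespace Cl

variable {Γ Δ Ξ : Ctx Base Op} {s : Kind Base Op} {A B : Ty Base Op} {𝒯 𝒯' : Theory Base Op}

/-- The class of a well-typed term. -/
def mk (M : Tm Γ s) (h : M.Wf) : Cl Γ s := Quotient.mk (tmSetoid Γ s) ⟨M, h⟩

theorem mk_eq_mk {M N : Tm Γ s} {hM : M.Wf} {hN : N.Wf} : mk M hM = mk N hN ↔ M.Equ N :=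
  ⟨fun h => Quotient.exact (s := tmSetoid Γ s) h,
    fun h => Quotient.sound (s := tmSetoid Γ s) h⟩

theorem mk_congr {M N : Tm Γ s} (h : M = N) (hM : M.Wf) : mk M hM = mk N (h ▸ hM) := by
  subst h; rfl

/-- A representative of a class. -/
noncomputable def rep (m : Cl Γ s) : Tm Γ s := (Quotient.out (s := tmSetoid Γ s) m).1

theorem rep_wf (m : Cl Γ s) : m.rep.Wf := (Quotient.out (s := tmSetoid Γ s) m).2

theorem mk_rep (m : Cl Γ s) : mk m.rep m.rep_wf = m := Quotient.out_eq (s := tmSetoid Γ s) m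

theorem rep_mk {M : Tm Γ s} (h : M.Wf) : (mk M h).rep.Equ M := mk_eq_mk.1 (mk_rep (mk M h))

theorem exists_mk (m : Cl Γ s) : ∃ M h, m = mk M h := ⟨_, _, m.mk_rep.symm⟩

theorem exists_mk_pi {ι : Type v} {Γ : ι → Ctx Base Op} {s : ι → Kind Base Op}
    (m : ∀ i, Cl (Γ i) (s i)) : ∃ (M : ∀ i, Tm (Γ i) (s i)) (h : ∀ i, (M i).Wf),
      m = fun i => mk (M i) (h i) :=
  ⟨fun i => (m i).rep, fun i => (m i).rep_wf, funext fun i => (m i).mk_rep.symm⟩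

/-- The class of a substitution. -/
def ofSub (σ : Sub Γ Δ) (h : σ.Wf) : CSub Γ Δ := fun _ x => mk (σ x) (h x)

theorem exists_ofSub (σ : CSub Γ Δ) : ∃ σ' h, σ = ofSub σ' h :=
  ⟨fun _ x => (σ x).rep, fun _ x => (σ x).rep_wf,
    funext fun _ => funext fun x => (σ x).mk_rep.symm⟩

noncomputable section

def var (x : Var Γ A) : Cl Γ (.val A) := mk (.var x) (.var x)

def lam (m : Cl (A :: Γ) (.cmp B 𝒯)) : Cl Γ (.val (.fn A B 𝒯)) := mk (.lam m.rep) (.lam m.rep_wf)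

def tuple {n : ℕ} {A : Fin n → Ty Base Op} (v : ∀ i, Cl Γ (.val (A i))) :
    Cl Γ (.val (.prod A)) :=
  mk (.tuple fun i => (v i).rep) (.tuple fun i => (v i).rep_wf)

def proj {n : ℕ} {A : Fin n → Ty Base Op} (i : Fin n) (v : Cl Γ (.val (.prod A))) :
    Cl Γ (.val (A i)) :=
  mk (.proj i v.rep) (.proj i v.rep_wf)

def inj {n : ℕ} {A : Fin n → Ty Base Op} (i : Fin n) (v : Cl Γ (.val (A i))) :
    Cl Γ (.val (.sum A)) :=
  mk (.inj i v.rep) (.inj i v.rep_wf)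

def app (v : Cl Γ (.val (.fn A B 𝒯))) (w : Cl Γ (.val A)) : Cl Γ (.cmp B 𝒯) :=
  mk (.app v.rep w.rep) (.app v.rep_wf w.rep_wf)

def ret (v : Cl Γ (.val A)) : Cl Γ (.cmp A 𝒯) := mk (.ret v.rep) (.ret v.rep_wf)

def letin (m : Cl Γ (.cmp A 𝒯)) (n : Cl (A :: Γ) (.cmp B 𝒯)) : Cl Γ (.cmp B 𝒯) :=
  mk (.letin m.rep n.rep) (.letin m.rep_wf n.rep_wf)

def op (o : 𝒯.sig.Idx) (v : Cl Γ (.val (𝒯.sig.argTy o))) : Cl Γ (.cmp (𝒯.sig.resTy o) 𝒯) :=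
  mk (.op o v.rep) (.op o v.rep_wf)

def case {n : ℕ} {A : Fin n → Ty Base Op} (v : Cl Γ (.val (.sum A)))
    (m : ∀ i, Cl (A i :: Γ) (.cmp B 𝒯)) : Cl Γ (.cmp B 𝒯) :=
  mk (.case v.rep fun i => (m i).rep) (.case v.rep_wf fun i => (m i).rep_wf)

def subst (m : Cl Γ s) (σ : CSub Γ Δ) : Cl Δ s :=
  mk (m.rep.subst fun _ x => (σ x).rep) (m.rep_wf.subst fun _ x => (σ x).rep_wf)

end

theorem lam_mk {M : Cmp (A :: Γ) B 𝒯} (h : M.Wf) : lam (mk M h) = mk (.lam M) (.lam h) :=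
  mk_eq_mk.2 (.lam (rep_mk h))

theorem tuple_mk {n : ℕ} {A : Fin n → Ty Base Op} {V : ∀ i, Val Γ (A i)} (h : ∀ i, (V i).Wf) :
    tuple (fun i => mk (V i) (h i)) = mk (.tuple V) (.tuple h) :=
  mk_eq_mk.2 (.tuple fun i => rep_mk (h i))

theorem proj_mk {n : ℕ} {A : Fin n → Ty Base Op} (i : Fin n) {V : Val Γ (.prod A)} (h : V.Wf) :
    proj i (mk V h) = mk (.proj i V) (.proj i h) :=
  mk_eq_mk.2 (.proj i (rep_mk h))

theorem inj_mk {n : ℕ} {A : Fin n → Ty Base Op} (i : Fin n) {V : Val Γ (A i)} (h : V.Wf) :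
    inj i (mk V h) = mk (.inj i V) (.inj (A := A) i h) :=
  mk_eq_mk.2 (.inj i (rep_mk h))

theorem app_mk {V : Val Γ (.fn A B 𝒯)} {W : Val Γ A} (h : V.Wf) (h' : W.Wf) :
    app (mk V h) (mk W h') = mk (.app V W) (.app h h') :=
  mk_eq_mk.2 (.app (rep_mk h) (rep_mk h'))

theorem ret_mk {V : Val Γ A} (h : V.Wf) : ret (𝒯 := 𝒯) (mk V h) = mk (.ret V) (.ret h) :=
  mk_eq_mk.2 (.ret (rep_mk h))

theorem letin_mk {M : Cmp Γ A 𝒯} {N : Cmp (A :: Γ) B 𝒯} (h : M.Wf) (h' : N.Wf) :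
    letin (mk M h) (mk N h') = mk (.letin M N) (.letin h h') :=
  mk_eq_mk.2 (.letin (rep_mk h) (rep_mk h'))

theorem op_mk (o : 𝒯.sig.Idx) {V : Val Γ (𝒯.sig.argTy o)} (h : V.Wf) :
    op o (mk V h) = mk (.op o V) (.op o h) :=
  mk_eq_mk.2 (.op o (rep_mk h))

theorem case_mk {n : ℕ} {A : Fin n → Ty Base Op} {V : Val Γ (.sum A)}
    {M : ∀ i, Cmp (A i :: Γ) B 𝒯} (h : V.Wf) (h' : ∀ i, (M i).Wf) :
    case (mk V h) (fun i => mk (M i) (h' i)) = mk (.case V M) (.case h h') :=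
  mk_eq_mk.2 (.case (rep_mk h) fun i => rep_mk (h' i))

theorem subst_mk {M : Tm Γ s} (h : M.Wf) {σ : Sub Γ Δ} (hσ : σ.Wf) :
    (mk M h).subst (ofSub σ hσ) = mk (M.subst σ) (h.subst hσ) :=
  mk_eq_mk.2 (.trans ((rep_wf _).subst_congr fun _ x => rep_mk (hσ x)) ((rep_mk h).subst hσ))

end Cl

namespace CSub

variable {Γ Δ Ξ Θ : Ctx Base Op} {s : Kind Base Op} {A B : Ty Base Op}

/-- The identity substitution. -/
def ids (Γ : Ctx Base Op) : CSub Γ Γ := fun _ x => .var x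

/-- The weakening substitution. -/
def shift (Γ : Ctx Base Op) (B : Ty Base Op) : CSub Γ (B :: Γ) := fun _ x => .var (.succ x)

/-- The composite of two substitutions. -/
noncomputable def comp (σ : CSub Γ Δ) (τ : CSub Δ Ξ) : CSub Γ Ξ := fun _ x => (σ x).subst τ

/-- The extension of a substitution by a value. -/
def cons (σ : CSub Γ Δ) (v : Cl Δ (.val B)) : CSub (B :: Γ) Δ
  | _, .zero => v
  | _, .succ x => σ x

/-- The extension of a substitution under a binder. -/
@[simp] noncomputable def up (σ : CSub Γ Δ) {B : Ty Base Op} : CSub (B :: Γ) (B :: Δ) :=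
  cons (comp σ (shift Δ B)) (.var .zero)

@[simp] theorem cons_zero (σ : CSub Γ Δ) (v : Cl Δ (.val B)) : cons σ v .zero = v := rfl

@[simp] theorem cons_succ (σ : CSub Γ Δ) (v : Cl Δ (.val B)) (x : Var Γ A) :
    cons σ v (.succ x) = σ x := rfl

@[simp] theorem ids_apply (x : Var Γ A) : ids Γ x = .var x := rfl

@[simp] theorem shift_apply (x : Var Γ A) : shift Γ B x = .var (.succ x) := rfl

theorem comp_apply (σ : CSub Γ Δ) (τ : CSub Δ Ξ) (x : Var Γ A) :
    comp σ τ x = (σ x).subst τ := rfl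

theorem ext_cons {σ τ : CSub (B :: Γ) Δ} (h₀ : σ .zero = τ .zero)
    (h : ∀ ⦃A : Ty Base Op⦄ (x : Var Γ A), σ (.succ x) = τ (.succ x)) : σ = τ := by
  funext A x
  cases x with
  | zero => exact h₀
  | succ x => exact h x

end CSub

open CSub

namespace Cl

variable {Γ Δ Ξ : Ctx Base Op} {s : Kind Base Op} {A B : Ty Base Op} {𝒯 𝒯' : Theory Base Op}

theorem ofSub_ids : ofSub (Sub.ids Γ) Sub.ids_wf = ids Γ := rfl

theorem ofSub_shift : ofSub (fun _ x => .var (.succ x)) (Sub.ren_wf fun _ x => .succ x) =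
    shift Γ B := rfl

theorem ofSub_cons {σ : Sub Γ Δ} (hσ : σ.Wf) {V : Val Δ B} (hV : V.Wf) :
    ofSub (σ.cons V) (hσ.cons hV) = cons (ofSub σ hσ) (mk V hV) :=
  ext_cons rfl fun _ _ => rfl

theorem subst_shift_mk {M : Tm Γ s} (h : M.Wf) :
    (mk M h).subst (shift Γ B) = mk M.wk (h.rename _) := by
  rw [← ofSub_shift, subst_mk]
  exact mk_congr (Tm.rename_eq_subst _ _).symm _

theorem ofSub_up {σ : Sub Γ Δ} (hσ : σ.Wf) :
    ofSub (σ.up (B := B)) (hσ.up B) = up (ofSub σ hσ) :=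
  ext_cons rfl fun _ x => (subst_shift_mk (hσ x)).symm

@[simp] theorem subst_var (x : Var Γ A) (σ : CSub Γ Δ) : (var x).subst σ = σ x := by
  obtain ⟨σ, hσ, rfl⟩ := exists_ofSub σ
  exact subst_mk (.var x) hσ

@[simp] theorem subst_lam (m : Cl (A :: Γ) (.cmp B 𝒯)) (σ : CSub Γ Δ) :
    (lam m).subst σ = lam (m.subst σ.up) := by
  obtain ⟨σ, hσ, rfl⟩ := exists_ofSub σ
  obtain ⟨M, hM, rfl⟩ := exists_mk m
  simp only [← ofSub_up, subst_mk, lam_mk]; rfl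

@[simp] theorem subst_tuple {n : ℕ} {A : Fin n → Ty Base Op} (v : ∀ i, Cl Γ (.val (A i)))
    (σ : CSub Γ Δ) : (tuple v).subst σ = tuple fun i => (v i).subst σ := by
  obtain ⟨σ, hσ, rfl⟩ := exists_ofSub σ
  obtain ⟨V, hV, rfl⟩ := exists_mk_pi v
  simp only [subst_mk, tuple_mk]; rfl

@[simp] theorem subst_proj {n : ℕ} {A : Fin n → Ty Base Op} (i : Fin n)
    (v : Cl Γ (.val (.prod A))) (σ : CSub Γ Δ) : (proj i v).subst σ = proj i (v.subst σ) := by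
  obtain ⟨σ, hσ, rfl⟩ := exists_ofSub σ
  obtain ⟨V, hV, rfl⟩ := exists_mk v
  simp only [subst_mk, proj_mk]; rfl

@[simp] theorem subst_inj {n : ℕ} {A : Fin n → Ty Base Op} (i : Fin n)
    (v : Cl Γ (.val (A i))) (σ : CSub Γ Δ) :
    (inj (A := A) i v).subst σ = inj i (v.subst σ) := by
  obtain ⟨σ, hσ, rfl⟩ := exists_ofSub σ
  obtain ⟨V, hV, rfl⟩ := exists_mk v
  simp only [subst_mk, inj_mk]; rfl

@[simp] theorem subst_app (v : Cl Γ (.val (.fn A B 𝒯))) (w : Cl Γ (.val A)) (σ : CSub Γ Δ) :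
    (app v w).subst σ = app (v.subst σ) (w.subst σ) := by
  obtain ⟨σ, hσ, rfl⟩ := exists_ofSub σ
  obtain ⟨V, hV, rfl⟩ := exists_mk v
  obtain ⟨W, hW, rfl⟩ := exists_mk w
  simp only [subst_mk, app_mk]; rfl

@[simp] theorem subst_ret (v : Cl Γ (.val A)) (σ : CSub Γ Δ) :
    (ret (𝒯 := 𝒯) v).subst σ = ret (v.subst σ) := by
  obtain ⟨σ, hσ, rfl⟩ := exists_ofSub σ
  obtain ⟨V, hV, rfl⟩ := exists_mk v
  simp only [subst_mk, ret_mk]; rfl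

@[simp] theorem subst_letin (m : Cl Γ (.cmp A 𝒯)) (n : Cl (A :: Γ) (.cmp B 𝒯)) (σ : CSub Γ Δ) :
    (letin m n).subst σ = letin (m.subst σ) (n.subst σ.up) := by
  obtain ⟨σ, hσ, rfl⟩ := exists_ofSub σ
  obtain ⟨M, hM, rfl⟩ := exists_mk m
  obtain ⟨N, hN, rfl⟩ := exists_mk n
  simp only [← ofSub_up, subst_mk, letin_mk]; rfl

@[simp] theorem subst_op (o : 𝒯.sig.Idx) (v : Cl Γ (.val (𝒯.sig.argTy o))) (σ : CSub Γ Δ) :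
    (op o v).subst σ = op o (v.subst σ) := by
  obtain ⟨σ, hσ, rfl⟩ := exists_ofSub σ
  obtain ⟨V, hV, rfl⟩ := exists_mk v
  simp only [subst_mk, op_mk]; rfl

@[simp] theorem subst_case {n : ℕ} {A : Fin n → Ty Base Op} (v : Cl Γ (.val (.sum A)))
    (m : ∀ i, Cl (A i :: Γ) (.cmp B 𝒯)) (σ : CSub Γ Δ) :
    (case v m).subst σ = case (v.subst σ) fun i => (m i).subst σ.up := by
  obtain ⟨σ, hσ, rfl⟩ := exists_ofSub σ
  obtain ⟨V, hV, rfl⟩ := exists_mk v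
  obtain ⟨M, hM, rfl⟩ := exists_mk_pi m
  simp only [← ofSub_up, subst_mk, case_mk]; rfl

theorem ofSub_comp {σ : Sub Γ Δ} (hσ : σ.Wf) {τ : Sub Δ Ξ} (hτ : τ.Wf) :
    comp (ofSub σ hσ) (ofSub τ hτ) = ofSub (fun _ x => (σ x).subst τ) (hσ.comp hτ) :=
  funext fun _ => funext fun x => subst_mk (hσ x) hτ

@[simp] theorem subst_subst (m : Cl Γ s) (σ : CSub Γ Δ) (τ : CSub Δ Ξ) :
    (m.subst σ).subst τ = m.subst (comp σ τ) := by
  obtain ⟨σ, hσ, rfl⟩ := exists_ofSub σ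
  obtain ⟨τ, hτ, rfl⟩ := exists_ofSub τ
  obtain ⟨M, hM, rfl⟩ := exists_mk m
  simp only [ofSub_comp, subst_mk]
  exact mk_congr (Tm.subst_subst _ _ _) _

@[simp] theorem subst_ids (m : Cl Γ s) : m.subst (ids Γ) = m := by
  obtain ⟨M, hM, rfl⟩ := exists_mk m
  rw [← ofSub_ids, subst_mk]
  exact mk_congr (Tm.subst_ids _) _

end Cl

namespace CSub

variable {Γ Δ Ξ Θ : Ctx Base Op} {s : Kind Base Op} {A B : Ty Base Op}

@[simp] theorem comp_cons (σ : CSub Γ Δ) (v : Cl Δ (.val B)) (τ : CSub Δ Ξ) :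
    comp (cons σ v) τ = cons (comp σ τ) (v.subst τ) :=
  ext_cons rfl fun _ _ => rfl

@[simp] theorem comp_ids (σ : CSub Γ Δ) : comp σ (ids Δ) = σ :=
  funext fun _ => funext fun _ => Cl.subst_ids _

@[simp] theorem ids_comp (σ : CSub Γ Δ) : comp (ids Γ) σ = σ :=
  funext fun _ => funext fun _ => Cl.subst_var _ _

@[simp] theorem comp_assoc (σ : CSub Γ Δ) (τ : CSub Δ Ξ) (υ : CSub Ξ Θ) :
    comp (comp σ τ) υ = comp σ (comp τ υ) :=
  funext fun _ => funext fun _ => Cl.subst_subst _ _ _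

@[simp] theorem shift_comp (σ : CSub Γ Δ) (v : Cl Δ (.val B)) :
    comp (shift Γ B) (cons σ v) = σ :=
  funext fun _ => funext fun _ => Cl.subst_var _ _

@[simp] theorem cons_shift : cons (shift Γ B) (.var .zero) = ids (B :: Γ) :=
  ext_cons rfl fun _ _ => rfl

@[simp] theorem cons_shift_shift :
    cons (comp (shift Γ A) (shift (A :: Γ) B)) (.var (.succ .zero)) = shift (A :: Γ) B :=
  ext_cons rfl fun _ _ => Cl.subst_var _ _

end CSub

namespace CHdl

variable {Γ Δ Ξ : Ctx Base Op} {S : Sig Base Op} {B : Ty Base Op} {𝒯 𝒯' : Theory Base Op}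

/-- The action of a substitution on handlers. -/
noncomputable def subst (h : CHdl Γ S B 𝒯') (σ : CSub Γ Δ) : CHdl Δ S B 𝒯' :=
  fun o => (h o).subst σ.up.up

theorem subst_apply (h : CHdl Γ S B 𝒯') (σ : CSub Γ Δ) (o : S.Idx) :
    subst h σ o = (h o).subst σ.up.up := rfl

@[simp] theorem subst_subst (h : CHdl Γ S B 𝒯') (σ : CSub Γ Δ) (τ : CSub Δ Ξ) :
    subst (subst h σ) τ = subst h (comp σ τ) := by
  funext o; simp [subst]

@[simp] theorem subst_ids (h : CHdl Γ S B 𝒯') : subst h (ids Γ) = h := by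
  funext o; simp [subst]

/-- The class of a handler. -/
def ofHdl (H : Hdl Γ S B 𝒯') (h : H.Wf) : CHdl Γ S B 𝒯' := fun o => .mk (H o) (h o)

theorem ofHdl_congr {H H' : Hdl Γ S B 𝒯'} (e : H = H') (h : H.Wf) :
    ofHdl H h = ofHdl H' (e ▸ h) := by
  subst e; rfl

theorem ofHdl_subst (H : Hdl Γ S B 𝒯') (h : H.Wf) {σ : Sub Γ Δ} (hσ : σ.Wf) :
    subst (ofHdl H h) (Cl.ofSub σ hσ) =
      ofHdl (H.subst σ) (h.subst hσ) := by
  funext o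
  simp only [subst, ofHdl, ← Cl.ofSub_up, Cl.subst_mk]; rfl

end CHdl

/-! ### Effect theory terms up to derivable equality -/

section Ground

variable {Γ Δ Ξ : Ctx Base Op} {S : Sig Base Op} {B : Ty Base Op} {𝒯 𝒯' : Theory Base Op}
  {G : List (GTy Base)} {A : GTy Base}

/-- The extension of a ground substitution by a value. -/
def CGSub.cons (σ : CGSub G Γ) {B : GTy Base} (v : Cl Γ (.val (B.toTy Op))) : CGSub (B :: G) Γ
  | _, .zero => v
  | _, .succ x => σ x

/-- The composite of a ground substitution with a substitution. -/
noncomputable def CGSub.comp (σ : CGSub G Γ) (τ : CSub Γ Δ) : CGSub G Δ :=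
  fun _ x => (σ x).subst τ

theorem CGSub.ext_cons {B : GTy Base} {σ τ : CGSub (B :: G) Γ} (h₀ : σ .zero = τ .zero)
    (h : ∀ ⦃A : GTy Base⦄ (x : Var G A), σ (.succ x) = τ (.succ x)) : σ = τ := by
  funext A x
  cases x with
  | zero => exact h₀
  | succ x => exact h x

theorem CGSub.comp_apply (σ : CGSub G Γ) (τ : CSub Γ Δ) (x : Var G A) :
    σ.comp τ x = (σ x).subst τ := rfl

@[simp] theorem CGSub.comp_cons (σ : CGSub G Γ) {B : GTy Base} (v : Cl Γ (.val (B.toTy Op)))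
    (τ : CSub Γ Δ) : (σ.cons v).comp τ = (σ.comp τ).cons (v.subst τ) :=
  ext_cons rfl fun _ _ => rfl

@[simp] theorem CGSub.comp_comp (σ : CGSub G Γ) (τ : CSub Γ Δ) (υ : CSub Δ Ξ) :
    (σ.comp τ).comp υ = σ.comp (CSub.comp τ υ) :=
  funext fun _ => funext fun _ => Cl.subst_subst _ _ _

/-- The extension of a ground substitution under a binder. -/
@[simp] noncomputable def CGSub.up (σ : CGSub G Γ) {B : GTy Base} : CGSub (B :: G) (B.toTy Op :: Γ) :=
  (σ.comp (shift Γ _)).cons (.var .zero)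

/-- The class of a ground substitution. -/
def CGSub.ofGSub (σ : GSub G Γ) (h : ∀ (A : GTy Base) (x : Var G A), (σ x).Wf) : CGSub G Γ :=
  fun _ x => .mk (σ x) (h _ x)

theorem CGSub.ofGSub_up {σ : GSub G Γ} (h : ∀ (A : GTy Base) (x : Var G A), (σ x).Wf)
    (B : GTy Base) : ofGSub (σ.up (B := B)) (GSub.up_wf h B) = up (ofGSub σ h) :=
  ext_cons rfl fun _ x => (Cl.subst_shift_mk (h _ x)).symm

/-- `V[σ]` up to derivable equality. -/
noncomputable def GTm.clInst (σ : CGSub G Γ) : ∀ {A : GTy Base}, GTm G A → Cl Γ (.val (A.toTy Op))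
  | _, .var x => σ x
  | _, .tuple V => .tuple fun i => (V i).clInst σ
  | _, .proj (A := A) i V => .proj (A := fun i => (A i).toTy Op) i (V.clInst σ)
  | _, .inj (A := A) i V => .inj (A := fun i => (A i).toTy Op) i (V.clInst σ)

theorem GTm.clInst_ofGSub (V : GTm G A) {σ : GSub G Γ}
    (h : ∀ (A : GTy Base) (x : Var G A), (σ x).Wf) :
    V.clInst (.ofGSub σ h) = .mk (V.inst σ) (V.inst_wf h) := by
  induction V with
  | var x => rfl
  | tuple V ih => exact (congrArg Cl.tuple (funext ih)).trans (Cl.tuple_mk _)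
  | proj i V ih =>
    exact (congrArg (Cl.proj (A := fun i => GTy.toTy Op _) i) ih).trans (Cl.proj_mk _ _)
  | inj i V ih =>
    exact (congrArg (Cl.inj (A := fun i => GTy.toTy Op _) i) ih).trans (Cl.inj_mk _ _)

@[simp] theorem GTm.clInst_subst (V : GTm G A) (σ : CGSub G Γ) (τ : CSub Γ Δ) :
    (V.clInst σ).subst τ = V.clInst (σ.comp τ) := by
  induction V with
  | var x => rfl
  | tuple V ih => exact (Cl.subst_tuple _ _).trans (congrArg Cl.tuple (funext ih))
  | proj i V ih =>
    exact (Cl.subst_proj _ _ _).trans (congrArg (Cl.proj (A := fun i => GTy.toTy Op _) i) ih)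
  | inj i V ih =>
    exact (Cl.subst_inj _ _ _).trans (congrArg (Cl.inj (A := fun i => GTy.toTy Op _) i) ih)

/-- `M[σ]` up to derivable equality. -/
noncomputable def ETm.clInst : ∀ {G : List (GTy Base)} {A : GTy Base}, ETm 𝒯.sig G A →
    ∀ {Γ : Ctx Base Op}, CGSub G Γ → Cl Γ (.cmp (A.toTy Op) 𝒯)
  | _, _, .ret V, _, σ => .ret (V.clInst σ)
  | _, _, .letop o V M, _, σ => .letin (.op o (V.clInst σ)) (M.clInst σ.up)
  | _, _, .case (B := B) V M, _, σ =>
      .case (A := fun i => (B i).toTy Op) (V.clInst σ) fun i => (M i).clInst σ.up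

theorem ETm.clInst_ofGSub (M : ETm 𝒯.sig G A) {σ : GSub G Γ}
    (h : ∀ (A : GTy Base) (x : Var G A), (σ x).Wf) :
    M.clInst (.ofGSub σ h) = .mk (M.inst σ) (M.inst_wf h) := by
  induction M generalizing Γ with
  | ret V => simp only [ETm.clInst, GTm.clInst_ofGSub, Cl.ret_mk]; rfl
  | letop o V M ih =>
    simp only [ETm.clInst, GTm.clInst_ofGSub, ← CGSub.ofGSub_up, ih, Cl.op_mk, Cl.letin_mk]; rfl
  | case V M ih =>
    simp only [ETm.clInst, ← CGSub.ofGSub_up, ih]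
    exact (congrArg (Cl.case (A := fun i => GTy.toTy Op _) · _) (V.clInst_ofGSub h)).trans
      (Cl.case_mk _ _)

/-- The translation of an effect theory term by a handler and a continuation, up to derivable
equality. -/
noncomputable def ETm.clHandle : ∀ {G : List (GTy Base)} {A : GTy Base}, ETm S G A →
    ∀ {Γ : Ctx Base Op}, CHdl Γ S B 𝒯' → CGSub G Γ → Cl Γ (.val (.fn (A.toTy Op) B 𝒯')) →
      Cl Γ (.cmp B 𝒯')
  | _, _, .ret V, _, _, σ, k => .app k (V.clInst σ)
  | _, _, .letop o V M, Γ, h, σ, k =>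
      (h o).subst (((ids Γ).cons (V.clInst σ)).cons
        (.lam (M.clHandle (h.subst (shift Γ _)) σ.up (k.subst (shift Γ _)))))
  | _, _, .case (B := B) V M, Γ, h, σ, k =>
      .case (A := fun i => (B i).toTy Op) (V.clInst σ)
        fun i => (M i).clHandle (h.subst (shift Γ _)) σ.up (k.subst (shift Γ _))

theorem ETm.clHandle_mk (M : ETm S G A) {H : Hdl Γ S B 𝒯'} (hH : H.Wf) {σ : GSub G Γ}
    (hσ : ∀ (A : GTy Base) (x : Var G A), (σ x).Wf) {k : Val Γ (.fn (A.toTy Op) B 𝒯')}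
    (hk : k.Wf) :
    M.clHandle (.ofHdl H hH) (.ofGSub σ hσ) (.mk k hk) =
      .mk (M.handleWith H σ k) (M.handleWith_wf hH hσ hk) := by
  have hren : ∀ {Γ : Ctx Base Op} {H : Hdl Γ S B 𝒯'} (hH : H.Wf) (C : Ty Base Op),
      CHdl.subst (.ofHdl H hH) (shift Γ C) =
        .ofHdl (H.rename fun _ x => .succ x) (hH.rename _) := by
    intro Γ H hH C
    rw [← Cl.ofSub_shift, CHdl.ofHdl_subst]
    exact CHdl.ofHdl_congr (Hdl.rename_eq_subst _ _).symm _
  induction M generalizing Γ with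
  | ret V => simp only [ETm.clHandle, GTm.clInst_ofGSub, Cl.app_mk]; rfl
  | letop o V M ih =>
    simp only [ETm.clHandle, GTm.clInst_ofGSub, ← CGSub.ofGSub_up, hren, Cl.subst_shift_mk, ih,
      Cl.lam_mk]
    rw [← Cl.ofSub_ids, ← Cl.ofSub_cons, ← Cl.ofSub_cons]
    exact Cl.subst_mk _ _
  | case V M ih =>
    simp only [ETm.clHandle, ← CGSub.ofGSub_up, hren, Cl.subst_shift_mk, ih]
    exact (congrArg (Cl.case (A := fun i => GTy.toTy Op _) · _) (V.clInst_ofGSub hσ)).trans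
      (Cl.case_mk _ _)

theorem ETm.clHandle_subst (M : ETm S G A) (h : CHdl Γ S B 𝒯') (σ : CGSub G Γ)
    (k : Cl Γ (.val (.fn (A.toTy Op) B 𝒯'))) (τ : CSub Γ Δ) :
    (M.clHandle h σ k).subst τ = M.clHandle (h.subst τ) (σ.comp τ) (k.subst τ) := by
  induction M generalizing Γ Δ with
  | ret V => simp [ETm.clHandle]
  | letop o V M ih => simp [ETm.clHandle, ih, CHdl.subst_apply]
  | case V M ih =>
    refine (Cl.subst_case (A := fun i => GTy.toTy Op _) _ _ _).trans ?_
    refine congr (congrArg (Cl.case (A := fun i => GTy.toTy Op _)) (V.clInst_subst σ τ))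
      (funext fun i => ?_)
    simp [ih]

/-- The handler `h` respects the axioms of `𝒯`. -/
def CHdl.Resp (h : CHdl Γ 𝒯.sig B 𝒯') : Prop :=
  ∀ e ∈ 𝒯.ax, ∀ {Δ : Ctx Base Op} (τ : CSub Γ Δ) (σ : CGSub e.ctx Δ)
    (k : Cl Δ (.val (.fn (e.ty.toTy Op) B 𝒯'))),
    e.lhs.clHandle (h.subst τ) σ k = e.rhs.clHandle (h.subst τ) σ k

theorem CHdl.Resp.subst {h : CHdl Γ 𝒯.sig B 𝒯'} (hr : h.Resp) (τ : CSub Γ Δ) :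
    (h.subst τ).Resp := fun e he Ξ υ σ k => by
  simpa only [CHdl.subst_subst] using hr e he (CSub.comp τ υ) σ k

/-- The substitution of `τ` for `Γ` and of `σ` for `G` in the context `Γ, G`. -/
def CSub.append (τ : CSub Γ Δ) : ∀ {G : List (GTy Base)}, CGSub G Δ →
    CSub (G.map (GTy.toTy Op) ++ Γ) Δ
  | [], _ => τ
  | _ :: _, σ => CSub.cons (CSub.append τ fun _ x => σ (.succ x)) (σ .zero)

theorem CSub.append_ofGround (τ : CSub Γ Δ) (σ : CGSub G Δ) (x : Var G A) :
    CSub.append τ σ (x.ofGround Γ) = σ x := by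
  induction x with
  | zero => rfl
  | succ x ih => exact ih fun _ x => σ (.succ x)

theorem CSub.append_append (τ : CSub Γ Δ) (σ : CGSub G Δ) {A : Ty Base Op} (x : Var Γ A) :
    CSub.append τ σ (Ren.append Γ _ x) = τ x := by
  induction G with
  | nil => rfl
  | cons B G ih => exact ih fun _ x => σ (.succ x)

theorem ETm.mk_translate (M : ETm S G A) {H : Hdl Γ S B 𝒯'} (hH : H.Wf) :
    Cl.mk (M.translate H) (M.translate_wf hH) =
      M.clHandle (CHdl.subst (.ofHdl H hH)
        fun _ x => .var (.succ (Ren.append Γ (G.map (GTy.toTy Op)) x)))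
        (fun _ x => .var (.succ (x.ofGround Γ))) (.var .zero) := by
  have := M.clHandle_mk (H := H.rename fun _ x => .succ (Ren.append Γ (G.map (GTy.toTy Op)) x))
    (hH.rename _) (σ := fun _ x => .var (.succ (x.ofGround Γ))) (fun _ _ => .var _)
    (k := .var .zero) (.var _)
  refine this.symm.trans ?_
  congr 1
  refine Eq.trans ?_ (CHdl.ofHdl_subst H hH (Sub.ren_wf _)).symm
  exact CHdl.ofHdl_congr (Hdl.rename_eq_subst _ _) _

theorem CHdl.resp_ofHdl {H : Hdl Γ 𝒯.sig B 𝒯'} (hH : H.Wf) :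
    (CHdl.ofHdl H hH).Resp ↔ H.Respects := by
  constructor
  · intro h e he
    refine Cl.mk_eq_mk.1 (?_ : Cl.mk _ (e.lhs.translate_wf hH) = Cl.mk _ (e.rhs.translate_wf hH))
    rw [ETm.mk_translate, ETm.mk_translate]
    exact h e he _ _ _
  · intro h e he Δ τ σ k
    have key := congrArg (fun m => Cl.subst m (CSub.cons (CSub.append τ σ) k))
      (Cl.mk_eq_mk (hM := e.lhs.translate_wf hH) (hN := e.rhs.translate_wf hH) |>.2 (h e he))
    have hτ : CSub.comp (fun _ x => .var (.succ (Ren.append Γ (e.ctx.map (GTy.toTy Op)) x)))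
        (CSub.cons (CSub.append τ σ) k) = τ := by
      funext A x
      simp only [CSub.comp_apply, Cl.subst_var, CSub.cons_succ, CSub.append_append]
    have hσ : CGSub.comp (fun _ x => .var (.succ (x.ofGround Γ)))
        (CSub.cons (CSub.append τ σ) k) = σ := by
      funext A x
      simp only [CGSub.comp_apply, Cl.subst_var, CSub.cons_succ, CSub.append_ofGround]
    rw [ETm.mk_translate, ETm.mk_translate] at key
    simpa only [ETm.clHandle_subst, CHdl.subst_subst, hτ, hσ, Cl.subst_var, CSub.cons_zero]
      using key

theorem CHdl.exists_ofHdl (h : CHdl Γ S B 𝒯') : ∃ H hH, h = ofHdl H hH :=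
  ⟨fun o => (h o).rep, fun o => (h o).rep_wf, funext fun o => (h o).mk_rep.symm⟩

theorem CHdl.respects_rep {h : CHdl Γ 𝒯.sig B 𝒯'} (hr : h.Resp) :
    Hdl.Respects (𝒯 := 𝒯) fun o => (h o).rep := by
  refine (CHdl.resp_ofHdl fun o => (h o).rep_wf).1 ?_
  rwa [show CHdl.ofHdl (fun o => (h o).rep) (fun o => (h o).rep_wf) = h from
    funext fun o => (h o).mk_rep]

end Ground

namespace Cl

variable {Γ Δ Ξ : Ctx Base Op} {s : Kind Base Op} {A B C : Ty Base Op} {𝒯 𝒯' : Theory Base Op}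

noncomputable def handle (m : Cl Γ (.cmp A 𝒯)) (h : CHdl Γ 𝒯.sig B 𝒯') (hr : h.Resp)
    (n : Cl (A :: Γ) (.cmp B 𝒯')) : Cl Γ (.cmp B 𝒯') :=
  mk (.handle m.rep (fun o => (h o).rep) n.rep)
    (.handle m.rep_wf (fun o => (h o).rep_wf) (CHdl.respects_rep hr) n.rep_wf)

theorem handle_mk {M : Cmp Γ A 𝒯} {H : Hdl Γ 𝒯.sig B 𝒯'} {N : Cmp (A :: Γ) B 𝒯'}
    (hM : M.Wf) (hH : H.Wf) (hr : (CHdl.ofHdl H hH).Resp) (hN : N.Wf) :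
    handle (mk M hM) (CHdl.ofHdl H hH) hr (mk N hN) =
      mk (.handle M H N) (.handle hM hH ((CHdl.resp_ofHdl hH).1 hr) hN) :=
  mk_eq_mk.2 (.handle (rep_mk hM) (fun o => rep_mk (hH o)) (CHdl.respects_rep hr)
    ((CHdl.resp_ofHdl hH).1 hr) (rep_mk hN))

@[simp] theorem subst_handle (m : Cl Γ (.cmp A 𝒯)) (h : CHdl Γ 𝒯.sig B 𝒯') (hr : h.Resp)
    (n : Cl (A :: Γ) (.cmp B 𝒯')) (σ : CSub Γ Δ) :
    (handle m h hr n).subst σ =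
      handle (m.subst σ) (h.subst σ) (hr.subst σ) (n.subst σ.up) := by
  obtain ⟨σ, hσ, rfl⟩ := exists_ofSub σ
  obtain ⟨M, hM, rfl⟩ := exists_mk m
  obtain ⟨N, hN, rfl⟩ := exists_mk n
  obtain ⟨H, hH, rfl⟩ := CHdl.exists_ofHdl h
  simp only [← ofSub_up, subst_mk, handle_mk, CHdl.ofHdl_subst]; rfl

@[simp] theorem app_lam (m : Cl (A :: Γ) (.cmp B 𝒯)) (v : Cl Γ (.val A)) :
    app (lam m) v = m.subst ((ids Γ).cons v) := by
  obtain ⟨M, hM, rfl⟩ := exists_mk m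
  obtain ⟨V, hV, rfl⟩ := exists_mk v
  rw [← ofSub_ids, ← ofSub_cons, subst_mk, lam_mk, app_mk]
  exact mk_eq_mk.2 (.fn_beta hM hV)

theorem lam_app (v : Cl Γ (.val (.fn A B 𝒯))) :
    lam (app (v.subst (shift Γ A)) (var .zero)) = v := by
  obtain ⟨V, hV, rfl⟩ := exists_mk v
  rw [subst_shift_mk, var, app_mk, lam_mk]
  exact mk_eq_mk.2 (.symm (.fn_eta hV))

@[simp] theorem proj_tuple {n : ℕ} {A : Fin n → Ty Base Op} (i : Fin n)
    (v : ∀ i, Cl Γ (.val (A i))) : proj i (tuple v) = v i := by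
  obtain ⟨V, hV, rfl⟩ := exists_mk_pi v
  rw [tuple_mk, proj_mk]
  exact mk_eq_mk.2 (.prod_beta i hV)

@[simp] theorem tuple_proj {n : ℕ} {A : Fin n → Ty Base Op} (v : Cl Γ (.val (.prod A))) :
    tuple (fun i => proj i v) = v := by
  obtain ⟨V, hV, rfl⟩ := exists_mk v
  simp only [proj_mk, tuple_mk]
  exact mk_eq_mk.2 (.symm (.prod_eta hV))

@[simp] theorem case_inj {n : ℕ} {A : Fin n → Ty Base Op} (i : Fin n) (v : Cl Γ (.val (A i)))
    (m : ∀ i, Cl (A i :: Γ) (.cmp B 𝒯)) :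
    case (inj i v) m = (m i).subst ((ids Γ).cons v) := by
  obtain ⟨M, hM, rfl⟩ := exists_mk_pi m
  obtain ⟨V, hV, rfl⟩ := exists_mk v
  rw [← ofSub_ids, ← ofSub_cons, subst_mk, inj_mk, case_mk]
  exact mk_eq_mk.2 (.sum_beta i hV hM)

theorem case_eta {n : ℕ} {A : Fin n → Ty Base Op} (v : Cl Γ (.val (.sum A)))
    (m : Cl (.sum A :: Γ) (.cmp B 𝒯)) :
    case v (fun i => m.subst ((shift Γ (A i)).cons (inj i (var .zero)))) =
      m.subst ((ids Γ).cons v) := by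
  obtain ⟨M, hM, rfl⟩ := exists_mk m
  obtain ⟨V, hV, rfl⟩ := exists_mk v
  simp only [← ofSub_ids, ← ofSub_cons, subst_mk, var, inj_mk, ← ofSub_shift, case_mk]
  exact mk_eq_mk.2 (.sum_eta hV hM)

@[simp] theorem letin_ret (v : Cl Γ (.val A)) (m : Cl (A :: Γ) (.cmp B 𝒯)) :
    letin (ret v) m = m.subst ((ids Γ).cons v) := by
  obtain ⟨M, hM, rfl⟩ := exists_mk m
  obtain ⟨V, hV, rfl⟩ := exists_mk v
  rw [← ofSub_ids, ← ofSub_cons, subst_mk, ret_mk, letin_mk]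
  exact mk_eq_mk.2 (.ret_let hV hM)

@[simp] theorem letin_ret_var (m : Cl Γ (.cmp A 𝒯)) : letin m (ret (var .zero)) = m := by
  obtain ⟨M, hM, rfl⟩ := exists_mk m
  rw [var, ret_mk, letin_mk]
  exact mk_eq_mk.2 (.let_ret hM)

theorem rename_up_succ_mk {L : Tm (A :: Γ) s} (hL : L.Wf) :
    (mk L hL).subst (up (shift Γ B)) =
      mk (L.rename (Ren.up fun _ x => .succ x)) (hL.rename _) := by
  rw [← ofSub_shift, ← ofSub_up, subst_mk]
  refine mk_congr ?_ _
  rw [Tm.rename_eq_subst, Sub.up_var]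

@[simp] theorem letin_letin (m : Cl Γ (.cmp A 𝒯)) (n : Cl (A :: Γ) (.cmp B 𝒯))
    (l : Cl (B :: Γ) (.cmp C 𝒯)) :
    letin (letin m n) l = letin m (letin n (l.subst (up (shift Γ A)))) := by
  obtain ⟨M, hM, rfl⟩ := exists_mk m
  obtain ⟨N, hN, rfl⟩ := exists_mk n
  obtain ⟨L, hL, rfl⟩ := exists_mk l
  rw [rename_up_succ_mk]
  simp only [letin_mk]
  exact mk_eq_mk.2 (.let_let hM hN hL)

@[simp] theorem handle_ret (v : Cl Γ (.val A)) (h : CHdl Γ 𝒯.sig B 𝒯') (hr : h.Resp)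
    (n : Cl (A :: Γ) (.cmp B 𝒯')) : handle (ret v) h hr n = n.subst ((ids Γ).cons v) := by
  obtain ⟨V, hV, rfl⟩ := exists_mk v
  obtain ⟨N, hN, rfl⟩ := exists_mk n
  obtain ⟨H, hH, rfl⟩ := CHdl.exists_ofHdl h
  rw [← ofSub_ids, ← ofSub_cons, subst_mk, ret_mk, handle_mk]
  exact mk_eq_mk.2 (.handle_ret hV hH ((CHdl.resp_ofHdl hH).1 hr) hN)

@[simp] theorem handle_letin (l : Cl Γ (.cmp A 𝒯)) (m : Cl (A :: Γ) (.cmp C 𝒯))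
    (h : CHdl Γ 𝒯.sig B 𝒯') (hr : h.Resp) (n : Cl (C :: Γ) (.cmp B 𝒯')) :
    handle (letin l m) h hr n =
      handle l h hr (handle m (h.subst (shift Γ A)) (hr.subst _) (n.subst (up (shift Γ A)))) := by
  obtain ⟨L, hL, rfl⟩ := exists_mk l
  obtain ⟨M, hM, rfl⟩ := exists_mk m
  obtain ⟨N, hN, rfl⟩ := exists_mk n
  obtain ⟨H, hH, rfl⟩ := CHdl.exists_ofHdl h
  have key := Tm.Equ.handle_let hL hM hH ((CHdl.resp_ofHdl hH).1 hr) hN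
  rw [rename_up_succ_mk]
  simp only [← ofSub_shift, CHdl.ofHdl_subst, handle_mk, letin_mk]
  refine mk_eq_mk.2 ?_
  rw [Hdl.rename_eq_subst] at key
  exact key

@[simp] theorem handle_op (o : 𝒯.sig.Idx) (v : Cl Γ (.val (𝒯.sig.argTy o)))
    (h : CHdl Γ 𝒯.sig B 𝒯') (hr : h.Resp) (n : Cl (𝒯.sig.resTy o :: Γ) (.cmp B 𝒯')) :
    handle (op o v) h hr n = (h o).subst (((ids Γ).cons v).cons (lam n)) := by
  obtain ⟨V, hV, rfl⟩ := exists_mk v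
  obtain ⟨N, hN, rfl⟩ := exists_mk n
  obtain ⟨H, hH, rfl⟩ := CHdl.exists_ofHdl h
  rw [lam_mk, ← ofSub_ids, ← ofSub_cons, ← ofSub_cons, op_mk, handle_mk]
  refine Eq.trans ?_ (subst_mk (hH o) _).symm
  exact mk_eq_mk.2 (.handle_op o hV hH ((CHdl.resp_ofHdl hH).1 hr) hN)

theorem clInst_ax {e : EqAx 𝒯.sig} (he : e ∈ 𝒯.ax) (σ : CGSub e.ctx Γ) :
    e.lhs.clInst σ = e.rhs.clInst σ := by
  have hσ : σ = .ofGSub (fun _ x => (σ x).rep) fun _ x => (σ x).rep_wf :=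
    funext fun _ => funext fun x => (σ x).mk_rep.symm
  rw [hσ, ETm.clInst_ofGSub, ETm.clInst_ofGSub]
  exact mk_eq_mk.2 (.inst_ax he fun _ x => (σ x).rep_wf)

end Cl

end Classes

/-! ## The syntactic category -/

section SyntacticCategory

variable {Base Op : Type u} {Γ Δ : Ctx Base Op} {X Y Z W : Ty Base Op} {𝒯 𝒯' : Theory Base Op}

open CSub

/-- The substitution of a value for the only variable of a context. -/
def CSub.sing (v : Cl Γ (.val X)) : CSub [X] Γ := CSub.cons (fun _ x => nomatch x) v

@[simp] theorem CSub.sing_zero (v : Cl Γ (.val X)) : CSub.sing v .zero = v := rfl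

theorem CSub.ext_sing {σ τ : CSub [X] Γ} (h : σ .zero = τ .zero) : σ = τ :=
  CSub.ext_cons h fun _ x => nomatch x

@[simp] theorem CSub.comp_sing (v : Cl Γ (.val X)) (σ : CSub Γ Δ) :
    comp (sing v) σ = sing (v.subst σ) :=
  ext_sing rfl

@[simp] theorem CSub.sing_var : sing (.var .zero : Cl [X] (.val X)) = ids [X] :=
  ext_sing rfl

/-- Objects are types, and morphisms are values in one variable up to derivable equality. -/
noncomputable instance : Category.{u} (Ty Base Op) where
  Hom X Y := Cl [X] (.val Y)
  id X := .var .zero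
  comp f g := Cl.subst g (.sing f)
  id_comp f := by simp
  comp_id f := by simp
  assoc f g h := by simp

/-- The application of a morphism to a value. -/
noncomputable def act (f : X ⟶ Y) (v : Cl Γ (.val X)) : Cl Γ (.val Y) :=
  Cl.subst (Γ := [X]) (s := .val Y) f (.sing v)

/-- The morphism given by a value in one variable. -/
def ofCl (f : Cl [X] (.val Y)) : X ⟶ Y := f

@[simp] theorem act_ofCl (f : Cl [X] (.val Y)) (v : Cl Γ (.val X)) :
    act (ofCl f) v = f.subst (sing v) := rfl

@[simp] theorem act_id (v : Cl Γ (.val X)) : act (𝟙 X) v = v := Cl.subst_var _ _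

@[simp] theorem act_comp (f : X ⟶ Y) (g : Y ⟶ Z) (v : Cl Γ (.val X)) :
    act (f ≫ g) v = act g (act f v) := by
  refine (Cl.subst_subst (Γ := [Y]) (s := .val Z) g (.sing f) (.sing v)).trans ?_
  rw [comp_sing]; rfl

@[simp] theorem subst_act (f : X ⟶ Y) (v : Cl Γ (.val X)) (σ : CSub Γ Δ) :
    (act f v).subst σ = act f (v.subst σ) := by
  refine (Cl.subst_subst (Γ := [X]) (s := .val Y) f (.sing v) σ).trans ?_
  rw [comp_sing]; rfl

theorem clHom_ext {f g : X ⟶ Y}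
    (h : ∀ {Γ : Ctx Base Op} (v : Cl Γ (.val X)), act f v = act g v) : f = g := by
  have := h (Γ := [X]) (.var .zero)
  simp only [act, sing_var, Cl.subst_ids] at this
  exact this

/-- The two factors of a binary product. -/
def pairFam (X Y : Ty Base Op) : Fin 2 → Ty Base Op
  | 0 => X
  | 1 => Y

/-- Binary products of types. -/
def pairTy (X Y : Ty Base Op) : Ty Base Op := .prod (pairFam X Y)

/-- The two components of a pair. -/
def pairEls (v : Cl Γ (.val X)) (w : Cl Γ (.val Y)) : ∀ i, Cl Γ (.val (pairFam X Y i))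
  | 0 => v
  | 1 => w

theorem eq_pairEls (v : ∀ i, Cl Γ (.val (pairFam X Y i))) : v = pairEls (v 0) (v 1) := by
  funext i; fin_cases i <;> rfl

namespace Cl

/-- Pairs in `pairTy X Y`. -/
noncomputable def mkPair (v : Cl Γ (.val X)) (w : Cl Γ (.val Y)) : Cl Γ (.val (pairTy X Y)) :=
  tuple (pairEls v w)

/-- The first component of an element of `pairTy X Y`. -/
noncomputable def left (p : Cl Γ (.val (pairTy X Y))) : Cl Γ (.val X) :=
  proj (A := pairFam X Y) 0 p

/-- The second component of an element of `pairTy X Y`. -/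
noncomputable def right (p : Cl Γ (.val (pairTy X Y))) : Cl Γ (.val Y) :=
  proj (A := pairFam X Y) 1 p

theorem left_mkPair (v : Cl Γ (.val X)) (w : Cl Γ (.val Y)) : left (mkPair v w) = v :=
  proj_tuple 0 (pairEls v w)

theorem right_mkPair (v : Cl Γ (.val X)) (w : Cl Γ (.val Y)) : right (mkPair v w) = w :=
  proj_tuple 1 (pairEls v w)

theorem mkPair_eta (p : Cl Γ (.val (pairTy X Y))) : mkPair (left p) (right p) = p :=
  (congrArg tuple (eq_pairEls fun i => proj i p).symm).trans (tuple_proj (A := pairFam X Y) p)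

theorem subst_left (p : Cl Γ (.val (pairTy X Y))) (σ : CSub Γ Δ) :
    (left p).subst σ = left (p.subst σ) :=
  subst_proj (A := pairFam X Y) 0 p σ

theorem subst_right (p : Cl Γ (.val (pairTy X Y))) (σ : CSub Γ Δ) :
    (right p).subst σ = right (p.subst σ) :=
  subst_proj (A := pairFam X Y) 1 p σ

theorem subst_mkPair (v : Cl Γ (.val X)) (w : Cl Γ (.val Y)) (σ : CSub Γ Δ) :
    (mkPair v w).subst σ = mkPair (v.subst σ) (w.subst σ) :=
  (subst_tuple (pairEls v w) σ).trans (congrArg tuple (eq_pairEls _))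

end Cl

/-- The terminal object. -/
noncomputable def unitCone : Limits.LimitCone (Functor.empty.{0} (Ty Base Op)) :=
  ⟨Limits.asEmptyCone (.prod (n := 0) (Fin.elim0 ·)),
    Limits.IsTerminal.ofUniqueHom (fun X => ofCl (.tuple (Fin.elim0 ·))) fun X f => by
      refine clHom_ext fun v => ?_
      rw [← Cl.tuple_proj (act f _), act_ofCl, Cl.subst_tuple]
      congr 1; funext i; exact i.elim0⟩

/-- The first projection from `pairTy X Y`. -/
noncomputable def leftHom (X Y : Ty Base Op) : pairTy X Y ⟶ X := ofCl (Cl.left (.var .zero))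

/-- The second projection from `pairTy X Y`. -/
noncomputable def rightHom (X Y : Ty Base Op) : pairTy X Y ⟶ Y := ofCl (Cl.right (.var .zero))

/-- The pairing of two morphisms into `pairTy X Y`. -/
noncomputable def pairHom (f : Z ⟶ X) (g : Z ⟶ Y) : Z ⟶ pairTy X Y :=
  ofCl (Cl.mkPair (act f (.var .zero)) (act g (.var .zero)))

theorem act_leftHom (p : Cl Γ (.val (pairTy X Y))) : act (leftHom X Y) p = p.left := by
  simp [leftHom, Cl.subst_left]

theorem act_rightHom (p : Cl Γ (.val (pairTy X Y))) : act (rightHom X Y) p = p.right := by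
  simp [rightHom, Cl.subst_right]

theorem act_pairHom (f : Z ⟶ X) (g : Z ⟶ Y) (v : Cl Γ (.val Z)) :
    act (pairHom f g) v = .mkPair (act f v) (act g v) := by
  simp [pairHom, Cl.subst_mkPair]

theorem pairHom_leftHom (f : Z ⟶ X) (g : Z ⟶ Y) : pairHom f g ≫ leftHom X Y = f :=
  clHom_ext fun v => by simp [act_pairHom, act_leftHom, Cl.left_mkPair]

theorem pairHom_rightHom (f : Z ⟶ X) (g : Z ⟶ Y) : pairHom f g ≫ rightHom X Y = g :=
  clHom_ext fun v => by simp [act_pairHom, act_rightHom, Cl.right_mkPair]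

theorem eq_pairHom (m : Z ⟶ pairTy X Y) : m = pairHom (m ≫ leftHom X Y) (m ≫ rightHom X Y) :=
  clHom_ext fun v => by simp [act_pairHom, act_leftHom, act_rightHom, Cl.mkPair_eta]

/-- The binary product cone. -/
noncomputable def pairCone (X Y : Ty Base Op) : Limits.LimitCone (Limits.pair X Y) :=
  ⟨Limits.BinaryFan.mk (leftHom X Y) (rightHom X Y),
  Limits.BinaryFan.isLimitMk (fun s => pairHom (X := X) (Y := Y) s.fst s.snd)
    (fun s => pairHom_leftHom (X := X) (Y := Y) s.fst s.snd)
    (fun s => pairHom_rightHom (X := X) (Y := Y) s.fst s.snd)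
    (fun s m h₀ h₁ => by
      rw [← h₀, ← h₁]
      exact eq_pairHom m)⟩

noncomputable instance : CartesianMonoidalCategory (Ty Base Op) :=
  .ofChosenFiniteProducts unitCone pairCone

namespace Cl

/-- The element of the unit type. -/
noncomputable def unit : Cl Γ (.val (𝟙_ (Ty Base Op))) := tuple (n := 0) (Fin.elim0 ·)

theorem eq_unit (v : Cl Γ (.val (𝟙_ (Ty Base Op)))) : v = unit :=
  (tuple_proj (n := 0) v).symm.trans (congrArg (tuple (n := 0)) (funext fun i => i.elim0))

@[simp] theorem subst_unit (σ : CSub Γ Δ) : (unit (Base := Base) (Op := Op)).subst σ = unit :=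
  eq_unit _

/-- The pair of two values. -/
noncomputable def pair (v : Cl Γ (.val X)) (w : Cl Γ (.val Y)) : Cl Γ (.val (X ⊗ Y)) :=
  mkPair v w

/-- The first projection. -/
noncomputable def fst (p : Cl Γ (.val (X ⊗ Y))) : Cl Γ (.val X) := left p

/-- The second projection. -/
noncomputable def snd (p : Cl Γ (.val (X ⊗ Y))) : Cl Γ (.val Y) := right p

@[simp] theorem fst_pair (v : Cl Γ (.val X)) (w : Cl Γ (.val Y)) : fst (pair v w) = v :=
  left_mkPair v w

@[simp] theorem snd_pair (v : Cl Γ (.val X)) (w : Cl Γ (.val Y)) : snd (pair v w) = w :=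
  right_mkPair v w

@[simp] theorem pair_fst_snd (p : Cl Γ (.val (X ⊗ Y))) : pair (fst p) (snd p) = p :=
  mkPair_eta p

@[simp] theorem subst_fst (p : Cl Γ (.val (X ⊗ Y))) (σ : CSub Γ Δ) :
    (fst p).subst σ = fst (p.subst σ) :=
  subst_left p σ

@[simp] theorem subst_snd (p : Cl Γ (.val (X ⊗ Y))) (σ : CSub Γ Δ) :
    (snd p).subst σ = snd (p.subst σ) :=
  subst_right p σ

@[simp] theorem subst_pair (v : Cl Γ (.val X)) (w : Cl Γ (.val Y)) (σ : CSub Γ Δ) :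
    (pair v w).subst σ = pair (v.subst σ) (w.subst σ) :=
  subst_mkPair v w σ

end Cl

@[simp] theorem act_fst (p : Cl Γ (.val (X ⊗ Y))) : act (fst X Y) p = p.fst :=
  act_leftHom p

@[simp] theorem act_snd (p : Cl Γ (.val (X ⊗ Y))) : act (snd X Y) p = p.snd :=
  act_rightHom p

theorem Cl.pair_ext {p q : Cl Γ (.val (X ⊗ Y))} (h₁ : p.fst = q.fst) (h₂ : p.snd = q.snd) :
    p = q := by
  rw [← p.pair_fst_snd, h₁, h₂, q.pair_fst_snd]

@[simp] theorem act_lift (f : Z ⟶ X) (g : Z ⟶ Y) (v : Cl Γ (.val Z)) :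
    act (lift f g) v = .pair (act f v) (act g v) := by
  refine Cl.pair_ext ?_ ?_
  · rw [← act_fst, ← act_comp, lift_fst, Cl.fst_pair]
  · rw [← act_snd, ← act_comp, lift_snd, Cl.snd_pair]

@[simp] theorem act_whiskerLeft (Z : Ty Base Op) (f : X ⟶ Y) (p : Cl Γ (.val (Z ⊗ X))) :
    act (Z ◁ f) p = .pair p.fst (act f p.snd) := by
  refine Cl.pair_ext ?_ ?_
  · rw [← act_fst, ← act_comp, whiskerLeft_fst, Cl.fst_pair, act_fst]
  · rw [← act_snd, ← act_comp, whiskerLeft_snd, Cl.snd_pair, act_comp, act_snd]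

@[simp] theorem act_whiskerRight (f : X ⟶ Y) (Z : Ty Base Op) (p : Cl Γ (.val (X ⊗ Z))) :
    act (f ▷ Z) p = .pair (act f p.fst) p.snd := by
  refine Cl.pair_ext ?_ ?_
  · rw [← act_fst, ← act_comp, whiskerRight_fst, Cl.fst_pair, act_comp, act_fst]
  · rw [← act_snd, ← act_comp, whiskerRight_snd, Cl.snd_pair, act_snd]

@[simp] theorem act_tensorHom (f : X ⟶ Y) (g : Z ⟶ W) (p : Cl Γ (.val (X ⊗ Z))) :
    act (f ⊗ₘ g) p = .pair (act f p.fst) (act g p.snd) := by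
  refine Cl.pair_ext ?_ ?_
  · rw [← act_fst, ← act_comp, tensorHom_fst, Cl.fst_pair, act_comp, act_fst]
  · rw [← act_snd, ← act_comp, tensorHom_snd, Cl.snd_pair, act_comp, act_snd]

@[simp] theorem act_leftUnitor (p : Cl Γ (.val (𝟙_ (Ty Base Op) ⊗ X))) :
    act (λ_ X).hom p = p.snd := by
  rw [leftUnitor_hom, act_snd]

@[simp] theorem act_associator (p : Cl Γ (.val ((X ⊗ Y) ⊗ Z))) :
    act (α_ X Y Z).hom p = .pair p.fst.fst (.pair p.fst.snd p.snd) := by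
  refine Cl.pair_ext ?_ (Cl.pair_ext ?_ ?_)
  · rw [← act_fst, ← act_comp, associator_hom_fst]; simp
  · rw [← act_snd, ← act_fst, ← act_comp, ← act_comp, associator_hom_snd_fst]; simp
  · rw [← act_snd, ← act_snd, ← act_comp, ← act_comp, associator_hom_snd_snd]; simp

@[simp] theorem act_associator_inv (p : Cl Γ (.val (X ⊗ (Y ⊗ Z)))) :
    act (α_ X Y Z).inv p = .pair (.pair p.fst p.snd.fst) p.snd.snd := by
  have h := act_associator (X := X) (Y := Y) (Z := Z) (.pair (.pair p.fst p.snd.fst) p.snd.snd)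
  simp only [Cl.fst_pair, Cl.snd_pair, Cl.pair_fst_snd] at h
  rw [← h, ← act_comp, Iso.hom_inv_id, act_id, h]

end SyntacticCategory

/-! ## The type structure of the syntactic category -/

section SyntacticTypes

variable {Base Op : Type u} {Γ Δ : Ctx Base Op} {X Y Z W : Ty Base Op} {𝒯 𝒯' : Theory Base Op}

open CSub

/-- The type of thunks of computations. -/
noncomputable def thunkTy (𝒯 : Theory Base Op) (X : Ty Base Op) : Ty Base Op := .fn (𝟙_ (Ty Base Op)) X 𝒯

namespace Cl

/-- The thunk of a computation. -/
noncomputable def thunk (m : Cl Γ (.cmp X 𝒯)) : Cl Γ (.val (thunkTy 𝒯 X)) :=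
  lam (m.subst (shift Γ _))

/-- The computation given by a thunk. -/
noncomputable def run (v : Cl Γ (.val (thunkTy 𝒯 X))) : Cl Γ (.cmp X 𝒯) := app v unit

@[simp] theorem run_thunk (m : Cl Γ (.cmp X 𝒯)) : run (thunk m) = m := by
  refine (app_lam _ _).trans ?_
  simp

@[simp] theorem thunk_run (v : Cl Γ (.val (thunkTy 𝒯 X))) : thunk (run v) = v := by
  refine Eq.trans ?_ (lam_app v)
  refine congrArg lam ((subst_app _ _ _).trans ?_)
  rw [eq_unit (var .zero), subst_unit]

theorem run_injective {v w : Cl Γ (.val (thunkTy 𝒯 X))} (h : run v = run w) : v = w := by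
  rw [← thunk_run v, h, thunk_run]

theorem thunk_injective {m n : Cl Γ (.cmp X 𝒯)} (h : thunk m = thunk n) : m = n := by
  rw [← run_thunk m, h, run_thunk]

@[simp] theorem subst_run (v : Cl Γ (.val (thunkTy 𝒯 X))) (σ : CSub Γ Δ) :
    (run v).subst σ = run (v.subst σ) :=
  (subst_app _ _ _).trans (congrArg _ (subst_unit σ))

@[simp] theorem subst_thunk (m : Cl Γ (.cmp X 𝒯)) (σ : CSub Γ Δ) :
    (thunk m).subst σ = thunk (m.subst σ) :=
  (subst_lam _ _).trans (congrArg lam (by simp))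

end Cl

/-- The action of the thunk monad on morphisms. -/
noncomputable def thunkMap (𝒯 : Theory Base Op) (f : X ⟶ Y) : thunkTy 𝒯 X ⟶ thunkTy 𝒯 Y :=
  ofCl (.thunk (.letin (.run (.var .zero)) (.ret (act f (.var .zero)))))

@[simp] theorem act_thunkMap (f : X ⟶ Y) (v : Cl Γ (.val (thunkTy 𝒯 X))) :
    act (thunkMap 𝒯 f) v = .thunk (.letin v.run (.ret (act f (.var .zero)))) := by
  simp [thunkMap]

/-- The unit of the thunk monad. -/
noncomputable def thunkUnit (𝒯 : Theory Base Op) (X : Ty Base Op) : X ⟶ thunkTy 𝒯 X :=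
  ofCl (.thunk (.ret (.var .zero)))

@[simp] theorem act_thunkUnit (v : Cl Γ (.val X)) :
    act (thunkUnit 𝒯 X) v = .thunk (.ret v) := by
  simp [thunkUnit]

/-- The multiplication of the thunk monad. -/
noncomputable def thunkMul (𝒯 : Theory Base Op) (X : Ty Base Op) :
    thunkTy 𝒯 (thunkTy 𝒯 X) ⟶ thunkTy 𝒯 X :=
  ofCl (.thunk (.letin (.run (.var .zero)) (.run (.var .zero))))

@[simp] theorem act_thunkMul (v : Cl Γ (.val (thunkTy 𝒯 (thunkTy 𝒯 X)))) :
    act (thunkMul 𝒯 X) v = .thunk (.letin v.run (.run (.var .zero))) := by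
  simp [thunkMul]

/-- The strength of the thunk monad. -/
noncomputable def thunkStr (𝒯 : Theory Base Op) (X Y : Ty Base Op) :
    X ⊗ thunkTy 𝒯 Y ⟶ thunkTy 𝒯 (X ⊗ Y) :=
  ofCl (.thunk (.letin (.run (.snd (.var .zero)))
    (.ret (.pair (.fst (.var (.succ .zero))) (.var .zero)))))

@[simp] theorem act_thunkStr (p : Cl Γ (.val (X ⊗ thunkTy 𝒯 Y))) :
    act (thunkStr 𝒯 X Y) p =
      .thunk (.letin p.snd.run (.ret (.pair (p.fst.subst (shift Γ Y)) (.var .zero)))) := by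
  simp [thunkStr]

/-- The thunk monad. -/
@[reducible] noncomputable def thunkMonad (𝒯 : Theory Base Op) : StrongMonad (Ty Base Op) where
  obj X := thunkTy 𝒯 X
  map f := thunkMap 𝒯 f
  map_id X := clHom_ext fun v => by simp
  map_comp f g := clHom_ext fun v => by simp
  η :=
    { app X := thunkUnit 𝒯 X
      naturality X Y f := clHom_ext fun v => by simp }
  μ :=
    { app X := thunkMul 𝒯 X
      naturality X Y f := clHom_ext fun v => by simp }
  assoc X := clHom_ext fun v => by simp
  left_unit X := clHom_ext fun v => by simp
  right_unit X := clHom_ext fun v => by simp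
  str X Y := thunkStr 𝒯 X Y
  str_natural f g := clHom_ext fun v => by simp
  str_leftUnitor Y := clHom_ext fun v => by simp
  str_associator X Y Z := clHom_ext fun v => by simp
  str_unit X Y := clHom_ext fun v => by simp
  str_mul X Y := clHom_ext fun v => by simp

/-- Currying for function types. -/
noncomputable def curryHom (f : X ⊗ Y ⟶ thunkTy 𝒯 Z) : X ⟶ .fn Y Z 𝒯 :=
  ofCl (.lam (.run (act f (.pair (.var (.succ .zero)) (.var .zero)))))

@[simp] theorem act_curryHom (f : X ⊗ Y ⟶ thunkTy 𝒯 Z) (v : Cl Γ (.val X)) :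
    act (curryHom f) v = .lam (.run (act f (.pair (v.subst (shift Γ Y)) (.var .zero)))) := by
  simp [curryHom]

/-- Uncurrying for function types. -/
noncomputable def uncurryHom (g : X ⟶ .fn Y Z 𝒯) : X ⊗ Y ⟶ thunkTy 𝒯 Z :=
  ofCl (.thunk (.app (act g (.fst (.var .zero))) (.snd (.var .zero))))

@[simp] theorem act_uncurryHom (g : X ⟶ .fn Y Z 𝒯) (p : Cl Γ (.val (X ⊗ Y))) :
    act (uncurryHom g) p = .thunk (.app (act g p.fst) p.snd) := by
  simp [uncurryHom]

/-- Case distinction. -/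
noncomputable def caseHom {n : ℕ} {X : Fin n → Ty Base Op} (f : ∀ i, Z ⊗ X i ⟶ thunkTy 𝒯 Y) :
    Z ⊗ .sum X ⟶ thunkTy 𝒯 Y :=
  ofCl (.thunk (.case (.snd (.var .zero))
    fun i => .run (act (f i) (.pair (.fst (.var (.succ .zero))) (.var .zero)))))

@[simp] theorem act_caseHom {n : ℕ} {X : Fin n → Ty Base Op} (f : ∀ i, Z ⊗ X i ⟶ thunkTy 𝒯 Y)
    (p : Cl Γ (.val (Z ⊗ .sum X))) :
    act (caseHom f) p = .thunk (.case p.snd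
      fun i => .run (act (f i) (.pair (p.fst.subst (shift Γ _)) (.var .zero)))) := by
  simp [caseHom]

/-- Projections from finite products. -/
noncomputable def projHom {n : ℕ} (X : Fin n → Ty Base Op) (i : Fin n) : .prod X ⟶ X i :=
  ofCl (.proj i (.var .zero))

@[simp] theorem act_projHom {n : ℕ} (X : Fin n → Ty Base Op) (i : Fin n)
    (v : Cl Γ (.val (.prod X))) : act (projHom X i) v = .proj i v := by
  simp [projHom]

/-- Tupling into finite products. -/
noncomputable def tupleHom {n : ℕ} {X : Fin n → Ty Base Op} (f : ∀ i, Z ⟶ X i) : Z ⟶ .prod X :=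
  ofCl (.tuple fun i => act (f i) (.var .zero))

@[simp] theorem act_tupleHom {n : ℕ} {X : Fin n → Ty Base Op} (f : ∀ i, Z ⟶ X i)
    (v : Cl Γ (.val Z)) : act (tupleHom f) v = .tuple fun i => act (f i) v := by
  simp [tupleHom]

/-- Injections into finite sums. -/
noncomputable def injHom {n : ℕ} (X : Fin n → Ty Base Op) (i : Fin n) : X i ⟶ .sum X :=
  ofCl (.inj i (.var .zero))

@[simp] theorem act_injHom {n : ℕ} (X : Fin n → Ty Base Op) (i : Fin n)
    (v : Cl Γ (.val (X i))) : act (injHom X i) v = .inj i v := by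
  simp [injHom]

theorem caseHom_ext {n : ℕ} {X : Fin n → Ty Base Op} {f g : Z ⊗ .sum X ⟶ thunkTy 𝒯 Y}
    (h : ∀ i, Z ◁ injHom X i ≫ f = Z ◁ injHom X i ≫ g) : f = g := by
  have key : ∀ (f : Z ⊗ .sum X ⟶ thunkTy 𝒯 Y) {Γ : Ctx Base Op} (p : Cl Γ (.val (Z ⊗ .sum X))),
      act f p = act (caseHom fun i => Z ◁ injHom X i ≫ f) p := by
    intro f Γ p
    have := Cl.case_eta p.snd (.run (act f (.pair (p.fst.subst (shift Γ _)) (.var .zero))))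
    simp at this
    simp [this]
  refine clHom_ext fun p => ?_
  rw [key f, key g]
  simp only [h]

theorem uncurryHom_curryHom (f : X ⊗ Y ⟶ thunkTy 𝒯 Z) : uncurryHom (curryHom f) = f :=
  clHom_ext fun v => by simp

theorem curryHom_uncurryHom (g : X ⟶ .fn Y Z 𝒯) : curryHom (uncurryHom g) = g :=
  clHom_ext fun v => by
    rw [act_curryHom, act_uncurryHom, Cl.run_thunk, Cl.fst_pair, Cl.snd_pair, ← subst_act,
      Cl.lam_app]

theorem curryHom_comp (g : W ⟶ X) (f : X ⊗ Y ⟶ thunkTy 𝒯 Z) :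
    curryHom (g ▷ Y ≫ f) = g ≫ curryHom f :=
  clHom_ext fun v => by simp

theorem injHom_caseHom {n : ℕ} {X : Fin n → Ty Base Op} (f : ∀ i, Z ⊗ X i ⟶ thunkTy 𝒯 Y)
    (i : Fin n) : Z ◁ injHom X i ≫ caseHom f = f i :=
  clHom_ext fun v => by simp

/-- The interpretation of types by themselves. -/
@[reducible] noncomputable def synTypes (Base Op : Type u) : TypeModel Base Op (Ty Base Op) where
  pr X := .prod X
  prProj X i := projHom X i
  prLift f := tupleHom f
  prLift_proj f i := clHom_ext fun v => by simp
  pr_ext {n X Z f g} h := clHom_ext fun v => by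
    rw [← Cl.tuple_proj (act f v), ← Cl.tuple_proj (act g v)]
    simp only [← act_projHom, ← act_comp, h]
  base b := .base b
  T 𝒯 := thunkMonad 𝒯
  kexp 𝒯 Y Z := .fn Y Z 𝒯
  curry {𝒯 X Y Z} :=
    { toFun f := curryHom (𝒯 := 𝒯) (Z := Z) f
      invFun g := uncurryHom g
      left_inv f := uncurryHom_curryHom f
      right_inv g := curryHom_uncurryHom g }
  curry_natural g f := curryHom_comp g f
  sm X := .sum X
  smInj X i := injHom X i
  smCase {𝒯 n X Z Y} f := caseHom (𝒯 := 𝒯) (Y := Y) f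
  smInj_case {𝒯 n X Z Y} f i := injHom_caseHom (𝒯 := 𝒯) (Y := Y) f i
  sm_ext {𝒯 n X Z Y f g} h := caseHom_ext (𝒯 := 𝒯) (Y := Y) h

end SyntacticTypes

/-! ## Transport along equations between types -/

section Transport

variable {Base Op : Type u} {Γ Δ : Ctx Base Op} {X Y Z W : Ty Base Op} {𝒯 𝒯' : Theory Base Op}

open CSub

namespace Cl

/-- Transport of values along an equation between types. -/
def cast (h : X = Y) (v : Cl Γ (.val X)) : Cl Γ (.val Y) := h ▸ v

/-- Transport of computations along an equation between types. -/
def ccast (h : X = Y) (m : Cl Γ (.cmp X 𝒯)) : Cl Γ (.cmp Y 𝒯) := h ▸ m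

@[simp] theorem cast_rfl (h : X = X) (v : Cl Γ (.val X)) : cast h v = v := rfl

@[simp] theorem ccast_rfl (h : X = X) (m : Cl Γ (.cmp X 𝒯)) : ccast h m = m := rfl

@[simp] theorem cast_cast (h : X = Y) (h' : Y = Z) (v : Cl Γ (.val X)) :
    cast h' (cast h v) = cast (h.trans h') v := by
  subst h h'; rfl

@[simp] theorem ccast_ccast (h : X = Y) (h' : Y = Z) (m : Cl Γ (.cmp X 𝒯)) :
    ccast h' (ccast h m) = ccast (h.trans h') m := by
  subst h h'; rfl

@[simp] theorem subst_cast (h : X = Y) (v : Cl Γ (.val X)) (σ : CSub Γ Δ) :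
    (cast h v).subst σ = cast h (v.subst σ) := by
  subst h; rfl

@[simp] theorem subst_ccast (h : X = Y) (m : Cl Γ (.cmp X 𝒯)) (σ : CSub Γ Δ) :
    (ccast h m).subst σ = ccast h (m.subst σ) := by
  subst h; rfl

theorem cast_lam {X' Y' : Ty Base Op} (hX : X = X') (hY : Y = Y')
    (h : Ty.fn X Y 𝒯 = Ty.fn X' Y' 𝒯) (m : Cl (X :: Γ) (.cmp Y 𝒯)) :
    cast h (lam m) =
      lam (ccast hY (m.subst (cons (shift Γ X') (cast hX.symm (var .zero))))) := by
  subst hX hY; simp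

theorem app_cast {X' Y' : Ty Base Op} (hX : X = X') (hY : Y = Y')
    (h : Ty.fn X Y 𝒯 = Ty.fn X' Y' 𝒯) (v : Cl Γ (.val (.fn X Y 𝒯))) (w : Cl Γ (.val X')) :
    app (cast h v) w = ccast hY (app v (cast hX.symm w)) := by
  subst hX hY; simp

theorem tuple_cast {n : ℕ} {A B : Fin n → Ty Base Op} (hA : ∀ i, A i = B i)
    (h : Ty.prod A = Ty.prod B) (v : ∀ i, Cl Γ (.val (A i))) :
    tuple (fun i => cast (hA i) (v i)) = cast h (tuple v) := by
  obtain rfl : A = B := funext hA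
  simp

theorem proj_cast {n : ℕ} {A B : Fin n → Ty Base Op} (hA : ∀ i, A i = B i)
    (h : Ty.prod A = Ty.prod B) (i : Fin n) (v : Cl Γ (.val (.prod A))) :
    proj i (cast h v) = cast (hA i) (proj i v) := by
  obtain rfl : A = B := funext hA
  simp

theorem inj_cast {n : ℕ} {A B : Fin n → Ty Base Op} (hA : ∀ i, A i = B i)
    (h : Ty.sum A = Ty.sum B) (i : Fin n) (v : Cl Γ (.val (A i))) :
    inj i (cast (hA i) v) = cast h (inj i v) := by
  obtain rfl : A = B := funext hA
  simp

theorem case_cast {n : ℕ} {A B : Fin n → Ty Base Op} (hA : ∀ i, A i = B i)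
    (h : Ty.sum A = Ty.sum B) (v : Cl Γ (.val (.sum A))) (m : ∀ i, Cl (B i :: Γ) (.cmp Y 𝒯)) :
    case (cast h v) m =
      case v fun i => (m i).subst (cons (shift Γ (A i)) (cast (hA i) (var .zero))) := by
  obtain rfl : A = B := funext hA
  simp

theorem ccast_case {n : ℕ} {A : Fin n → Ty Base Op} (h : X = Y) (v : Cl Γ (.val (.sum A)))
    (m : ∀ i, Cl (A i :: Γ) (.cmp X 𝒯)) : ccast h (case v m) = case v fun i => ccast h (m i) := by
  subst h; simp

theorem ret_cast (h : X = Y) (v : Cl Γ (.val X)) : ret (𝒯 := 𝒯) (cast h v) = ccast h (ret v) := by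
  subst h; simp

theorem letin_ccast (h : X = Y) (m : Cl Γ (.cmp X 𝒯)) (n : Cl (Y :: Γ) (.cmp Z 𝒯)) :
    letin (ccast h m) n = letin m (n.subst (cons (shift Γ X) (cast h (var .zero)))) := by
  subst h; simp

theorem ccast_letin (h : X = Y) (m : Cl Γ (.cmp Z 𝒯)) (n : Cl (Z :: Γ) (.cmp X 𝒯)) :
    ccast h (letin m n) = letin m (ccast h n) := by
  subst h; simp

theorem handle_ccast (h : X = Y) (m : Cl Γ (.cmp X 𝒯)) (H : CHdl Γ 𝒯.sig Z 𝒯') (hr : H.Resp)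
    (n : Cl (Y :: Γ) (.cmp Z 𝒯')) :
    handle (ccast h m) H hr n =
      handle m H hr (n.subst (cons (shift Γ X) (cast h (var .zero)))) := by
  subst h; simp

end Cl

/-- Transport of handlers along an equation between types. -/
def CHdl.cast {S : Sig Base Op} (h : X = Y) (H : CHdl Γ S X 𝒯') : CHdl Γ S Y 𝒯' := h ▸ H

theorem CHdl.cast_apply {S : Sig Base Op} (h : X = Y) (H : CHdl Γ S X 𝒯') (o : S.Idx) :
    H.cast h o = .ccast h ((H o).subst (cons (cons (comp (shift Γ _) (shift _ _))
      (.var (.succ .zero))) (.cast (by rw [h]) (.var .zero)))) := by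
  subst h; simp [CHdl.cast]

theorem CHdl.Resp.cast {H : CHdl Γ 𝒯.sig X 𝒯'} (hr : H.Resp) (h : X = Y) : (H.cast h).Resp := by
  subst h; exact hr

theorem Cl.ccast_handle (h : X = Y) (m : Cl Γ (.cmp Z 𝒯)) (H : CHdl Γ 𝒯.sig X 𝒯') (hr : H.Resp)
    (n : Cl (Z :: Γ) (.cmp X 𝒯')) :
    ccast h (handle m H hr n) = handle m (H.cast h) (hr.cast h) (ccast h n) := by
  subst h; rfl

end Transport

/-! ## Effect theory terms in the syntactic category -/

section Syntactic

variable {Base Op : Type u} {Γ Δ : Ctx Base Op} {X Y Z W : Ty Base Op} {𝒯 𝒯' : Theory Base Op}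

open CSub

local notation "𝓢" => synTypes Base Op

theorem synTypes_ty (A : Ty Base Op) : (𝓢).ty A = A := by
  induction A with
  | base b => rfl
  | fn A B 𝒯 ihA ihB => exact congrArg₂ (Ty.fn · · 𝒯) ihA ihB
  | prod A ih => exact congrArg Ty.prod (funext ih)
  | sum A ih => exact congrArg Ty.sum (funext ih)

theorem synTypes_gty (A : GTy Base) : (𝓢).gty A = A.toTy Op := synTypes_ty _

@[simp] theorem act_synEv (p : Cl Γ (.val (.fn Y Z 𝒯 ⊗ Y))) :
    act ((𝓢).ev 𝒯 Y Z) p = .thunk (.app p.fst p.snd) := by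
  refine (act_uncurryHom (𝟙 (Ty.fn Y Z 𝒯)) p).trans ?_
  rw [act_id]

theorem run_act_synBind (f : Z ⟶ thunkTy 𝒯 X) (g : Z ⊗ X ⟶ thunkTy 𝒯 Y) (v : Cl Γ (.val Z)) :
    Cl.run (act ((𝓢).bind (𝒯 := 𝒯) f g) v) =
      .letin (.run (act f v)) (.run (act g (.pair (v.subst (shift Γ X)) (.var .zero)))) := by
  have : act ((𝓢).bind (𝒯 := 𝒯) f g) v =
      act (lift (𝟙 Z) f ≫ thunkStr 𝒯 Z X ≫ thunkMap 𝒯 g ≫ thunkMul 𝒯 Y) v := rfl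
  rw [this]
  simp

theorem run_act_synCase {n : ℕ} {X : Fin n → Ty Base Op} (f : Z ⟶ .sum X)
    (g : ∀ i, Z ⊗ X i ⟶ thunkTy 𝒯 Y) (v : Cl Γ (.val Z)) :
    Cl.run (act (lift (𝟙 Z) f ≫ (𝓢).smCase (𝒯 := 𝒯) g) v) =
      .case (act f v) fun i => .run (act (g i) (.pair (v.subst (shift Γ (X i))) (.var .zero))) := by
  have : act (lift (𝟙 Z) f ≫ (𝓢).smCase (𝒯 := 𝒯) g) v = act (lift (𝟙 Z) f ≫ caseHom g) v := rfl
  rw [this]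
  simp

/-- The components of an element of the interpretation of a ground context. -/
noncomputable def components {G : List (GTy Base)} (d : Cl Γ (.val ((𝓢).gctx G))) : CGSub G Γ :=
  fun A x => .cast (synTypes_gty A) (act (varHom (𝓢).gty x) d)

theorem components_comp {G : List (GTy Base)} (d : Cl Γ (.val ((𝓢).gctx G))) (σ : CSub Γ Δ) :
    (components d).comp σ = components (d.subst σ) := by
  funext A x
  simp [components, CGSub.comp_apply]

theorem components_pair {G : List (GTy Base)} {A : GTy Base} (d : Cl Γ (.val ((𝓢).gctx G)))
    (v : Cl Γ (.val ((𝓢).gty A))) :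
    components (G := A :: G) (.pair d v) = (components d).cons (.cast (synTypes_gty A) v) := by
  refine CGSub.ext_cons ?_ fun B x => ?_
  · refine congrArg (Cl.cast _) ((act_snd _).trans ?_)
    exact Cl.snd_pair _ _
  · refine congrArg (Cl.cast _) ((act_comp _ _ _).trans (congrArg _ ((act_fst _).trans ?_)))
    exact Cl.fst_pair _ _

theorem exists_components {G : List (GTy Base)} (σ : CGSub G Γ) :
    ∃ d : Cl Γ (.val ((𝓢).gctx G)), components d = σ := by
  induction G with
  | nil => exact ⟨.unit, funext fun _ => funext fun x => nomatch x⟩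
  | cons A G ih =>
    obtain ⟨d, hd⟩ := ih fun _ x => σ (.succ x)
    refine ⟨.pair d (.cast (synTypes_gty A).symm (σ .zero)), ?_⟩
    rw [components_pair, hd]
    exact CGSub.ext_cons (by simp [CGSub.cons]) fun _ _ => rfl

theorem act_gtm {G : List (GTy Base)} {A : GTy Base} (V : GTm G A)
    (d : Cl Γ (.val ((𝓢).gctx G))) :
    act ((𝓢).gtm V) d = .cast (synTypes_gty A).symm (V.clInst (components d)) := by
  induction V with
  | var x => simp [TypeModel.gtm, GTm.clInst, components]
  | @tuple n A V ih =>
    refine (act_tupleHom _ _).trans ((congrArg Cl.tuple (funext ih)).trans ?_)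
    exact Cl.tuple_cast (fun i => (synTypes_gty (A i)).symm) _ _
  | @proj n A i V ih =>
    refine (act_comp _ _ _).trans ((act_projHom _ _ _).trans
      ((congrArg (Cl.proj (A := fun i => (𝓢).gty (A i)) i) ih).trans ?_))
    exact Cl.proj_cast (fun i => (synTypes_gty (A i)).symm) _ _ _
  | @inj n A i V ih =>
    refine (act_comp _ _ _).trans ((act_injHom _ _ _).trans
      ((congrArg (Cl.inj (A := fun i => (𝓢).gty (A i)) i) ih).trans ?_))
    exact Cl.inj_cast (fun i => (synTypes_gty (A i)).symm) _ _ _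

theorem ETm.clInst_subst {G : List (GTy Base)} {A : GTy Base} (M : ETm 𝒯.sig G A)
    (σ : CGSub G Γ) (τ : CSub Γ Δ) : (M.clInst σ).subst τ = M.clInst (σ.comp τ) := by
  induction M generalizing Γ Δ with
  | ret V => simp [ETm.clInst]
  | letop o V M ih => simp [ETm.clInst, ih]
  | case V M ih =>
    refine (Cl.subst_case (A := fun i => GTy.toTy Op _) _ _ _).trans ?_
    refine congr (congrArg (Cl.case (A := fun i => GTy.toTy Op _)) (V.clInst_subst σ τ))
      (funext fun i => ?_)
    simp [ih]

/-- The generic effects of the syntactic category. -/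
noncomputable def synOp (𝒯 : Theory Base Op) (o : 𝒯.sig.Idx) :
    (𝓢).gty (𝒯.sig.arg o) ⟶ thunkTy 𝒯 ((𝓢).gty (𝒯.sig.res o)) :=
  ofCl (.thunk (.ccast (synTypes_gty _).symm (.op o (.cast (synTypes_gty _) (.var .zero)))))

@[simp] theorem act_synOp (o : 𝒯.sig.Idx) (v : Cl Γ (.val ((𝓢).gty (𝒯.sig.arg o)))) :
    act (synOp 𝒯 o) v =
      .thunk (.ccast (synTypes_gty _).symm (.op o (.cast (synTypes_gty _) v))) := by
  simp [synOp]

theorem run_act_etm {G : List (GTy Base)} {A : GTy Base} (M : ETm 𝒯.sig G A)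
    (d : Cl Γ (.val ((𝓢).gctx G))) :
    Cl.run (act ((𝓢).etm (𝒯 := 𝒯) (synOp 𝒯) M) d) =
      .ccast (synTypes_gty A).symm (M.clInst (components d)) := by
  induction M generalizing Γ with
  | ret V =>
    refine (congrArg Cl.run ((act_comp _ _ _).trans (act_thunkUnit _))).trans ?_
    rw [act_gtm, Cl.run_thunk, Cl.ret_cast]; rfl
  | letop o V M ih =>
    have h : Cl.run (act ((𝓢).gtm V ≫ synOp 𝒯 o) d) =
        .ccast (synTypes_gty _).symm (.op o (V.clInst (components d))) := by
      simp [act_gtm]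
    refine (run_act_synBind _ _ _).trans ((congrArg₂ Cl.letin h (ih _)).trans ?_)
    rw [Cl.letin_ccast, components_pair]
    simp [ETm.clInst, Cl.ccast_letin, ETm.clInst_subst, components_comp]
  | @case G A n B V M ih =>
    refine (run_act_synCase _ _ _).trans
      ((congr (congrArg Cl.case (act_gtm V d)) (funext fun i => ih i _)).trans ?_)
    refine (Cl.case_cast (fun i => (synTypes_gty (B i)).symm) _ _ _).trans ?_
    refine Eq.trans ?_ (Cl.ccast_case _ _ _).symm
    refine congrArg _ (funext fun i => ?_)
    simp [ETm.clInst_subst, components_comp, components_pair]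

end Syntactic

/-! ## The syntactic model -/

section SyntacticModel

variable {Base Op : Type u} {Γ Δ : Ctx Base Op} {X Y Z W : Ty Base Op} {𝒯 𝒯' : Theory Base Op}
  {S : Sig Base Op}

open CSub

local notation "𝓢" => synTypes Base Op

theorem fn_gty (A : GTy Base) (X : Ty Base Op) (𝒯 : Theory Base Op) :
    Ty.fn ((𝓢).gty A) X 𝒯 = Ty.fn (A.toTy Op) X 𝒯 := by
  rw [synTypes_gty]

/-- The projections from the object of algebra structures. -/
noncomputable def algProj (S : Sig Base Op) (𝒯' : Theory Base Op) (X : Ty Base Op) (o : S.Idx) :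
    (𝓢).hb S 𝒯' X ⟶
      .fn ((𝓢).gty (S.arg o) ⊗ .fn ((𝓢).gty (S.res o)) X 𝒯') X 𝒯' :=
  (𝓢).hbProj S 𝒯' X o

/-- The handler given by an element of the object of algebra structures. -/
noncomputable def ofAlg (h : Cl Γ (.val ((𝓢).hb S 𝒯' X))) : CHdl Γ S X 𝒯' := fun o =>
  .app (act (algProj S 𝒯' X o) (h.subst (comp (shift Γ _) (shift _ _))))
    (.pair (.cast (synTypes_gty _).symm (.var (.succ .zero)))
      (.cast (fn_gty _ _ _).symm (.var .zero)))

theorem ofAlg_subst (h : Cl Γ (.val ((𝓢).hb S 𝒯' X))) (σ : CSub Γ Δ) :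
    (ofAlg h).subst σ = ofAlg (h.subst σ) := by
  funext o
  simp [ofAlg, CHdl.subst_apply]

theorem ofAlg_inst (h : Cl Γ (.val ((𝓢).hb S 𝒯' X))) (o : S.Idx) (v : Cl Γ (.val (S.argTy o)))
    (k : Cl Γ (.val (.fn (S.resTy o) X 𝒯'))) :
    (ofAlg h o).subst (cons (cons (ids Γ) v) k) =
      .app (act (algProj S 𝒯' X o) h)
        (.pair (.cast (synTypes_gty _).symm v) (.cast (fn_gty _ _ _).symm k)) := by
  simp [ofAlg]

theorem act_shuffle {H D K A : Ty Base Op} (h : Cl Γ (.val H)) (d : Cl Γ (.val D))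
    (k : Cl Γ (.val K)) (a : Cl Γ (.val A)) :
    act (TypeModel.shuffle H D K A) (.pair (.pair h (.pair d k)) a) =
      .pair h (.pair (.pair d a) k) := by
  simp [TypeModel.shuffle]

theorem run_act_algRet {H D A : Ty Base Op} (V : D ⟶ A) (h : Cl Γ (.val H)) (d : Cl Γ (.val D))
    (k : Cl Γ (.val (.fn A X 𝒯'))) :
    Cl.run (act (snd H _ ≫ lift (snd _ _) (fst _ _ ≫ V) ≫ (𝓢).ev 𝒯' A X)
      (.pair h (.pair d k))) = .app k (act V d) := by
  simp

theorem run_act_algLetop {H D K P R : Ty Base Op} (p : H ⟶ .fn (P ⊗ .fn R X 𝒯') X 𝒯')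
    (V : D ⟶ P) (g : H ⊗ ((D ⊗ R) ⊗ K) ⟶ thunkTy 𝒯' X) (h : Cl Γ (.val H)) (d : Cl Γ (.val D))
    (k : Cl Γ (.val K)) :
    Cl.run (act (lift (fst H _ ≫ p) (lift (snd _ _ ≫ fst _ _ ≫ V)
      ((𝓢).curry (𝒯 := 𝒯') (TypeModel.shuffle _ _ _ _ ≫ g))) ≫ (𝓢).ev 𝒯' _ X)
        (.pair h (.pair d k))) =
      .app (act p h) (.pair (act V d) (.lam (.run (act g (.pair (h.subst (shift Γ _))
        (.pair (.pair (d.subst (shift Γ _)) (.var .zero)) (k.subst (shift Γ _)))))))) := by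
  have : Cl.run (act (lift (fst H _ ≫ p) (lift (snd _ _ ≫ fst _ _ ≫ V)
      (curryHom (TypeModel.shuffle _ _ _ _ ≫ g))) ≫ (𝓢).ev 𝒯' _ X) (.pair h (.pair d k))) =
      .app (act p h) (.pair (act V d) (.lam (.run (act g (.pair (h.subst (shift Γ _))
        (.pair (.pair (d.subst (shift Γ _)) (.var .zero)) (k.subst (shift Γ _)))))))) := by
    simp [act_shuffle]
  exact this

theorem run_act_algCase {H D K : Ty Base Op} {n : ℕ} {B : Fin n → Ty Base Op} (V : D ⟶ .sum B)
    (g : ∀ i, H ⊗ ((D ⊗ B i) ⊗ K) ⟶ thunkTy 𝒯' X) (h : Cl Γ (.val H)) (d : Cl Γ (.val D))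
    (k : Cl Γ (.val K)) :
    Cl.run (act (lift (𝟙 _) (snd H (D ⊗ K) ≫ fst _ _ ≫ V) ≫
      (𝓢).smCase (𝒯 := 𝒯') fun i => TypeModel.shuffle _ _ _ _ ≫ g i) (.pair h (.pair d k))) =
      .case (act V d) fun i => .run (act (g i) (.pair (h.subst (shift Γ _))
        (.pair (.pair (d.subst (shift Γ _)) (.var .zero)) (k.subst (shift Γ _))))) := by
  refine (run_act_synCase _ _ _).trans ?_
  simp [act_shuffle]

theorem run_act_algUncurried {G : List (GTy Base)} {A : GTy Base} (M : ETm S G A)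
    (h : Cl Γ (.val ((𝓢).hb S 𝒯' X))) (d : Cl Γ (.val ((𝓢).gctx G)))
    (k : Cl Γ (.val (.fn ((𝓢).gty A) X 𝒯'))) :
    Cl.run (act (Y := thunkTy 𝒯' X) ((𝓢).algUncurried 𝒯' X M) (.pair h (.pair d k))) =
      M.clHandle (ofAlg h) (components d) (.cast (fn_gty _ _ _) k) := by
  induction M generalizing Γ with
  | ret V =>
    rw [TypeModel.algUncurried]
    refine (run_act_algRet _ _ _ _).trans ?_
    rw [act_gtm, ETm.clHandle, Cl.app_cast (synTypes_gty _) rfl, Cl.ccast_rfl]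
  | @letop G A o V M ih =>
    rw [TypeModel.algUncurried]
    refine (run_act_algLetop (algProj S 𝒯' X o) _ _ _ _ _).trans ?_
    refine (congrArg (fun m => Cl.app _ (Cl.pair _ (Cl.lam m))) (ih _ _ _)).trans ?_
    rw [ETm.clHandle, ofAlg_inst, act_gtm, components_pair,
      Cl.cast_lam (synTypes_gty _).symm rfl]
    simp [ETm.clHandle_subst, ofAlg_subst, components_comp]
  | @case G A n B V M ih =>
    rw [TypeModel.algUncurried]
    refine (run_act_algCase _ _ _ _ _).trans ?_
    refine (congr (congrArg Cl.case (act_gtm V d)) (funext fun i => ih i _ _ _)).trans ?_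
    refine (Cl.case_cast (fun i => (synTypes_gty (B i)).symm) _ _ _).trans ?_
    refine congrArg _ (funext fun i => ?_)
    simp [ETm.clHandle_subst, ofAlg_subst, components_comp, components_pair]

theorem app_act_alg {G : List (GTy Base)} {A : GTy Base} (M : ETm S G A)
    (h : Z ⟶ (𝓢).hb S 𝒯' X) (v : Cl Γ (.val Z)) (d : Cl Γ (.val ((𝓢).gctx G)))
    (k : Cl Γ (.val (.fn ((𝓢).gty A) X 𝒯'))) :
    Cl.app (A := (𝓢).gctx G ⊗ Ty.fn ((𝓢).gty A) X 𝒯') (B := X) (𝒯 := 𝒯')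
      (act (h ≫ (𝓢).alg 𝒯' X M) v) (.pair d k) =
      M.clHandle (ofAlg (act h v)) (components d) (.cast (fn_gty _ _ _) k) := by
  rw [← run_act_algUncurried]
  set a : (𝓢).hb S 𝒯' X ⊗ ((𝓢).gctx G ⊗ Ty.fn ((𝓢).gty A) X 𝒯') ⟶ thunkTy 𝒯' X :=
    (𝓢).algUncurried 𝒯' X M
  have : Cl.app (act (h ≫ curryHom a) v) (.pair d k) = .run (act a (.pair (act h v) (.pair d k))) := by
    simp
  exact this

theorem sat_iff (h : Z ⟶ (𝓢).hb 𝒯.sig 𝒯' X) :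
    (𝓢).Sat 𝒯 𝒯' X h ↔ ∀ {Γ : Ctx Base Op} (v : Cl Γ (.val Z)),
      CHdl.Resp (𝒯 := 𝒯) (ofAlg (act h v)) := by
  constructor
  · intro hh Γ v e he Δ τ σ k
    obtain ⟨d, rfl⟩ := exists_components σ
    have h₁ := app_act_alg e.lhs h (v.subst τ) d (.cast (fn_gty _ _ _).symm k)
    have h₂ := app_act_alg e.rhs h (v.subst τ) d (.cast (fn_gty _ _ _).symm k)
    rw [hh e he] at h₁
    have := h₁.symm.trans h₂
    simpa [ofAlg_subst] using this
  · intro hh e he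
    refine clHom_ext fun {Γ} v => ?_
    have key : ∀ M : ETm 𝒯.sig e.ctx e.ty, act (h ≫ (𝓢).alg 𝒯' X M) v =
        Cl.lam (A := (𝓢).gctx e.ctx ⊗ Ty.fn ((𝓢).gty e.ty) X 𝒯') (B := X) (𝒯 := 𝒯')
          (M.clHandle (ofAlg (act h (v.subst (shift Γ _))))
            (components (.fst (.var .zero))) (.cast (fn_gty _ _ _) (.snd (.var .zero)))) := by
      intro M
      rw [← app_act_alg, Cl.pair_fst_snd, ← subst_act]
      exact (Cl.lam_app _).symm
    rw [key, key]
    have := hh v e he (shift Γ ((𝓢).gctx e.ctx ⊗ Ty.fn ((𝓢).gty e.ty) X 𝒯'))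
      (components (.fst (.var .zero))) (.cast (fn_gty _ _ _) (.snd (.var .zero)))
    rw [ofAlg_subst, subst_act] at this
    exact congrArg Cl.lam this

/-- Handling in the syntactic category. -/
noncomputable def handleHom (𝒯 𝒯' : Theory Base Op) (X : Ty Base Op)
    (h : Z ⟶ (𝓢).hb 𝒯.sig 𝒯' X) (hh : (𝓢).Sat 𝒯 𝒯' X h)
    (f : Z ⟶ thunkTy 𝒯 (thunkTy 𝒯' X)) : Z ⟶ thunkTy 𝒯' X :=
  ofCl (.thunk (.handle (.run (act f (.var .zero))) (ofAlg (act h (.var .zero)))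
    ((sat_iff h).1 hh _) (.run (.var .zero))))

theorem act_handleHom (h : Z ⟶ (𝓢).hb 𝒯.sig 𝒯' X) (hh : (𝓢).Sat 𝒯 𝒯' X h)
    (f : Z ⟶ thunkTy 𝒯 (thunkTy 𝒯' X)) (v : Cl Γ (.val Z)) :
    act (handleHom 𝒯 𝒯' X h hh f) v =
      .thunk (.handle (.run (act f v)) (ofAlg (act h v)) ((sat_iff h).1 hh _)
        (.run (.var .zero))) := by
  simp [handleHom, ofAlg_subst]

theorem handleHom_natural (h : Z ⟶ (𝓢).hb 𝒯.sig 𝒯' X) (hh : (𝓢).Sat 𝒯 𝒯' X h)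
    (f : Z ⟶ thunkTy 𝒯 (thunkTy 𝒯' X)) (g : W ⟶ Z) :
    g ≫ handleHom 𝒯 𝒯' X h hh f = handleHom 𝒯 𝒯' X (g ≫ h) (hh.comp g) (g ≫ f) :=
  clHom_ext fun v => by simp [act_handleHom]

theorem handleHom_unit (h : Z ⟶ (𝓢).hb 𝒯.sig 𝒯' X) (hh : (𝓢).Sat 𝒯 𝒯' X h)
    (f : Z ⟶ thunkTy 𝒯' X) : handleHom 𝒯 𝒯' X h hh (f ≫ thunkUnit 𝒯 _) = f :=
  clHom_ext fun v => by simp [act_handleHom]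

theorem handleHom_mul (h : Z ⟶ (𝓢).hb 𝒯.sig 𝒯' X) (hh : (𝓢).Sat 𝒯 𝒯' X h)
    (f : Z ⟶ thunkTy 𝒯 (thunkTy 𝒯 (thunkTy 𝒯' X))) :
    handleHom 𝒯 𝒯' X h hh (f ≫ thunkMul 𝒯 _) =
      handleHom 𝒯 𝒯' X h hh (lift (𝟙 Z) f ≫ thunkStr 𝒯 _ _ ≫
        thunkMap 𝒯 (handleHom 𝒯 𝒯' X (fst Z _ ≫ h) (hh.comp (fst Z _)) (snd _ _))) :=
  clHom_ext fun v => by simp [act_handleHom, ofAlg_subst]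

theorem handleHom_op (h : Z ⟶ (𝓢).hb 𝒯.sig 𝒯' X) (hh : (𝓢).Sat 𝒯 𝒯' X h) (o : 𝒯.sig.Idx)
    (f : Z ⟶ (𝓢).gty (𝒯.sig.arg o) ⊗ .fn ((𝓢).gty (𝒯.sig.res o)) X 𝒯') :
    handleHom 𝒯 𝒯' X h hh (f ≫ synOp 𝒯 o ▷ _ ≫ lift (snd _ _) (fst _ _) ≫
      thunkStr 𝒯 _ _ ≫ thunkMap 𝒯 ((𝓢).ev 𝒯' _ X)) =
      lift (h ≫ algProj 𝒯.sig 𝒯' X o) f ≫ (𝓢).ev 𝒯' _ X :=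
  clHom_ext fun {Γ} v => by
    have e : Cl.lam (.app (Cl.subst (.snd (act f v)) (shift Γ _))
        (.cast (synTypes_gty (𝒯.sig.res o)).symm (.var .zero))) =
        .cast (fn_gty _ _ _) (Cl.snd (act f v)) := by
      rw [← Cl.lam_app (.cast _ _), Cl.subst_cast, Cl.app_cast (synTypes_gty _) rfl, Cl.ccast_rfl]
    simp only [Cl.subst_snd, subst_act] at e
    simp [act_handleHom, Cl.letin_ccast, ofAlg_inst, e]

/-- The syntactic model. -/
@[reducible] noncomputable def synModel (Base Op : Type u) : Model Base Op (Ty Base Op) where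
  toTypeModel := synTypes Base Op
  op 𝒯 o := synOp 𝒯 o
  op_sat 𝒯 e he := clHom_ext fun v => Cl.run_injective (by
    rw [run_act_etm, run_act_etm, Cl.clInst_ax he])
  handle 𝒯 𝒯' X _ h hh f := handleHom 𝒯 𝒯' X h hh f
  handle_natural 𝒯 𝒯' X _ _ h hh f g := handleHom_natural h hh f g
  handle_unit 𝒯 𝒯' X _ h hh f := handleHom_unit h hh f
  handle_mul 𝒯 𝒯' X _ h hh f := handleHom_mul h hh f
  handle_op 𝒯 𝒯' X _ h hh o f := handleHom_op h hh o f

end SyntacticModel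

/-! ## The interpretation of terms in the syntactic model -/

theorem partPi_some {ι : Type u} {β : ι → Type v} (b : ∀ i, β i) :
    partPi (fun i => Part.some (b i)) = Part.some b :=
  Part.ext' ⟨fun _ => trivial, fun _ _ => trivial⟩ fun _ _ => rfl

theorem TypeModel.hbLift_hbProj {Base Op : Type u} {C : Type w} [Category.{v} C]
    [CartesianMonoidalCategory C] (𝓜 : TypeModel Base Op C) (S : Sig Base Op)
    (𝒯' : Theory Base Op) (X : C) {Z : C}
    (f : ∀ o : S.Idx,
      Z ⟶ 𝓜.kexp 𝒯' (𝓜.gty (S.arg o) ⊗ 𝓜.kexp 𝒯' (𝓜.gty (S.res o)) X) X) (o : S.Idx) :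
    𝓜.hbLift S 𝒯' X f ≫ 𝓜.hbProj S 𝒯' X o = f o := by
  have key : ∀ (o' : S.Idx) (h : o' = o), f o' ≫ eqToHom (by rw [h]) = f o := by
    rintro _ rfl
    simp
  rw [TypeModel.hbLift, TypeModel.hbProj, ← Category.assoc, 𝓜.prLift_proj]
  exact key _ (Equiv.symm_apply_apply _ _)

section Interpretation

variable {Base Op : Type u} {Γ Δ Ξ : Ctx Base Op} {X Y Z W : Ty Base Op} {𝒯 𝒯' : Theory Base Op}
  {S : Sig Base Op}

open CSub

local notation "𝓢" => synTypes Base Op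

/-- The components of an element of the interpretation of a context. -/
noncomputable def values (d : Cl Δ (.val ((𝓢).ctx Γ))) : CSub Γ Δ :=
  fun A x => .cast (synTypes_ty A) (act (varHom (𝓢).ty x) d)

theorem values_comp (d : Cl Δ (.val ((𝓢).ctx Γ))) (σ : CSub Δ Ξ) :
    comp (values d) σ = values (d.subst σ) := by
  funext A x
  simp [values, comp_apply]

theorem values_pair {A : Ty Base Op} (d : Cl Δ (.val ((𝓢).ctx Γ))) (v : Cl Δ (.val ((𝓢).ty A))) :
    values (Γ := A :: Γ) (.pair d v) = cons (values d) (.cast (synTypes_ty A) v) := by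
  refine CSub.ext_cons ?_ fun B x => ?_
  · refine congrArg (Cl.cast _) ((act_snd _).trans ?_)
    exact Cl.snd_pair _ _
  · refine congrArg (Cl.cast _) ((act_comp _ _ _).trans (congrArg _ ((act_fst _).trans ?_)))
    exact Cl.fst_pair _ _

theorem exists_values (σ : CSub Γ Δ) : ∃ d : Cl Δ (.val ((𝓢).ctx Γ)), values d = σ := by
  induction Γ with
  | nil => exact ⟨.unit, funext fun _ => funext fun x => nomatch x⟩
  | cons A Γ ih =>
    obtain ⟨d, hd⟩ := ih fun _ x => σ (.succ x)
    refine ⟨.pair d (.cast (synTypes_ty A).symm (σ .zero)), ?_⟩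
    rw [values_pair, hd]
    exact CSub.ext_cons (by simp) fun _ _ => rfl

/-- Terms as elements of the interpretation of their kind. -/
noncomputable def reify : ∀ {s : Kind Base Op}, Cl Γ s → Cl Γ (.val ((𝓢).kind s))
  | .val A, v => .cast (synTypes_ty A).symm v
  | .cmp A _, m => .thunk (.ccast (synTypes_ty A).symm m)

theorem reify_injective {s : Kind Base Op} {m n : Cl Γ s} (h : reify m = reify n) : m = n := by
  cases s with
  | val A =>
    have := congrArg (Cl.cast (synTypes_ty A)) h
    simpa [reify] using this
  | cmp A 𝒯 =>
    have := congrArg (Cl.ccast (synTypes_ty A)) (Cl.thunk_injective h)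
    simpa using this

theorem app_act_curryHom_assoc {A B : Ty Base Op} (g : (Z ⊗ A) ⊗ B ⟶ thunkTy 𝒯 X)
    (v : Cl Γ (.val Z)) (a : Cl Γ (.val A)) (b : Cl Γ (.val B)) :
    Cl.app (act (curryHom ((α_ Z A B).inv ≫ g)) v) (.pair a b) =
      .run (act g (.pair (.pair v a) b)) := by
  simp

theorem ofAlg_act_hbLift {B : Ty Base Op} {H : Hdl Γ S B 𝒯'} (hH : H.Wf)
    (m : ∀ o : S.Idx, ((𝓢).ctx Γ ⊗ (𝓢).gty (S.arg o)) ⊗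
      .fn ((𝓢).gty (S.res o)) ((𝓢).ty B) 𝒯' ⟶ thunkTy 𝒯' ((𝓢).ty B))
    (hm : ∀ (o : S.Idx) {Δ : Ctx Base Op}
      (d : Cl Δ (.val ((𝓢).ctx (.fn (S.resTy o) B 𝒯' :: S.argTy o :: Γ)))),
      act (m o) d = .thunk (.ccast (synTypes_ty B).symm ((Cl.mk (H o) (hH o)).subst (values d))))
    (d : Cl Δ (.val ((𝓢).ctx Γ))) :
    ofAlg (act ((𝓢).hbLift S 𝒯' ((𝓢).ty B) fun o =>
        (𝓢).curry (𝒯 := 𝒯') ((α_ _ _ _).inv ≫ m o)) d) =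
      ((CHdl.ofHdl H hH).subst (values d)).cast (synTypes_ty B).symm := by
  funext o
  have e : ∀ {Δ : Ctx Base Op} (d : Cl Δ (.val ((𝓢).ctx Γ))),
      act (algProj S 𝒯' ((𝓢).ty B) o) (act ((𝓢).hbLift S 𝒯' ((𝓢).ty B) fun o =>
        (𝓢).curry (𝒯 := 𝒯') ((α_ _ _ _).inv ≫ m o)) d) =
      act (curryHom ((α_ _ _ _).inv ≫ m o)) d := by
    intro Δ d
    rw [← act_comp]
    exact congrArg (act · d) (TypeModel.hbLift_hbProj _ _ _ _ _ _)
  rw [CHdl.cast_apply, ofAlg, subst_act, e, app_act_curryHom_assoc]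
  refine (congrArg Cl.run (hm o _)).trans ((Cl.run_thunk _).trans (congrArg _ ?_))
  refine (congrArg _ ((values_pair _ _).trans (congrArg (cons · _) (values_pair _ _)))).trans ?_
  simp [CHdl.subst_apply, CHdl.ofHdl, values_comp]
  exact congrArg (fun v => Cl.subst _ (cons _ v)) (Cl.cast_cast _ _ _)

theorem act_interpHandle (h : Z ⟶ (𝓢).hb 𝒯.sig 𝒯' X)
    (hh : (𝓢).Sat 𝒯 𝒯' X h) (f : Z ⟶ thunkTy 𝒯 Y) (g : Z ⊗ Y ⟶ thunkTy 𝒯' X)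
    (v : Cl Γ (.val Z)) :
    act (handleHom 𝒯 𝒯' X h hh (lift (𝟙 _) f ≫ thunkStr 𝒯 _ _ ≫ thunkMap 𝒯 g)) v =
      .thunk (.handle (.run (act f v)) (ofAlg (act h v)) ((sat_iff h).1 hh _)
        (.run (act g (.pair (v.subst (shift Γ _)) (.var .zero))))) := by
  simp [act_handleHom]

theorem Cl.handle_congr {A B : Ty Base Op} {m m' : Cl Γ (.cmp A 𝒯)} {h h' : CHdl Γ 𝒯.sig B 𝒯'}
    {n n' : Cl (A :: Γ) (.cmp B 𝒯')} (em : m = m') (eh : h = h') (en : n = n') (hr : h.Resp) :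
    handle m h hr n = handle m' h' (eh ▸ hr) n' := by
  subst em eh en; rfl

theorem exists_interp {Γ : Ctx Base Op} {s : Kind Base Op} {M : Tm Γ s} (hM : M.Wf) :
    ∃ m : (𝓢).ctx Γ ⟶ (𝓢).kind s, (synModel Base Op).interp M = Part.some m ∧
      ∀ {Δ : Ctx Base Op} (d : Cl Δ (.val ((𝓢).ctx Γ))),
        act m d = reify ((Cl.mk M hM).subst (values d)) := by
  match hM with
  | .var x =>
    refine ⟨_, rfl, fun d => ?_⟩
    rw [← Cl.var, Cl.subst_var, reify, values, Cl.cast_cast, Cl.cast_rfl]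
  | .lam h =>
    obtain ⟨m, hm, e⟩ := exists_interp h
    refine ⟨curryHom m, ?_, fun d => ?_⟩
    · rw [Model.interp, hm]; exact Part.map_some _ _
    · refine (act_curryHom _ _).trans ((congrArg (fun v => Cl.lam (Cl.run v)) (e _)).trans ?_)
      rw [← Cl.lam_mk h, Cl.subst_lam, reify]
      refine Eq.trans ?_ (Cl.cast_lam (synTypes_ty _).symm (synTypes_ty _).symm _ _).symm
      rw [reify, Cl.run_thunk, values_pair]
      simp [values_comp]
  | .tuple h =>
    choose m hm e using fun i => exists_interp (h i)
    refine ⟨tupleHom m, ?_, fun d => ?_⟩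
    · rw [Model.interp, funext hm, partPi_some]; exact Part.map_some _ _
    · refine (act_tupleHom _ _).trans ((congrArg Cl.tuple (funext fun i => e i d)).trans ?_)
      rw [← Cl.tuple_mk h, Cl.subst_tuple, reify]
      exact Cl.tuple_cast (fun i => (synTypes_ty _).symm) _ _
  | .proj (A := A) i h =>
    obtain ⟨m, hm, e⟩ := exists_interp h
    refine ⟨m ≫ projHom (fun i => (𝓢).ty (A i)) i, ?_, fun d => ?_⟩
    · rw [Model.interp, hm]; exact Part.map_some _ _
    · refine (act_comp _ _ _).trans ((act_projHom _ _ _).trans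
        ((congrArg (Cl.proj (A := fun i => (𝓢).ty (A i)) i) (e d)).trans ?_))
      rw [← Cl.proj_mk i h, Cl.subst_proj, reify, reify]
      exact Cl.proj_cast (fun i => (synTypes_ty _).symm) _ _ _
  | .inj (A := A) i h =>
    obtain ⟨m, hm, e⟩ := exists_interp h
    refine ⟨m ≫ injHom (fun i => (𝓢).ty (A i)) i, ?_, fun d => ?_⟩
    · rw [Model.interp, hm]; exact Part.map_some _ _
    · refine (act_comp _ _ _).trans ((act_injHom _ _ _).trans
        ((congrArg (Cl.inj (A := fun i => (𝓢).ty (A i)) i) (e d)).trans ?_))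
      rw [← Cl.inj_mk i h, Cl.subst_inj, reify, reify]
      exact Cl.inj_cast (fun i => (synTypes_ty (A i)).symm) _ _ _
  | .app h h' =>
    obtain ⟨v, hv, e⟩ := exists_interp h
    obtain ⟨w, hw, e'⟩ := exists_interp h'
    refine ⟨lift v w ≫ (𝓢).ev _ _ _, ?_, fun d => ?_⟩
    · rw [Model.interp, hv, hw]; exact (Part.bind_some _ _).trans (Part.map_some _ _)
    · refine (act_comp _ _ _).trans ((congrArg _ (act_lift _ _ _)).trans ((act_synEv _).trans ?_))
      rw [← Cl.app_mk h h', Cl.subst_app, reify]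
      refine congrArg Cl.thunk ((congrArg₂ Cl.app ((Cl.fst_pair _ _).trans (e d))
        ((Cl.snd_pair _ _).trans (e' d))).trans ?_)
      refine (Cl.app_cast (synTypes_ty _).symm (synTypes_ty _).symm _ _ _).trans ?_
      rw [reify, Cl.cast_cast, Cl.cast_rfl]
  | .ret h =>
    obtain ⟨v, hv, e⟩ := exists_interp h
    refine ⟨v ≫ thunkUnit _ _, ?_, fun d => ?_⟩
    · rw [Model.interp, hv, Part.map_some]
    · refine (act_comp _ _ _).trans ((act_thunkUnit _).trans ((congrArg (fun v => Cl.thunk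
        (Cl.ret v)) (e d)).trans ?_))
      rw [← Cl.ret_mk h, Cl.subst_ret, reify, reify, Cl.ret_cast]
  | .letin h h' =>
    obtain ⟨m, hm, e⟩ := exists_interp h
    obtain ⟨n, hn, e'⟩ := exists_interp h'
    refine ⟨(𝓢).bind m n, ?_, fun d => ?_⟩
    · rw [Model.interp, hm, hn]; exact (Part.bind_some _ _).trans (Part.map_some _ _)
    · refine Cl.run_injective ((run_act_synBind _ _ _).trans
        ((congrArg₂ (fun v w => Cl.letin (Cl.run v) (Cl.run w)) (e d) (e' _)).trans ?_))
      rw [← Cl.letin_mk h h', Cl.subst_letin, reify, reify, reify, values_pair]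
      simp [Cl.letin_ccast, Cl.ccast_letin, values_comp]
  | .op o h =>
    obtain ⟨v, hv, e⟩ := exists_interp h
    refine ⟨v ≫ synOp _ o, ?_, fun d => ?_⟩
    · rw [Model.interp, hv, Part.map_some]
    · refine (act_comp _ _ _).trans ((act_synOp _ _).trans ?_)
      rw [e, ← Cl.op_mk o h, Cl.subst_op, reify, reify, Cl.cast_cast, Cl.cast_rfl]
  | .case (A := A) h h' =>
    obtain ⟨v, hv, e⟩ := exists_interp h
    choose m hm e' using fun i => exists_interp (h' i)
    refine ⟨lift (𝟙 _) v ≫ (𝓢).smCase (X := fun i => (𝓢).ty (A i)) m, ?_, fun d => ?_⟩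
    · rw [Model.interp, hv, funext hm, partPi_some]
      exact (Part.bind_some _ _).trans (Part.map_some _ _)
    · refine Cl.run_injective ((run_act_synCase _ _ _).trans
        ((congr (congrArg Cl.case (e d)) (funext fun i => congrArg Cl.run (e' i _))).trans ?_))
      rw [← Cl.case_mk h h', Cl.subst_case, reify, reify]
      refine (Cl.case_cast (fun i => (synTypes_ty (A i)).symm) _ _ _).trans ?_
      rw [Cl.run_thunk, Cl.ccast_case]
      refine congrArg _ (funext fun i => ?_)
      rw [reify, Cl.run_thunk, values_pair]
      simp [values_comp]
  | .handle (B := B) (𝒯 := 𝒯) (𝒯' := 𝒯') (H := H) h hH hr h' =>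
    obtain ⟨m, hm, e⟩ := exists_interp h
    obtain ⟨n, hn, e'⟩ := exists_interp h'
    choose c hc ec using fun o => exists_interp (hH o)
    have hcl : (synModel Base Op).clauses (Z := (𝓢).ctx Γ)
        (fun o => (synModel Base Op).interp (H o)) =
        Part.some ((𝓢).hbLift 𝒯.sig 𝒯' ((𝓢).ty B) fun o =>
          (𝓢).curry (𝒯 := 𝒯') ((α_ _ _ _).inv ≫ c o)) := by
      rw [funext hc]
      exact (congrArg _ (partPi_some _)).trans (Part.map_some _ _)
    have eH := fun {Δ : Ctx Base Op} (d : Cl Δ (.val ((𝓢).ctx Γ))) =>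
      ofAlg_act_hbLift (H := H) hH c ec d
    have hr' : CHdl.Resp (𝒯 := 𝒯) (CHdl.ofHdl H hH) := (CHdl.resp_ofHdl hH).2 hr
    have hs := (sat_iff (𝒯 := 𝒯) ((𝓢).hbLift 𝒯.sig 𝒯' ((𝓢).ty B) fun o =>
          (𝓢).curry (𝒯 := 𝒯') ((α_ _ _ _).inv ≫ c o))).2 fun v => by
      rw [eH]
      exact (hr'.subst _).cast _
    refine ⟨handleHom 𝒯 𝒯' ((𝓢).ty B) _ hs (lift (𝟙 _) m ≫ thunkStr 𝒯 _ _ ≫ thunkMap 𝒯 n),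
      ?_, fun d => ?_⟩
    · rw [Model.interp, hm, hn, hcl, Part.bind_some, Part.bind_some, Part.bind_some,
        Part.assert_pos hs]
    · refine (act_interpHandle _ _ _ _ _).trans ?_
      rw [← Cl.handle_mk h hH hr' h', Cl.subst_handle, reify, Cl.ccast_handle]
      refine congrArg Cl.thunk ((Cl.handle_congr (congrArg Cl.run (e d)) (eH d)
        (congrArg Cl.run (e' _)) _).trans ?_)
      refine (Cl.handle_congr (Cl.run_thunk _) rfl (Cl.run_thunk _) _).trans ?_
      refine (Cl.handle_ccast _ _ _ _ _).trans (Cl.handle_congr rfl rfl ?_ _)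
      rw [values_pair]
      simp [values_comp]

theorem equ_of_interp_eq {s : Kind Base Op} {M N : Tm Γ s} (hM : M.Wf) (hN : N.Wf)
    (h : (synModel Base Op).interp M = (synModel Base Op).interp N) : M.Equ N := by
  obtain ⟨m, hm, e⟩ := exists_interp hM
  obtain ⟨n, hn, e'⟩ := exists_interp hN
  rw [hm, hn] at h
  obtain rfl := Part.some_injective h
  obtain ⟨d, hd⟩ := exists_values (ids Γ)
  have := (e d).symm.trans (e' d)
  rw [hd, Cl.subst_ids, Cl.subst_ids] at this
  exact Cl.mk_eq_mk.1 (reify_injective this)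

theorem exists_interpHdl {B : Ty Base Op} {H : Hdl Γ S B 𝒯'} (hH : H.Wf) :
    ∃ h : (𝓢).ctx Γ ⟶ (𝓢).hb S 𝒯' ((𝓢).ty B), (synModel Base Op).interpHdl H = Part.some h ∧
      ∀ {Δ : Ctx Base Op} (d : Cl Δ (.val ((𝓢).ctx Γ))),
        ofAlg (act h d) = ((CHdl.ofHdl H hH).subst (values d)).cast (synTypes_ty B).symm := by
  choose c hc ec using fun o => exists_interp (hH o)
  refine ⟨(𝓢).hbLift S 𝒯' ((𝓢).ty B) fun o => (𝓢).curry (𝒯 := 𝒯') ((α_ _ _ _).inv ≫ c o), ?_,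
    ofAlg_act_hbLift hH c ec⟩
  rw [Model.interpHdl, funext hc]
  exact (congrArg _ (partPi_some _)).trans (Part.map_some _ _)

theorem equ_of_interpHdl_eq {B : Ty Base Op} {H H' : Hdl Γ S B 𝒯'} (hH : H.Wf) (hH' : H'.Wf)
    (h : (synModel Base Op).interpHdl H = (synModel Base Op).interpHdl H') : H.Equ H' := by
  obtain ⟨m, hm, e⟩ := exists_interpHdl hH
  obtain ⟨n, hn, e'⟩ := exists_interpHdl hH'
  rw [hm, hn] at h
  obtain rfl := Part.some_injective h
  obtain ⟨d, hd⟩ := exists_values (ids Γ)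
  have := (e d).symm.trans (e' d)
  rw [hd, CHdl.subst_ids, CHdl.subst_ids] at this
  have key : ∀ {X Y : Ty Base Op} (h : X = Y) {K K' : CHdl Γ S X 𝒯'},
      K.cast h = K'.cast h → K = K' := by
    rintro X _ rfl K K' h
    exact h
  exact fun o => Cl.mk_eq_mk.1 (congrFun (key _ this) o)

end Interpretation

end EffCalc

theorem mainTheorem3 (Base Op : Type u) (Γ : EffCalc.Ctx Base Op) :
    (∀ (A : EffCalc.Ty Base Op) (V W : EffCalc.Val Γ A), V.Wf → W.Wf →
      (∀ (C : Type u) [Category.{u} C] [CartesianMonoidalCategory C]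
        (𝓜 : EffCalc.Model Base Op C), 𝓜.interp V = 𝓜.interp W) →
      EffCalc.Tm.Equ V W) ∧
    (∀ (A : EffCalc.Ty Base Op) (𝒯 : EffCalc.Theory Base Op) (M N : EffCalc.Cmp Γ A 𝒯),
      M.Wf → N.Wf →
      (∀ (C : Type u) [Category.{u} C] [CartesianMonoidalCategory C]
        (𝓜 : EffCalc.Model Base Op C), 𝓜.interp M = 𝓜.interp N) →
      EffCalc.Tm.Equ M N) ∧
    (∀ (S : EffCalc.Sig Base Op) (A : EffCalc.Ty Base Op) (𝒯 : EffCalc.Theory Base Op)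
      (H H' : EffCalc.Hdl Γ S A 𝒯), H.Wf → H'.Wf →
      (∀ (C : Type u) [Category.{u} C] [CartesianMonoidalCategory C]
        (𝓜 : EffCalc.Model Base Op C), 𝓜.interpHdl H = 𝓜.interpHdl H') →
      H.Equ H') :=
  ⟨fun _ _ _ hV hW h => EffCalc.equ_of_interp_eq hV hW (h _ (EffCalc.synModel Base Op)),
    fun _ _ _ _ hM hN h => EffCalc.equ_of_interp_eq hM hN (h _ (EffCalc.synModel Base Op)),
    fun _ _ _ _ _ hH hH' h =>
      EffCalc.equ_of_interpHdl_eq hH hH' (h _ (EffCalc.synModel Base Op))⟩
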